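/- **Notation.** Let $\mathcal P$ be the set of all integer partitions, $\nu^t$ the conjugate of $\nu$, $|\nu|$ its size, $\kappa(\nu)=\sum_i\nu_i(\nu_i-2i+1)$, and put $\nu_i=0$ for $i>l(\nu)$. For an integer $t>1$, $\nu$ is a $t$-core if none of its hook lengths is a multiple of $t$; $\mathcal P_{t\text{-core}}$ is the set of $t$-cores. Let $s_{\lambda/\mu}$ be the skew Schur functions, $s_\lambda=s_{\lambda/\emptyset}$, and let $s_{\lambda/\mu}(q^{\nu+\rho})$ be the evaluation at $x_i=q^{\nu_i-i+1/2}$, $i\ge1$; it is a rational function of $q^{1/2}$, given by the expansion for $|q|>1$. The topological vertex is the rational function of $q^{1/2}$ $$C_{\lambda,\mu,\nu}(q)=q^{\kappa(\lambda)/2+\kappa(\nu)/2}\,s_{\nu^t}(q^{\rho})\sum_{\eta\in\mathcal P}s_{\lambda^t/\eta}(q^{\nu+\rho})\,s_{\mu/\eta}(q^{\nu^t+\rho}).$$ Define $$Z(Q;Q_1,q)=\sum_{\mu,\nu\in\mathcal P}(-Q_1)^{|\mu|}(-Q)^{|\nu|}C_{\emptyset,\mu^t,\nu}(q)\,C_{\emptyset,\mu,\nu^t}(q),$$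 $$Z(Q;Q_1,q;s_1,\dots,s_n)=\frac{1}{Z(Q;Q_1,q)}\sum_{\mu,\nu\in\mathcal P}(-Q_1)^{|\mu|}(-Q)^{|\nu|}C_{\emptyset,\mu^t,\nu}(q)\,C_{\emptyset,\mu,\nu^t}(q)\prod_{j=1}^n\sum_{i=1}^\infty s_j^{\nu_i-i+\frac12},$$ $$F_t(Q;s_1,\dots,s_n)=\frac{1}{\sum_{\nu\in\mathcal P_{t\text{-core}}}Q^{|\nu|}}\sum_{\nu\in\mathcal P_{t\text{-core}}}Q^{|\nu|}\prod_{j=1}^n\sum_{i=1}^\infty s_j^{\nu_i-i+\frac12}.$$ **Theorem 1.1.** Let $t>1$ be an integer, $\xi_t\in\mathbb C$ a primitive $t$-th root of unity, $n\ge0$, and let $Q,s_1,\dots,s_n\in\mathbb C$ satisfy $|s_j|>1$ for all $j$ and $|Q|\prod_{j=1}^n|s_j|<1$. Fix any square roots $s_j^{1/2}$ and, for each $q\in(0,1)$, any square root of $\xi_tq$. Then all the sums over $i$ above converge absolutely, and so do the two sums over $t$-cores in $F_t(Q;s_1,\dots,s_n)$, with $\sum_{\nu\in\mathcal P_{t\text{-core}}}Q^{|\nu|}\neq0$.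 For every $q\in(0,1)$ the two sums over pairs $(\mu,\nu)$ that define $Z(Q;q^t,\xi_tq)$ and $Z(Q;q^t,\xi_tq;s_1,\dots,s_n)$ converge absolutely, and $Z(Q;q^t,\xi_tq)\ne0$ for all $q<1$ close enough to $1$. Moreover, $$F_t(Q;s_1,\dots,s_n)=\lim_{q\to1^-}Z(Q;q^t,\xi_tq;s_1,\dots,s_n).$$ -/

import Mathlib

open Filter Topology
open scoped BigOperators

noncomputable section

namespace TCore

/-! Integer partitions are Young diagrams `ν : YoungDiagram`. Rows and columns are numbered
from `0`, so that `ν.rowLen i` is the part `ν_{i+1}` (it is `0` for `i ≥ l(ν)`), `ν.colLen 0` is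
the length `l(ν)`, `ν.card` is the size `|ν|`, `ν.transpose` is the conjugate partition and `⊥`
is the empty partition. -/

/-- The hook length of the box `c` of `ν`: arm plus leg plus one. -/
def hookLength (ν : YoungDiagram) (c : ℕ × ℕ) : ℕ :=
  (ν.rowLen c.1 - (c.2 + 1)) + (ν.colLen c.2 - (c.1 + 1)) + 1

/-- A partition is a `t`-core if none of its hook lengths is a multiple of `t`. -/
def IsTCore (t : ℕ) (ν : YoungDiagram) : Prop :=
  ∀ c ∈ ν.cells, ¬ t ∣ hookLength ν c

/-- Half of `κ(ν) = ∑_i ν_i (ν_i - 2 i + 1)`, i.e. the sum of the contents of the boxes. -/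
def halfKappa (ν : YoungDiagram) : ℤ :=
  ∑ c ∈ ν.cells, ((c.2 : ℤ) - (c.1 : ℤ))

/-- Twice the half-integer `ν_i - i + 1/2`, where `i` is counted from `1` in this formula
and from `0` in the code. -/
def twiceMaya (ν : YoungDiagram) (i : ℕ) : ℤ :=
  2 * (ν.rowLen i : ℤ) - 2 * (i : ℤ) - 1

/-- The power sum `p_k` at the point `q^{ν+ρ} = (q^{ν_1-1/2}, q^{ν_2-3/2}, …)`, for `k ≥ 1`, as a
rational function of `v = q^{1/2}`: the finitely many terms with `i ≤ l(ν)` are compared with those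
of the empty partition, and `∑_{i ≥ 1} q^{k(-i+1/2)} = 1 / (q^{k/2} - q^{-k/2})`. -/
def powerSum (ν : YoungDiagram) (v : ℂ) (k : ℕ) : ℂ :=
  (∑ i ∈ Finset.range (ν.colLen 0),
      (v ^ ((k : ℤ) * twiceMaya ν i) - v ^ ((k : ℤ) * twiceMaya ⊥ i)))
    + 1 / (v ^ (k : ℤ) - v ^ (-(k : ℤ)))

/-- The complete symmetric functions `h_r` with power sums `p_k` (for `k ≥ 1`), i.e. the
coefficients of `∏_i 1 / (1 - x_i z) = exp (∑_{k ≥ 1} p_k z^k / k)`, through the recursion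
`r h_r = ∑_{k=1}^{r} p_k h_{r-k}`. -/
def completeH (p : ℕ → ℂ) : ℕ → ℂ
  | 0 => 1
  | r + 1 => (∑ k : Fin (r + 1), p ((k : ℕ) + 1) * completeH p (r - (k : ℕ))) / ((r : ℂ) + 1)
termination_by r => r
decreasing_by omega

/-- `h_m` for an integer index `m`; it is `0` for `m < 0`. -/
def completeHInt (p : ℕ → ℂ) (m : ℤ) : ℂ :=
  if m < 0 then 0 else completeH p m.toNat

/-- The skew Schur function `s_{lam/μ} = det (h_{lam_i - μ_j - i + j})`, the determinant having
size `max (l(lam)) (l(μ))`, as a function of the power sums. -/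
def skewSchur (lam μ : YoungDiagram) (p : ℕ → ℂ) : ℂ :=
  Matrix.det (Matrix.of
    fun i j : Fin (max (lam.colLen 0) (μ.colLen 0)) =>
      completeHInt p
        ((lam.rowLen (i : ℕ) : ℤ) - (μ.rowLen (j : ℕ) : ℤ) - ((i : ℕ) : ℤ) + ((j : ℕ) : ℤ)))

/-- The Schur function `s_lam = s_{lam/∅}`. -/
def schur (lam : YoungDiagram) (p : ℕ → ℂ) : ℂ := skewSchur lam ⊥ p

/-- The topological vertex
`C_{lam,μ,ν}(q) = q^{κ(lam)/2+κ(ν)/2} s_{ν^t}(q^ρ) ∑_η s_{lam^t/η}(q^{ν+ρ}) s_{μ/η}(q^{ν^t+ρ})`,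
a rational function of `v = q^{1/2}`. The sum over `η` has finite support, since `s_{μ/η} = 0`
unless `η ⊆ μ`. -/
def topVertex (lam μ ν : YoungDiagram) (v : ℂ) : ℂ :=
  (v ^ 2) ^ (halfKappa lam + halfKappa ν) * schur ν.transpose (powerSum ⊥ v) *
    ∑ᶠ η : YoungDiagram,
      skewSchur lam.transpose η (powerSum ν v) * skewSchur μ η (powerSum ν.transpose v)

/-- `∏_j ∑_{i ≥ 1} s_j^{ν_i - i + 1/2}`, where `r j` is the chosen square root of `s_j`. -/
def pointProd {n : ℕ} (ν : YoungDiagram) (r : Fin n → ℂ) : ℂ :=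
  ∏ j, ∑' i : ℕ, r j ^ twiceMaya ν i

/-- The summand of the `q`-deformed partition function, for the pair `x = (μ, ν)`. -/
def zTerm (Q Q₁ v : ℂ) (x : YoungDiagram × YoungDiagram) : ℂ :=
  (-Q₁) ^ x.1.card * (-Q) ^ x.2.card * topVertex ⊥ x.1.transpose x.2 v *
    topVertex ⊥ x.1 x.2.transpose v

/-- The `q`-deformed partition function `Z(Q; Q₁, q)`, with `v = q^{1/2}`. -/
def partitionZ (Q Q₁ v : ℂ) : ℂ := ∑' x : YoungDiagram × YoungDiagram, zTerm Q Q₁ v x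

/-- The `q`-deformed `n`-point function `Z(Q; Q₁, q; s_1, …, s_n)`, with `v = q^{1/2}` and
`r j = s_j^{1/2}`. -/
def nPointZ {n : ℕ} (Q Q₁ v : ℂ) (r : Fin n → ℂ) : ℂ :=
  1 / partitionZ Q Q₁ v *
    ∑' x : YoungDiagram × YoungDiagram, zTerm Q Q₁ v x * pointProd x.2 r

/-- The generating function `∑_ν Q^{|ν|}` of `t`-cores. -/
def coreSum (t : ℕ) (Q : ℂ) : ℂ := ∑' ν : {ν : YoungDiagram // IsTCore t ν}, Q ^ ν.1.card

/-- The `n`-point function `F_t(Q; s_1, …, s_n)` of `t`-core partitions, with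
`r j = s_j^{1/2}`. -/
def nPointF {n : ℕ} (t : ℕ) (Q : ℂ) (r : Fin n → ℂ) : ℂ :=
  1 / coreSum t Q *
    ∑' ν : {ν : YoungDiagram // IsTCore t ν}, pointProd ν.1 r * Q ^ ν.1.card

/-- In the region `|q| > 1`, where the series of the power sum converges, `powerSum` is its
value. -/
theorem hasSum_powerSum (ν : YoungDiagram) (v : ℂ) (hv : 1 < ‖v‖) (k : ℕ) (hk : 1 ≤ k) :
    HasSum (fun i : ℕ => v ^ ((k : ℤ) * twiceMaya ν i)) (powerSum ν v k) := by
  have hv0 : v ≠ 0 := by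
    intro h
    rw [h, norm_zero] at hv
    linarith
  have hvk0 : v ^ k ≠ 0 := pow_ne_zero _ hv0
  have hlt : 1 < ‖v ^ k‖ := by
    rw [norm_pow]
    exact one_lt_pow₀ hv (by omega)
  have hlt2 : ‖((v ^ k)⁻¹) ^ 2‖ < 1 := by
    rw [norm_pow, norm_inv]
    exact pow_lt_one₀ (by positivity) (inv_lt_one_of_one_lt₀ hlt) two_ne_zero
  have hne : 1 - ((v ^ k)⁻¹) ^ 2 ≠ 0 := by
    intro h
    have h1 : ((v ^ k)⁻¹) ^ 2 = 1 := (sub_eq_zero.mp h).symm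
    rw [h1, norm_one] at hlt2
    exact lt_irrefl _ hlt2
  have hbot : ∀ i : ℕ, v ^ ((k : ℤ) * twiceMaya ⊥ i) = (v ^ k)⁻¹ * (((v ^ k)⁻¹) ^ 2) ^ i := by
    intro i
    have hr : (⊥ : YoungDiagram).rowLen i = 0 := by
      rw [YoungDiagram.rowLen_eq_card, Finset.card_eq_zero]
      ext c
      simp [YoungDiagram.mem_row_iff]
    have he : (k : ℤ) * twiceMaya ⊥ i = -((k * (2 * i + 1) : ℕ) : ℤ) := by
      simp only [twiceMaya, hr]
      push_cast
      ring
    rw [he, zpow_neg, zpow_natCast, pow_mul, ← inv_pow, pow_succ, pow_mul, mul_comm]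
  have h0 : HasSum (fun i : ℕ => v ^ ((k : ℤ) * twiceMaya ⊥ i))
      (1 / (v ^ (k : ℤ) - v ^ (-(k : ℤ)))) := by
    have hg := (hasSum_geometric_of_norm_lt_one hlt2).mul_left ((v ^ k)⁻¹)
    have hval : (v ^ k)⁻¹ * (1 - ((v ^ k)⁻¹) ^ 2)⁻¹ = 1 / (v ^ (k : ℤ) - v ^ (-(k : ℤ))) := by
      rw [zpow_neg, zpow_natCast, one_div, ← mul_inv]
      congr 1
      field_simp
    rw [← hval]
    simpa only [hbot] using hg
  have hfin : HasSum
      (fun i : ℕ => v ^ ((k : ℤ) * twiceMaya ν i) - v ^ ((k : ℤ) * twiceMaya ⊥ i))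
      (∑ i ∈ Finset.range (ν.colLen 0),
        (v ^ ((k : ℤ) * twiceMaya ν i) - v ^ ((k : ℤ) * twiceMaya ⊥ i))) := by
    apply hasSum_sum_of_ne_finset_zero
    intro i hi
    have hz : ∀ μ : YoungDiagram, (i, 0) ∉ μ → μ.rowLen i = 0 := by
      intro μ h
      rw [YoungDiagram.mem_iff_lt_rowLen] at h
      omega
    have h1 : ν.rowLen i = 0 := by
      apply hz
      rw [YoungDiagram.mem_iff_lt_colLen]
      simpa using hi
    have h2 : (⊥ : YoungDiagram).rowLen i = 0 := hz _ (YoungDiagram.notMem_bot _)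
    simp [twiceMaya, h1, h2]
  have := hfin.add h0
  simpa [powerSum] using this

end TCore

end

noncomputable section

namespace TCore

/-! ### Young diagrams through their row lengths -/

theorem lt_rowLen_iff_lt_colLen {ν : YoungDiagram} {i j : ℕ} :
    j < ν.rowLen i ↔ i < ν.colLen j := by
  rw [← YoungDiagram.mem_iff_lt_rowLen, YoungDiagram.mem_iff_lt_colLen]

theorem colLen_le_iff {ν : YoungDiagram} {i j : ℕ} : ν.colLen j ≤ i ↔ ν.rowLen i ≤ j := by
  rw [← not_lt, ← not_lt, lt_rowLen_iff_lt_colLen]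

@[simp]
theorem rowLen_bot (i : ℕ) : (⊥ : YoungDiagram).rowLen i = 0 := by
  by_contra h
  exact YoungDiagram.notMem_bot (i, 0) (YoungDiagram.mem_iff_lt_rowLen.2 (Nat.pos_of_ne_zero h))

@[simp]
theorem colLen_bot (i : ℕ) : (⊥ : YoungDiagram).colLen i = 0 := by
  by_contra h
  exact YoungDiagram.notMem_bot (0, i) (YoungDiagram.mem_iff_lt_colLen.2 (Nat.pos_of_ne_zero h))

@[simp]
theorem transpose_bot : (⊥ : YoungDiagram).transpose = ⊥ := by
  ext c
  simp

@[simp]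
theorem card_bot : (⊥ : YoungDiagram).card = 0 := rfl

@[simp]
theorem card_transpose (ν : YoungDiagram) : ν.transpose.card = ν.card := by
  unfold YoungDiagram.card
  apply Finset.card_bij (fun c _ => c.swap)
  · intro c hc
    simpa using hc
  · intro a _ b _ h
    exact Prod.swap_injective h
  · intro c hc
    exact ⟨c.swap, by simpa using hc, by simp⟩

theorem rowLen_eq_zero {ν : YoungDiagram} {i : ℕ} (h : ν.colLen 0 ≤ i) : ν.rowLen i = 0 :=
  Nat.le_zero.1 (colLen_le_iff.1 h)

theorem ext_rowLen {μ ν : YoungDiagram} (h : ∀ i, μ.rowLen i = ν.rowLen i) : μ = ν := by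
  ext ⟨i, j⟩
  simp only [YoungDiagram.mem_cells, YoungDiagram.mem_iff_lt_rowLen, h]

theorem le_iff_rowLen {μ ν : YoungDiagram} : μ ≤ ν ↔ ∀ i, μ.rowLen i ≤ ν.rowLen i := by
  constructor
  · intro h i
    by_contra hlt
    have h1 : (i, ν.rowLen i) ∈ μ := YoungDiagram.mem_iff_lt_rowLen.2 (not_le.1 hlt)
    exact lt_irrefl _ (YoungDiagram.mem_iff_lt_rowLen.1 (h h1))
  · rintro h ⟨i, j⟩ hc
    exact YoungDiagram.mem_iff_lt_rowLen.2 ((YoungDiagram.mem_iff_lt_rowLen.1 hc).trans_le (h i))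

/-- The Young diagram with prescribed row lengths. -/
def ofRowLen (f : ℕ → ℕ) (hf : Antitone f) (N : ℕ) (_hN : f N = 0) :
    YoungDiagram where
  cells := (Finset.range N ×ˢ Finset.range (f 0)).filter fun c => c.2 < f c.1
  isLowerSet := by
    rintro ⟨i, j⟩ ⟨i', j'⟩ h hc
    obtain ⟨h1, h2⟩ := Prod.mk_le_mk.1 h
    simp only [Finset.coe_filter, Finset.mem_product, Finset.mem_range, Set.mem_ofPred_eq] at hc ⊢
    have := hf h1
    omega

@[simp]
theorem rowLen_ofRowLen (f : ℕ → ℕ) (hf : Antitone f) (N : ℕ) (hN : f N = 0) (i : ℕ) :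
    (ofRowLen f hf N hN).rowLen i = f i := by
  have key : ∀ j, j < (ofRowLen f hf N hN).rowLen i ↔ j < f i := by
    intro j
    rw [← YoungDiagram.mem_iff_lt_rowLen, ← YoungDiagram.mem_cells]
    simp only [ofRowLen, Finset.mem_filter, Finset.mem_product, Finset.mem_range,
      and_iff_right_iff_imp]
    intro h
    refine ⟨?_, h.trans_le (hf (Nat.zero_le i))⟩
    by_contra hi
    have := hf (not_lt.1 hi)
    omega
  exact le_antisymm (le_of_forall_lt fun j hj => (key j).1 hj)
    (le_of_forall_lt fun j hj => (key j).2 hj)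

@[to_additive]
theorem prod_cells {α : Type*} [CommMonoid α] (ν : YoungDiagram) (f : ℕ × ℕ → α) {N : ℕ}
    (hN : ν.colLen 0 ≤ N) :
    ∏ c ∈ ν.cells, f c = ∏ i ∈ Finset.range N, ∏ j ∈ Finset.range (ν.rowLen i), f (i, j) := by
  rw [Finset.prod_sigma']
  refine Finset.prod_bij' (fun c _ => ⟨c.1, c.2⟩) (fun c _ => (c.1, c.2)) ?_ ?_ ?_ ?_ ?_
  · rintro ⟨i, j⟩ hc
    rw [YoungDiagram.mem_cells] at hc
    have h2 := YoungDiagram.mem_iff_lt_colLen.1 (ν.up_left_mem le_rfl (Nat.zero_le j) hc)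
    simp only [Finset.mem_sigma, Finset.mem_range]
    exact ⟨h2.trans_le hN, YoungDiagram.mem_iff_lt_rowLen.1 hc⟩
  · rintro ⟨i, j⟩ hc
    simp only [Finset.mem_sigma, Finset.mem_range] at hc
    exact (YoungDiagram.mem_cells _).2 (YoungDiagram.mem_iff_lt_rowLen.2 hc.2)
  · intros; rfl
  · intros; rfl
  · intros; rfl

theorem card_eq_sum_rowLen (ν : YoungDiagram) {N : ℕ} (hN : ν.colLen 0 ≤ N) :
    ν.card = ∑ i ∈ Finset.range N, ν.rowLen i := by
  have := sum_cells ν (fun _ => 1) hN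
  simpa [YoungDiagram.card] using this

theorem rowLen_le_card (ν : YoungDiagram) (i : ℕ) : ν.rowLen i ≤ ν.card := by
  rw [YoungDiagram.rowLen_eq_card]
  exact Finset.card_le_card (Finset.filter_subset _ _)

theorem colLen_le_card (ν : YoungDiagram) (i : ℕ) : ν.colLen i ≤ ν.card := by
  rw [YoungDiagram.colLen_eq_card]
  exact Finset.card_le_card (Finset.filter_subset _ _)

/-! ### Positions of the particles and holes of the Maya diagram -/

/-- The position `ν_i - i - 1` of the `i`-th particle. -/
def rowPos (ν : YoungDiagram) (i : ℕ) : ℤ := (ν.rowLen i : ℤ) - i - 1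

/-- The position `j - ν^t_j` of the `j`-th hole. -/
def colPos (ν : YoungDiagram) (j : ℕ) : ℤ := (j : ℤ) - ν.colLen j

theorem rowPos_strictAnti (ν : YoungDiagram) : StrictAnti (rowPos ν) := by
  intro i k h
  have := ν.rowLen_anti i k h.le
  simp only [rowPos]
  omega

theorem colPos_strictMono (ν : YoungDiagram) : StrictMono (colPos ν) := by
  intro i k h
  have := ν.colLen_anti i k h.le
  simp only [colPos]
  omega

theorem colPos_lt_rowPos_iff {ν : YoungDiagram} {i j : ℕ} :
    colPos ν j < rowPos ν i ↔ j < ν.rowLen i := by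
  have := @lt_rowLen_iff_lt_colLen ν i j
  simp only [rowPos, colPos]
  omega

theorem rowPos_lt_colPos_iff {ν : YoungDiagram} {i j : ℕ} :
    rowPos ν i < colPos ν j ↔ ν.rowLen i ≤ j := by
  have := @lt_rowLen_iff_lt_colLen ν i j
  simp only [rowPos, colPos]
  omega

theorem rowPos_ne_colPos (ν : YoungDiagram) (i j : ℕ) : rowPos ν i ≠ colPos ν j := by
  have h1 := @colPos_lt_rowPos_iff ν i j
  have h2 := @rowPos_lt_colPos_iff ν i j
  omega

theorem hookLength_eq {ν : YoungDiagram} {i j : ℕ} (h : j < ν.rowLen i) :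
    (hookLength ν (i, j) : ℤ) = rowPos ν i - colPos ν j := by
  have := lt_rowLen_iff_lt_colLen.1 h
  simp only [hookLength, rowPos, colPos]
  omega

theorem hookLength_pos (ν : YoungDiagram) (c : ℕ × ℕ) : 0 < hookLength ν c := Nat.succ_pos _

theorem Ico_eq_image_union (ν : YoungDiagram) {N M : ℕ} (hN : ν.colLen 0 ≤ N)
    (hM : ν.rowLen 0 ≤ M) :
    Disjoint ((Finset.range N).image (rowPos ν)) ((Finset.range M).image (colPos ν)) ∧
    Finset.Ico (-(N : ℤ)) M =
      (Finset.range N).image (rowPos ν) ∪ (Finset.range M).image (colPos ν) := by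
  have hd : Disjoint ((Finset.range N).image (rowPos ν))
      ((Finset.range M).image (colPos ν)) := by
    rw [Finset.disjoint_left]
    intro x h1 h2
    obtain ⟨i, _, rfl⟩ := Finset.mem_image.1 h1
    obtain ⟨j, _, h⟩ := Finset.mem_image.1 h2
    exact rowPos_ne_colPos ν i j h.symm
  refine ⟨hd, ?_⟩
  symm
  apply Finset.eq_of_subset_of_card_le
  · intro x hx
    rw [Finset.mem_union, Finset.mem_image, Finset.mem_image] at hx
    rw [Finset.mem_Ico]
    rcases hx with ⟨i, hi, rfl⟩ | ⟨j, hj, rfl⟩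
    · have := ν.rowLen_anti 0 i (Nat.zero_le i)
      rw [Finset.mem_range] at hi
      simp only [rowPos]
      omega
    · have := ν.colLen_anti 0 j (Nat.zero_le j)
      rw [Finset.mem_range] at hj
      simp only [colPos]
      omega
  · rw [Finset.card_union_of_disjoint hd, Finset.card_image_of_injective _
      (rowPos_strictAnti ν).injective, Finset.card_image_of_injective _
      (colPos_strictMono ν).injective]
    simp
    omega

@[to_additive]
theorem prod_Ico_eq {α : Type*} [CommMonoid α] (ν : YoungDiagram) {N M : ℕ}
    (hN : ν.colLen 0 ≤ N) (hM : ν.rowLen 0 ≤ M) (g : ℤ → α) :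
    ∏ m ∈ Finset.Ico (-(N : ℤ)) M, g m =
      (∏ i ∈ Finset.range N, g (rowPos ν i)) * ∏ j ∈ Finset.range M, g (colPos ν j) := by
  obtain ⟨hd, h⟩ := Ico_eq_image_union ν hN hM
  rw [h, Finset.prod_union hd, Finset.prod_image (rowPos_strictAnti ν).injective.injOn,
    Finset.prod_image (colPos_strictMono ν).injective.injOn]

theorem exists_rowPos_or_colPos (ν : YoungDiagram) (x : ℤ) :
    (∃ i, rowPos ν i = x) ∨ ∃ j, colPos ν j = x := by
  have h := (Ico_eq_image_union ν (N := ν.colLen 0 + x.natAbs) (M := ν.rowLen 0 + x.natAbs + 1)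
    (by omega) (by omega)).2
  have hx : x ∈ Finset.Ico (-((ν.colLen 0 + x.natAbs : ℕ) : ℤ))
      ((ν.rowLen 0 + x.natAbs + 1 : ℕ) : ℤ) := by
    rw [Finset.mem_Ico]
    omega
  rw [h, Finset.mem_union, Finset.mem_image, Finset.mem_image] at hx
  rcases hx with ⟨i, _, h⟩ | ⟨j, _, h⟩
  · exact Or.inl ⟨i, h⟩
  · exact Or.inr ⟨j, h⟩

/-- A diagram is a `t`-core as soon as no hook length is equal to `t`. -/
theorem isTCore_of_hookLength_ne {t : ℕ} (ht : 0 < t) {ν : YoungDiagram}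
    (h : ∀ c ∈ ν.cells, hookLength ν c ≠ t) : IsTCore t ν := by
  have step : ∀ x : ℤ, (∃ i, rowPos ν i = x) → ∃ i, rowPos ν i = x - t := by
    rintro x ⟨i, rfl⟩
    rcases exists_rowPos_or_colPos ν (rowPos ν i - t) with h1 | ⟨j, hj⟩
    · exact h1
    · exfalso
      have hlt : j < ν.rowLen i := colPos_lt_rowPos_iff.1 (by omega)
      apply h (i, j) ((YoungDiagram.mem_cells _).2 (YoungDiagram.mem_iff_lt_rowLen.2 hlt))
      have := hookLength_eq hlt
      omega
  have steps : ∀ (k : ℕ) (x : ℤ), (∃ i, rowPos ν i = x) → ∃ i, rowPos ν i = x - k * t := by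
    intro k
    induction k with
    | zero => intro x hx; simpa using hx
    | succ k ih =>
      intro x hx
      obtain ⟨i, hi⟩ := step _ (ih x hx)
      exact ⟨i, by rw [hi]; push_cast; ring⟩
  rintro ⟨i, j⟩ hc ⟨k, hk⟩
  have hlt := YoungDiagram.mem_iff_lt_rowLen.1 ((YoungDiagram.mem_cells _).1 hc)
  have h1 := hookLength_eq hlt
  obtain ⟨i', hi'⟩ := steps k _ ⟨i, rfl⟩
  apply rowPos_ne_colPos ν i' j
  rw [hk] at h1
  push_cast at h1
  rw [hi']
  linarith

/-! ### Products over hooks -/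

@[to_additive]
theorem prod_Ico_ite_lt {α : Type*} [CommMonoid α] (f : ℤ → α) {a b x : ℤ} (hx : x ≤ b) :
    ∏ m ∈ Finset.Ico a b, (if m < x then f (x - m) else 1) =
      ∏ k ∈ Finset.range (x - a).toNat, f (k + 1) := by
  rw [← Finset.prod_filter]
  refine Finset.prod_bij' (fun m _ => (x - m - 1).toNat) (fun k _ => x - k - 1) ?_ ?_ ?_ ?_ ?_
  · intro m hm
    simp only [Finset.mem_filter, Finset.mem_Ico, Finset.mem_range] at hm ⊢
    omega
  · intro k hk
    simp only [Finset.mem_filter, Finset.mem_Ico, Finset.mem_range] at hk ⊢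
    omega
  · intro m hm
    simp only [Finset.mem_filter, Finset.mem_Ico] at hm
    omega
  · intro k hk
    simp only [Finset.mem_range] at hk
    omega
  · intro m hm
    simp only [Finset.mem_filter, Finset.mem_Ico] at hm
    congr 1
    omega

theorem prod_Ico_ite_gt {α : Type*} [CommMonoid α] (f : ℤ → α) {a b x : ℤ} (hx : a ≤ x) :
    ∏ m ∈ Finset.Ico a b, (if x < m then f (m - x) else 1) =
      ∏ k ∈ Finset.range (b - 1 - x).toNat, f (k + 1) := by
  rw [← Finset.prod_filter]
  refine Finset.prod_bij' (fun m _ => (m - x - 1).toNat) (fun k _ => x + k + 1) ?_ ?_ ?_ ?_ ?_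
  · intro m hm
    simp only [Finset.mem_filter, Finset.mem_Ico, Finset.mem_range] at hm ⊢
    omega
  · intro k hk
    simp only [Finset.mem_filter, Finset.mem_Ico, Finset.mem_range] at hk ⊢
    omega
  · intro m hm
    simp only [Finset.mem_filter, Finset.mem_Ico] at hm
    omega
  · intro k hk
    simp only [Finset.mem_range] at hk
    omega
  · intro m hm
    simp only [Finset.mem_filter, Finset.mem_Ico] at hm
    congr 1
    omega

theorem prod_range_ite_colPos_lt {α : Type*} [CommMonoid α] (ν : YoungDiagram) (f : ℤ → α)
    {M : ℕ} (hM : ν.rowLen 0 ≤ M) (i : ℕ) :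
    ∏ j ∈ Finset.range M, (if colPos ν j < rowPos ν i then f (rowPos ν i - colPos ν j) else 1) =
      ∏ j ∈ Finset.range (ν.rowLen i), f (hookLength ν (i, j)) := by
  rw [← Finset.prod_filter]
  have hs : (Finset.range M).filter (fun j => colPos ν j < rowPos ν i) =
      Finset.range (ν.rowLen i) := by
    ext j
    have := ν.rowLen_anti 0 i (Nat.zero_le i)
    simp only [Finset.mem_filter, Finset.mem_range, colPos_lt_rowPos_iff]
    omega
  rw [hs]
  refine Finset.prod_congr rfl fun j hj => ?_
  rw [hookLength_eq (Finset.mem_range.1 hj)]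

/-- The product over all pairs of particles. -/
def pairProd {α : Type*} [CommMonoid α] (ν : YoungDiagram) (N : ℕ) (f : ℤ → α) : α :=
  ∏ i ∈ Finset.range N, ∏ k ∈ Finset.range N,
    if rowPos ν k < rowPos ν i then f (rowPos ν i - rowPos ν k) else 1

theorem rowPos_add_toNat {ν : YoungDiagram} {N i : ℕ} (hi : i < N) :
    (rowPos ν i - -(N : ℤ)).toNat = ν.rowLen i + (N - 1 - i) := by
  simp only [rowPos]
  omega

theorem prod_range_rowPos_eq {α : Type*} [CommMonoid α] (ν : YoungDiagram) (f : ℤ → α) {N : ℕ}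
    (hN : ν.colLen 0 ≤ N) :
    ∏ i ∈ Finset.range N, ∏ k ∈ Finset.range (ν.rowLen i + (N - 1 - i)), f (k + 1) =
      pairProd ν N f * ∏ c ∈ ν.cells, f (hookLength ν c) := by
  rw [prod_cells ν _ hN, pairProd, ← Finset.prod_mul_distrib]
  refine Finset.prod_congr rfl fun i hi => ?_
  rw [Finset.mem_range] at hi
  have hb : rowPos ν i ≤ ν.rowLen 0 := by
    have := ν.rowLen_anti 0 i (Nat.zero_le i)
    simp only [rowPos]
    omega
  have h := prod_Ico_eq ν hN le_rfl fun m => if m < rowPos ν i then f (rowPos ν i - m) else 1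
  rw [prod_Ico_ite_lt f hb, rowPos_add_toNat hi, prod_range_ite_colPos_lt ν f le_rfl] at h
  exact h

/-- The product over all pairs of a particle and a hole. -/
theorem prod_colPos_sub_rowPos {α : Type*} [CommMonoid α] (ν : YoungDiagram) (f : ℤ → α)
    {N M : ℕ} (hN : ν.colLen 0 ≤ N) (hM : ν.rowLen 0 ≤ M) :
    (∏ i ∈ Finset.range N, ∏ j ∈ Finset.range M, f (colPos ν j - rowPos ν i)) *
        ∏ i ∈ Finset.range N, ∏ k ∈ Finset.range (ν.rowLen i + (N - 1 - i)), f (k + 1) =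
      (∏ c ∈ ν.cells, f (hookLength ν c) * f (-(hookLength ν c : ℤ))) *
        ∏ i ∈ Finset.range N, ∏ k ∈ Finset.range (M + i - ν.rowLen i), f (k + 1) := by
  have h2 : ∏ i ∈ Finset.range N, ∏ k ∈ Finset.range (M + i - ν.rowLen i), f (k + 1) =
      pairProd ν N f * ∏ i ∈ Finset.range N, ∏ j ∈ Finset.range M,
        if rowPos ν i < colPos ν j then f (colPos ν j - rowPos ν i) else 1 := by
    rw [pairProd, Finset.prod_comm, ← Finset.prod_mul_distrib]
    refine Finset.prod_congr rfl fun i hi => ?_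
    rw [Finset.mem_range] at hi
    have hb : -(N : ℤ) ≤ rowPos ν i := by
      simp only [rowPos]
      omega
    have h := prod_Ico_eq ν hN hM fun m => if rowPos ν i < m then f (m - rowPos ν i) else 1
    rw [prod_Ico_ite_gt f hb] at h
    rw [← h]
    congr 2
    simp only [rowPos]
    have := ν.rowLen_anti 0 i (Nat.zero_le i)
    omega
  have h3 : ∏ i ∈ Finset.range N, ∏ j ∈ Finset.range M, f (colPos ν j - rowPos ν i) =
      (∏ c ∈ ν.cells, f (-(hookLength ν c : ℤ))) * ∏ i ∈ Finset.range N, ∏ j ∈ Finset.range M,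
        if rowPos ν i < colPos ν j then f (colPos ν j - rowPos ν i) else 1 := by
    rw [prod_cells ν _ hN, ← Finset.prod_mul_distrib]
    refine Finset.prod_congr rfl fun i _ => ?_
    have h := prod_range_ite_colPos_lt ν (fun x => f (-x)) hM i
    rw [← h, ← Finset.prod_mul_distrib]
    refine Finset.prod_congr rfl fun j _ => ?_
    rcases lt_or_gt_of_ne (rowPos_ne_colPos ν i j) with h1 | h1
    · rw [if_neg h1.not_gt, if_pos h1, one_mul]
    · rw [if_pos h1, if_neg h1.not_gt, mul_one, neg_sub]
  rw [prod_range_rowPos_eq ν f hN, h2, h3, Finset.prod_mul_distrib]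
  simp only [mul_assoc, mul_comm, mul_left_comm]

/-! ### The number of hooks of a given length -/

theorem sq_card_hookLength_eq_le (ν : YoungDiagram) (h : ℕ) :
    (ν.cells.filter fun c => hookLength ν c = h).card ^ 2 ≤ 2 * ν.card := by
  set T := ν.cells.filter fun c => hookLength ν c = h with hT
  have hmem : ∀ c ∈ T, c.2 < ν.rowLen c.1 ∧ rowPos ν c.1 - colPos ν c.2 = h := by
    rintro ⟨i, j⟩ hc
    obtain ⟨h1, h2⟩ := Finset.mem_filter.1 hc
    have hlt := YoungDiagram.mem_iff_lt_rowLen.1 ((YoungDiagram.mem_cells _).1 h1)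
    exact ⟨hlt, by rw [← hookLength_eq hlt, h2]⟩
  have h1 : Set.InjOn Prod.fst (T : Set (ℕ × ℕ)) := by
    intro a ha b hb hab
    have h1 := (hmem a ha).2
    have h2 := (hmem b hb).2
    rw [hab] at h1
    exact Prod.ext hab ((colPos_strictMono ν).injective (by omega))
  have h2 : Set.InjOn Prod.snd (T : Set (ℕ × ℕ)) := by
    intro a ha b hb hab
    have h1 := (hmem a ha).2
    have h2 := (hmem b hb).2
    rw [hab] at h1
    exact Prod.ext ((rowPos_strictAnti ν).injective (by omega)) hab
  have h3 : ∑ c ∈ T, (c.2 + 1) ≤ ν.card := by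
    calc ∑ c ∈ T, (c.2 + 1) ≤ ∑ c ∈ T, ν.rowLen c.1 :=
          Finset.sum_le_sum fun c hc => (hmem c hc).1
      _ = ∑ i ∈ T.image Prod.fst, ν.rowLen i := (Finset.sum_image h1).symm
      _ ≤ ∑ i ∈ Finset.range (ν.colLen 0), ν.rowLen i := by
          apply Finset.sum_le_sum_of_subset
          intro i hi
          obtain ⟨c, hc, rfl⟩ := Finset.mem_image.1 hi
          rw [Finset.mem_range]
          by_contra hlt
          have := rowLen_eq_zero (not_lt.1 hlt)
          have := (hmem c hc).1
          omega
      _ = ν.card := (card_eq_sum_rowLen ν le_rfl).symm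
  have h4 : ∑ c ∈ T, (c.2 + 1) = ∑ j ∈ T.image Prod.snd, (j + 1) := (Finset.sum_image h2).symm
  have h5 : ∑ j ∈ Finset.range T.card, (j + 1) ≤ ∑ j ∈ T.image Prod.snd, (j + 1) := by
    have hinj : Function.Injective fun j : ℕ => (j : ℤ) + 1 := fun a b hab => by simpa using hab
    have h := Finset.sum_range_le_sum (s := (T.image Prod.snd).image fun j : ℕ => (j : ℤ) + 1)
      (c := 1) (by
        intro x hx
        obtain ⟨j, _, rfl⟩ := Finset.mem_image.1 hx
        omega)
    rw [Finset.sum_image hinj.injOn, Finset.card_image_of_injective _ hinj,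
      Finset.card_image_of_injOn h2] at h
    zify
    simpa only [add_comm] using h
  have h6 := Finset.sum_range_id_mul_two T.card
  rw [Finset.sum_add_distrib] at h5
  simp only [Finset.sum_const, Finset.card_range, smul_eq_mul, mul_one] at h5
  rcases Nat.eq_zero_or_pos T.card with h0 | h0
  · rw [h0]; simp
  · obtain ⟨m, hm⟩ := Nat.exists_eq_succ_of_ne_zero h0.ne'
    rw [hm] at h5 h6 ⊢
    simp only [Nat.succ_eq_add_one, Nat.add_sub_cancel] at *
    nlinarith

/-! ### The generating function of partitions -/

theorem colLen_zero_le_iff {ν : YoungDiagram} {N : ℕ} : ν.colLen 0 ≤ N ↔ ν.rowLen N = 0 := by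
  rw [colLen_le_iff, Nat.le_zero]

theorem antitone_rowLen_sub (ν : YoungDiagram) (m : ℕ) : Antitone fun i => ν.rowLen i - m :=
  fun i k h => Nat.sub_le_sub_right (ν.rowLen_anti i k h) m

theorem antitone_rowLen_add (ν : YoungDiagram) (N m : ℕ) :
    Antitone fun i => if i ≤ N then ν.rowLen i + m else 0 := by
  intro i k h
  have := ν.rowLen_anti i k h
  dsimp only
  split_ifs <;> omega

/-- Splitting off the columns of length `N + 1` from a partition with at most `N + 1` rows. -/
def fullColumnsEquiv (N : ℕ) :
    {ν : YoungDiagram // ν.colLen 0 ≤ N + 1} ≃ ℕ × {ν : YoungDiagram // ν.colLen 0 ≤ N} where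
  toFun ν := (ν.1.rowLen N, ⟨ofRowLen (fun i => ν.1.rowLen i - ν.1.rowLen N)
    (antitone_rowLen_sub ν.1 _) N (Nat.sub_self _),
    colLen_zero_le_iff.2 (by simp)⟩)
  invFun x := ⟨ofRowLen (fun i => if i ≤ N then x.2.1.rowLen i + x.1 else 0)
    (antitone_rowLen_add x.2.1 N x.1) (N + 1) (by simp), colLen_zero_le_iff.2 (by simp)⟩
  left_inv ν := by
    apply Subtype.ext
    apply ext_rowLen
    intro i
    simp only [rowLen_ofRowLen]
    split_ifs with h
    · have := ν.1.rowLen_anti i N h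
      omega
    · exact (rowLen_eq_zero (ν.2.trans (by omega))).symm
  right_inv x := by
    have h0 := colLen_zero_le_iff.1 x.2.2
    refine Prod.ext (by simp [h0]) (Subtype.ext (ext_rowLen fun i => ?_))
    simp only [rowLen_ofRowLen, le_refl, if_true, h0]
    split_ifs with h
    · omega
    · rw [rowLen_eq_zero (x.2.2.trans (by omega : N ≤ i))]
      simp

theorem card_fullColumnsEquiv_symm (N : ℕ) (x : ℕ × {ν : YoungDiagram // ν.colLen 0 ≤ N}) :
    ((fullColumnsEquiv N).symm x).1.card = (N + 1) * x.1 + x.2.1.card := by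
  have h0 := colLen_zero_le_iff.1 x.2.2
  rw [card_eq_sum_rowLen _ ((fullColumnsEquiv N).symm x).2,
    card_eq_sum_rowLen _ (x.2.2.trans (Nat.le_succ N))]
  have : ∀ i ∈ Finset.range (N + 1), ((fullColumnsEquiv N).symm x).1.rowLen i =
      x.1 + x.2.1.rowLen i := by
    intro i hi
    have hi' : i ≤ N := Nat.lt_succ_iff.1 (Finset.mem_range.1 hi)
    simp [fullColumnsEquiv, hi', add_comm]
  rw [Finset.sum_congr rfl this, Finset.sum_add_distrib]
  simp

theorem hasSum_pow_card_of_colLen_le {x : ℂ} (hx : ‖x‖ < 1) (N : ℕ) :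
    HasSum (fun ν : {ν : YoungDiagram // ν.colLen 0 ≤ N} => x ^ ν.1.card)
      (∏ k ∈ Finset.range N, (1 - x ^ (k + 1))⁻¹) := by
  induction N with
  | zero =>
    have hu : ∀ ν : {ν : YoungDiagram // ν.colLen 0 ≤ 0}, ν = ⟨⊥, by simp⟩ := by
      intro ν
      apply Subtype.ext
      apply ext_rowLen
      intro i
      rw [rowLen_bot]
      exact rowLen_eq_zero (ν.2.trans (Nat.zero_le i))
    have := hasSum_single (f := fun ν : {ν : YoungDiagram // ν.colLen 0 ≤ 0} => x ^ ν.1.card)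
      ⟨⊥, by simp⟩ fun ν hν => absurd (hu ν) hν
    simpa using this
  | succ N ih =>
    rw [← (fullColumnsEquiv N).symm.hasSum_iff]
    have hpow : ‖x ^ (N + 1)‖ < 1 := by
      rw [norm_pow]
      exact pow_lt_one₀ (norm_nonneg x) hx (Nat.succ_ne_zero N)
    have hg := hasSum_geometric_of_norm_lt_one hpow
    have hs := summable_mul_of_summable_norm (R := ℂ) hg.summable.norm ih.summable.norm
    have h := hg.mul ih hs
    rw [Finset.prod_range_succ, mul_comm]
    have hfun : (fun ν : {ν : YoungDiagram // ν.colLen 0 ≤ N + 1} => x ^ ν.1.card) ∘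
        (fullColumnsEquiv N).symm = fun y => (x ^ (N + 1)) ^ y.1 * x ^ y.2.1.card := by
      funext y
      simp only [Function.comp_apply, card_fullColumnsEquiv_symm, pow_add, pow_mul]
    rw [hfun]
    exact h

theorem inv_one_sub_le_exp {y : ℝ} (hy : y < 1) : (1 - y)⁻¹ ≤ Real.exp (y / (1 - y)) := by
  have h : 1 - y ≠ 0 := by linarith
  calc (1 - y)⁻¹ = y / (1 - y) + 1 := by field_simp; ring
    _ ≤ _ := Real.add_one_le_exp _

theorem sum_pow_succ_le {x : ℝ} (h0 : 0 ≤ x) (h1 : x < 1) (N : ℕ) :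
    ∑ k ∈ Finset.range N, x ^ (k + 1) ≤ (1 - x)⁻¹ := by
  have hs : Summable fun k : ℕ => x ^ k := summable_geometric_of_lt_one h0 h1
  calc ∑ k ∈ Finset.range N, x ^ (k + 1) ≤ ∑ k ∈ Finset.range N, x ^ k :=
        Finset.sum_le_sum fun k _ => pow_le_pow_of_le_one h0 h1.le (Nat.le_succ k)
    _ ≤ ∑' k, x ^ k := hs.sum_le_tsum _ fun k _ => pow_nonneg h0 k
    _ = _ := tsum_geometric_of_lt_one h0 h1

theorem summable_pow_card_real {x : ℝ} (h0 : 0 ≤ x) (h1 : x < 1) :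
    Summable fun ν : YoungDiagram => x ^ ν.card := by
  have hx : ‖(x : ℂ)‖ < 1 := by rwa [Complex.norm_real, Real.norm_of_nonneg h0]
  have hN : ∀ N : ℕ, HasSum (fun ν : {ν : YoungDiagram // ν.colLen 0 ≤ N} => x ^ ν.1.card)
      (∏ k ∈ Finset.range N, (1 - x ^ (k + 1))⁻¹) := by
    intro N
    rw [← Complex.hasSum_ofReal]
    push_cast
    exact hasSum_pow_card_of_colLen_le hx N
  have hlt : ∀ k : ℕ, x ^ (k + 1) ≤ x := fun k => by
    simpa using pow_le_pow_of_le_one h0 h1.le (Nat.succ_le_succ (Nat.zero_le k))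
  apply summable_of_sum_le (c := Real.exp ((1 - x)⁻¹ / (1 - x))) (fun ν => pow_nonneg h0 _)
  intro u
  set N := u.sup fun ν => ν.colLen 0
  have hu : ∀ ν ∈ u, ν.colLen 0 ≤ N := fun ν hν => Finset.le_sup (f := fun ν => ν.colLen 0) hν
  calc ∑ ν ∈ u, x ^ ν.card = ∑ ν ∈ u.subtype fun ν => ν.colLen 0 ≤ N, x ^ ν.1.card :=
        (Finset.sum_subtype_of_mem (fun ν : YoungDiagram => x ^ ν.card) hu).symm
    _ ≤ ∏ k ∈ Finset.range N, (1 - x ^ (k + 1))⁻¹ :=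
        sum_le_hasSum _ (fun ν _ => pow_nonneg h0 _) (hN N)
    _ ≤ ∏ k ∈ Finset.range N, Real.exp (x ^ (k + 1) / (1 - x)) := by
        apply Finset.prod_le_prod
        · intro k _
          have := hlt k
          exact inv_nonneg.2 (by linarith)
        · intro k _
          have h2 := hlt k
          refine (inv_one_sub_le_exp (by linarith)).trans (Real.exp_le_exp.2 ?_)
          exact div_le_div_of_nonneg_left (pow_nonneg h0 _) (by linarith) (by linarith)
    _ = Real.exp ((∑ k ∈ Finset.range N, x ^ (k + 1)) / (1 - x)) := by
        rw [← Real.exp_sum, Finset.sum_div]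
    _ ≤ _ := Real.exp_le_exp.2
        (div_le_div_of_nonneg_right (sum_pow_succ_le h0 h1 N) (by linarith))

theorem summable_pow_card {x : ℂ} (hx : ‖x‖ < 1) :
    Summable fun ν : YoungDiagram => x ^ ν.card := by
  rw [← summable_norm_iff]
  simpa only [norm_pow] using summable_pow_card_real (norm_nonneg x) hx

theorem tsum_pow_card_ne_zero {x : ℂ} (hx : ‖x‖ < 1) :
    ∑' ν : YoungDiagram, x ^ ν.card ≠ 0 := by
  have hlim : Tendsto (fun N : ℕ => ∏ k ∈ Finset.range N, (1 - x ^ (k + 1))⁻¹) atTop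
      (𝓝 (∑' ν : YoungDiagram, x ^ ν.card)) := by
    have heq : ∀ N : ℕ, ∏ k ∈ Finset.range N, (1 - x ^ (k + 1))⁻¹ =
        ∑' ν : YoungDiagram, {ν : YoungDiagram | ν.colLen 0 ≤ N}.indicator
          (fun ν => x ^ ν.card) ν := by
      intro N
      rw [← (hasSum_pow_card_of_colLen_le hx N).tsum_eq]
      exact tsum_subtype {ν : YoungDiagram | ν.colLen 0 ≤ N} (fun ν => x ^ ν.card)
    simp only [heq]
    apply tendsto_tsum_of_dominated_convergence
      (summable_pow_card_real (norm_nonneg x) hx)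
    · intro ν
      apply tendsto_const_nhds.congr'
      filter_upwards [eventually_ge_atTop (ν.colLen 0)] with N hN
      rw [Set.indicator_of_mem]
      exact hN
    · refine Eventually.of_forall fun N ν => ?_
      rw [← norm_pow]
      exact norm_indicator_le_norm_self _ _
  have hbound : ∀ N : ℕ, Real.exp (-(1 - ‖x‖)⁻¹) ≤
      ‖∏ k ∈ Finset.range N, (1 - x ^ (k + 1))⁻¹‖ := by
    intro N
    have h1 : ‖∏ k ∈ Finset.range N, (1 - x ^ (k + 1))‖ ≤ Real.exp ((1 - ‖x‖)⁻¹) := by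
      rw [norm_prod]
      calc ∏ k ∈ Finset.range N, ‖1 - x ^ (k + 1)‖
          ≤ ∏ k ∈ Finset.range N, Real.exp (‖x‖ ^ (k + 1)) := by
            apply Finset.prod_le_prod (fun k _ => norm_nonneg _)
            intro k _
            have h2 : ‖1 - x ^ (k + 1)‖ ≤ 1 + ‖x‖ ^ (k + 1) := by
              simpa using norm_sub_le 1 (x ^ (k + 1))
            have h3 := Real.add_one_le_exp (‖x‖ ^ (k + 1))
            linarith
        _ = Real.exp (∑ k ∈ Finset.range N, ‖x‖ ^ (k + 1)) := (Real.exp_sum _ _).symm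
        _ ≤ _ := Real.exp_le_exp.2 (sum_pow_succ_le (norm_nonneg x) hx N)
    have h2 : 0 < ‖∏ k ∈ Finset.range N, (1 - x ^ (k + 1))‖ := by
      rw [norm_pos_iff, Finset.prod_ne_zero_iff]
      intro k _ h
      have h3 : ‖x ^ (k + 1)‖ < 1 := by
        rw [norm_pow]
        exact pow_lt_one₀ (norm_nonneg x) hx (Nat.succ_ne_zero k)
      rw [← sub_eq_zero.1 h, norm_one] at h3
      exact lt_irrefl _ h3
    rw [Finset.prod_inv_distrib, norm_inv, Real.exp_neg]
    exact inv_anti₀ h2 h1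
  have h := ge_of_tendsto' hlim.norm hbound
  rw [← norm_pos_iff]
  exact (Real.exp_pos _).trans_le h

/-! ### Maya diagrams -/

/-- The indicator function of `A` minus that of the negative integers. -/
def excess (A : Set ℤ) (x : ℤ) : ℤ := by
  classical exact (if x ∈ A then 1 else 0) - (if x < 0 then 1 else 0)

/-- The sum of a weight over `A`, relative to the negative integers. -/
def relSum (w : ℤ → ℤ) (A : Set ℤ) : ℤ := ∑ᶠ x, w x * excess A x

/-- The sets `A` that differ from the set of negative integers in finitely many elements. -/
def IsComm (A : Set ℤ) : Prop := (Function.support (excess A)).Finite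

/-- The set of positions of the particles of a partition. -/
def mayaSet (ν : YoungDiagram) : Set ℤ := Set.range (rowPos ν)

theorem colPos_notMem_mayaSet (ν : YoungDiagram) (j : ℕ) : colPos ν j ∉ mayaSet ν := by
  rintro ⟨i, h⟩
  exact rowPos_ne_colPos ν i j h

theorem support_weight_mul {A : Set ℤ} (hA : IsComm A) (w : ℤ → ℤ) :
    (Function.support fun x => w x * excess A x).Finite :=
  hA.subset (Function.support_mul_subset_right _ _)

theorem relSum_add {A : Set ℤ} (hA : IsComm A) (w w' : ℤ → ℤ) :
    relSum (fun x => w x + w' x) A = relSum w A + relSum w' A := by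
  unfold relSum
  rw [← finsum_add_distrib (support_weight_mul hA w) (support_weight_mul hA w')]
  exact finsum_congr fun x => add_mul _ _ _

theorem relSum_sum {A : Set ℤ} (hA : IsComm A) {ι : Type*} (s : Finset ι) (w : ι → ℤ → ℤ) :
    relSum (fun x => ∑ a ∈ s, w a x) A = ∑ a ∈ s, relSum (w a) A := by
  unfold relSum
  rw [← finsum_sum_comm s _ fun a _ => support_weight_mul hA (w a)]
  exact finsum_congr fun x => Finset.sum_mul _ _ _

theorem relSum_const_mul (A : Set ℤ) (k : ℤ) (w : ℤ → ℤ) :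
    relSum (fun x => k * w x) A = k * relSum w A := by
  unfold relSum
  rw [mul_finsum]
  exact finsum_congr fun x => mul_assoc _ _ _

theorem excess_eq_zero_of_notMem_Ico {ν : YoungDiagram} {N M : ℕ} (hN : ν.colLen 0 ≤ N)
    (hM : ν.rowLen 0 ≤ M) {x : ℤ} (hx : x ∉ Finset.Ico (-(N : ℤ)) M) :
    excess (mayaSet ν) x = 0 := by
  classical
  rw [Finset.mem_Ico, not_and_or] at hx
  rcases exists_rowPos_or_colPos ν x with ⟨i, rfl⟩ | ⟨j, rfl⟩
  · have := ν.rowLen_anti 0 i (Nat.zero_le i)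
    have h0 : rowPos ν i < 0 := by
      simp only [rowPos] at hx ⊢
      omega
    have h1 : rowPos ν i ∈ mayaSet ν := ⟨i, rfl⟩
    simp [excess, h0, h1]
  · have := ν.colLen_anti 0 j (Nat.zero_le j)
    have h0 : ¬ colPos ν j < 0 := by
      simp only [colPos] at hx ⊢
      omega
    simp [excess, h0, colPos_notMem_mayaSet]

theorem isComm_mayaSet (ν : YoungDiagram) : IsComm (mayaSet ν) := by
  apply (Finset.Ico (-(ν.colLen 0 : ℤ)) (ν.rowLen 0)).finite_toSet.subset
  intro x hx
  by_contra h
  exact hx (excess_eq_zero_of_notMem_Ico le_rfl le_rfl h)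

theorem relSum_mayaSet (w : ℤ → ℤ) (ν : YoungDiagram) :
    relSum w (mayaSet ν) =
      ∑ i ∈ Finset.range (ν.colLen 0), (w (rowPos ν i) - w (-(i : ℤ) - 1)) := by
  classical
  set N := ν.colLen 0
  set M := ν.rowLen 0
  have h1 : relSum w (mayaSet ν) =
      ∑ x ∈ Finset.Ico (-(N : ℤ)) M, w x * excess (mayaSet ν) x := by
    apply finsum_eq_sum_of_support_subset
    intro x hx
    by_contra h
    exact hx (by simp only [excess_eq_zero_of_notMem_Ico le_rfl le_rfl h, mul_zero])
  have h2 := sum_Ico_eq ν (N := N) (M := M) le_rfl le_rfl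
    fun x => if x ∈ mayaSet ν then w x else 0
  have h3 := sum_Ico_eq ⊥ (N := N) (M := M) (by simp) (by simp) fun x => if x < 0 then w x else 0
  have h4 : ∀ i, rowPos ν i ∈ mayaSet ν := fun i => ⟨i, rfl⟩
  have h5 : ∀ i : ℕ, -(i : ℤ) - 1 < 0 := fun i => by omega
  have h6 : ∀ i : ℕ, ¬ (i : ℤ) < 0 := fun i => by omega
  have h7 : ∀ i : ℕ, rowPos ⊥ i = -(i : ℤ) - 1 := fun i => by simp [rowPos]
  have h8 : ∀ i : ℕ, colPos ⊥ i = i := fun i => by simp [colPos]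
  simp only [h4, colPos_notMem_mayaSet, if_true, if_false, Finset.sum_const_zero, add_zero] at h2
  simp only [h7, h8, h5, h6, if_true, if_false, Finset.sum_const_zero, add_zero] at h3
  rw [h1, Finset.sum_sub_distrib, ← h2, ← h3, ← Finset.sum_sub_distrib]
  refine Finset.sum_congr rfl fun x _ => ?_
  simp only [excess]
  split_ifs <;> ring

theorem relSum_one_mayaSet (ν : YoungDiagram) : relSum (fun _ => 1) (mayaSet ν) = 0 := by
  simp [relSum_mayaSet]

theorem relSum_id_mayaSet (ν : YoungDiagram) : relSum (fun x => x) (mayaSet ν) = ν.card := by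
  rw [relSum_mayaSet, card_eq_sum_rowLen ν le_rfl]
  push_cast
  exact Finset.sum_congr rfl fun i _ => by simp only [rowPos]; ring

theorem mayaSet_injective : Function.Injective mayaSet := by
  intro μ ν h
  have h1 : StrictMono fun i => -rowPos μ i := fun i k hik => neg_lt_neg (rowPos_strictAnti μ hik)
  have h2 : StrictMono fun i => -rowPos ν i := fun i k hik => neg_lt_neg (rowPos_strictAnti ν hik)
  have h3 : Set.range (fun i => -rowPos μ i) = Set.range fun i => -rowPos ν i := by
    have := congrArg (fun s => (fun x : ℤ => -x) '' s) h
    simp only [mayaSet, ← Set.range_comp] at this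
    exact this
  have h4 := (h1.range_inj h2).1 h3
  apply ext_rowLen
  intro i
  have := congrFun h4 i
  simp only [rowPos] at this
  omega

theorem exists_mayaSet_eq {A : Set ℤ} (hA : IsComm A) (h0 : relSum (fun _ => 1) A = 0) :
    ∃ ν, mayaSet ν = A := by
  classical
  obtain ⟨L, hL⟩ : ∃ L : ℕ, ∀ x : ℤ, x < -L ∨ (L : ℤ) ≤ x → excess A x = 0 := by
    refine ⟨hA.toFinset.sup Int.natAbs + 1, fun x hx => ?_⟩
    by_contra h
    have := Finset.le_sup (f := Int.natAbs) (hA.mem_toFinset.2 h)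
    omega
  have hpos : ∀ x : ℤ, (L : ℤ) ≤ x → x ∉ A := by
    intro x hx hxA
    have h1 := hL x (Or.inr hx)
    have h2 : ¬ x < 0 := by omega
    simp [excess, hxA, h2] at h1
  have hneg : ∀ x : ℤ, x < -L → x ∈ A := by
    intro x hx
    by_contra hxA
    have h1 := hL x (Or.inl hx)
    have h2 : x < 0 := by omega
    simp [excess, hxA, h2] at h1
  set p : ℕ → Prop := fun k => (L : ℤ) - 1 - k ∈ A with hp
  have hlarge : ∀ k, 2 * L ≤ k → p k := fun k hk => hneg _ (by omega)
  have hinf : (Set.ofPred p).Infinite := by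
    intro hfin
    obtain ⟨b, hb⟩ := hfin.bddAbove
    have := hb (hlarge (b + 2 * L + 1) (by omega))
    omega
  have hcount : Nat.count p (2 * L) = L := by
    have h1 : relSum (fun _ => 1) A = ∑ x ∈ Finset.Ico (-(L : ℤ)) L, excess A x := by
      unfold relSum
      simp only [one_mul]
      apply finsum_eq_sum_of_support_subset
      intro x hx
      by_contra h
      rw [Finset.mem_coe, Finset.mem_Ico] at h
      exact hx (hL x (by omega))
    have h2 : ∑ x ∈ Finset.Ico (-(L : ℤ)) L, (if x ∈ A then (1 : ℤ) else 0) =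
        Nat.count p (2 * L) := by
      rw [Nat.count_eq_card_filter_range, ← Finset.sum_filter, Finset.sum_const, nsmul_eq_mul,
        mul_one, Nat.cast_inj]
      refine Finset.card_bij' (fun x _ => (L - 1 - x).toNat) (fun k _ => (L : ℤ) - 1 - k)
        ?_ ?_ ?_ ?_
      · intro x hx
        simp only [Finset.mem_filter, Finset.mem_Ico, Finset.mem_range, hp] at hx ⊢
        refine ⟨by omega, ?_⟩
        rw [show (L : ℤ) - 1 - ((L - 1 - x).toNat : ℤ) = x by omega]
        exact hx.2
      · intro k hk
        simp only [Finset.mem_filter, Finset.mem_Ico, Finset.mem_range, hp] at hk ⊢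
        exact ⟨by omega, hk.2⟩
      · intro x hx
        simp only [Finset.mem_filter, Finset.mem_Ico] at hx
        omega
      · intro k hk
        omega
    have h3 : ∑ x ∈ Finset.Ico (-(L : ℤ)) L, (if x < 0 then (1 : ℤ) else 0) = L := by
      have := sum_Ico_ite_lt (fun _ => (1 : ℤ)) (a := -(L : ℤ)) (b := L) (x := 0) (by omega)
      rw [this]
      simp
    have h4 : ∑ x ∈ Finset.Ico (-(L : ℤ)) L, excess A x =
        ∑ x ∈ Finset.Ico (-(L : ℤ)) L, (if x ∈ A then (1 : ℤ) else 0) -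
          ∑ x ∈ Finset.Ico (-(L : ℤ)) L, (if x < 0 then (1 : ℤ) else 0) := by
      rw [← Finset.sum_sub_distrib]
      rfl
    omega
  have hnth : ∀ i, L ≤ i → Nat.nth p i = L + i := by
    intro i hi
    have h1 : ∀ k, Nat.count p (2 * L + k) = L + k := by
      intro k
      induction k with
      | zero => exact hcount
      | succ k ih => rw [← add_assoc, Nat.count_succ_eq_succ_count (hlarge _ (by omega)), ih]; rfl
    have h2 := Nat.nth_count (hlarge (2 * L + (i - L)) (by omega))
    rw [h1] at h2
    rw [show L + (i - L) = i by omega] at h2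
    omega
  have hmono := Nat.nth_strictMono hinf
  have hle : ∀ i, Nat.nth p i ≤ L + i := by
    intro i
    have h1 := hmono.add_le_nat L i
    have h2 := hnth (L + i) (by omega)
    omega
  have hanti : Antitone fun i => L + i - Nat.nth p i := by
    apply antitone_nat_of_succ_le
    intro i
    have := hmono (Nat.lt_succ_self i)
    rw [Nat.succ_eq_add_one] at this
    omega
  refine ⟨ofRowLen _ hanti L (by simp [hnth L le_rfl]), ?_⟩
  have hrow : ∀ i, rowPos (ofRowLen _ hanti L (by simp [hnth L le_rfl])) i =
      (L : ℤ) - 1 - Nat.nth p i := by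
    intro i
    have := hle i
    rw [rowPos, rowLen_ofRowLen]
    omega
  ext x
  rw [mayaSet, Set.mem_range]
  simp only [hrow]
  constructor
  · rintro ⟨i, rfl⟩
    exact Nat.nth_mem_of_infinite hinf i
  · intro hx
    have hxL : x < L := by
      by_contra h
      exact hpos x (not_lt.1 h) hx
    have : ((L : ℤ) - 1 - x).toNat ∈ Set.range (Nat.nth p) := by
      rw [Nat.range_nth_of_infinite hinf]
      change (L : ℤ) - 1 - (((L : ℤ) - 1 - x).toNat : ℤ) ∈ A
      rwa [show (L : ℤ) - 1 - (((L : ℤ) - 1 - x).toNat : ℤ) = x by omega]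
    obtain ⟨i, hi⟩ := this
    exact ⟨i, by omega⟩

/-! ### Charges of the runners of the `t`-abacus -/

section Abacus

variable {t : ℕ}

/-- Moving the residue class of `x` modulo `t` by `t * c x`. -/
def shiftSet (c : ZMod t → ℤ) (A : Set ℤ) : Set ℤ := {x | x - t * c x ∈ A}

/-- The translation of the residue classes modulo `t`. -/
def shiftEquiv (c : ZMod t → ℤ) : ℤ ≃ ℤ where
  toFun x := x - t * c x
  invFun x := x + t * c x
  left_inv x := by simp
  right_inv x := by simp

/-- The relative number of elements of `A` in a residue class. -/
def charge (A : Set ℤ) (a : ZMod t) : ℤ := relSum (fun x => if (x : ZMod t) = a then 1 else 0) A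

theorem excess_shiftSet (c : ZMod t → ℤ) (A : Set ℤ) (x : ℤ) :
    excess (shiftSet c A) x =
      excess A (shiftEquiv c x) + excess (shiftSet c (Set.Iio 0)) x := by
  simp only [excess, shiftSet, shiftEquiv, Set.mem_ofPred_eq, Equiv.coe_fn_mk, Set.mem_Iio]
  by_cases h1 : x - t * c x ∈ A <;> by_cases h2 : x < 0 <;> by_cases h3 : x - t * c x < 0 <;>
    simp [h1, h2, h3]

theorem isComm_shiftSet_Iio [NeZero t] (c : ZMod t → ℤ) :
    IsComm (shiftSet c (Set.Iio 0)) := by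
  obtain ⟨B, hB⟩ : ∃ B : ℤ, ∀ a, |t * c a| ≤ B := by
    refine ⟨∑ a, |t * c a|, fun a => ?_⟩
    exact Finset.single_le_sum (f := fun a => |t * c a|) (fun _ _ => abs_nonneg _)
      (Finset.mem_univ a)
  apply (Finset.Icc (-B) B).finite_toSet.subset
  intro x hx
  rw [Finset.mem_coe, Finset.mem_Icc]
  have h := abs_le.1 (hB x)
  by_contra hcon
  apply hx
  simp only [excess, shiftSet, Set.mem_ofPred_eq, Set.mem_Iio]
  split_ifs <;> first | rfl | omega

theorem isComm_shiftSet [NeZero t] (c : ZMod t → ℤ) {A : Set ℤ} (hA : IsComm A) :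
    IsComm (shiftSet c A) := by
  have h1 : (Function.support fun x => excess A (shiftEquiv c x)).Finite := by
    have := hA.preimage (f := shiftEquiv c) (shiftEquiv c).injective.injOn
    exact this
  apply (h1.union (isComm_shiftSet_Iio c)).subset
  intro x hx
  by_contra h
  rw [Set.mem_union, not_or, Function.notMem_support, Function.notMem_support] at h
  exact hx (by rw [excess_shiftSet, h.1, h.2, add_zero])

theorem relSum_shiftSet [NeZero t] (w : ℤ → ℤ) (c : ZMod t → ℤ) {A : Set ℤ} (hA : IsComm A) :
    relSum w (shiftSet c A) =
      relSum (fun x => w (x + t * c x)) A + relSum w (shiftSet c (Set.Iio 0)) := by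
  have h1 : relSum (fun x => w (x + t * c x)) A =
      ∑ᶠ x, w x * excess A (shiftEquiv c x) := by
    rw [relSum, ← finsum_comp_equiv (shiftEquiv c)]
    refine finsum_congr fun x => ?_
    congr 2
    exact (shiftEquiv c).symm_apply_apply x
  rw [h1]
  unfold relSum
  rw [← finsum_add_distrib _ (support_weight_mul (isComm_shiftSet_Iio c) w)]
  · exact finsum_congr fun x => by rw [excess_shiftSet, mul_add]
  · have := (hA.preimage (f := shiftEquiv c) (shiftEquiv c).injective.injOn)
    exact this.subset (Function.support_mul_subset_right _ _)

theorem charge_shiftSet_Iio [NeZero t] (c : ZMod t → ℤ) (a : ZMod t) :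
    charge (shiftSet c (Set.Iio 0)) a = c a := by
  have ht : 0 < (t : ℤ) := by exact_mod_cast Nat.pos_of_ne_zero (NeZero.ne t)
  have hval : ((a.val : ℤ) : ZMod t) = a := by simp
  have hinj : Function.Injective fun k : ℤ => (a.val : ℤ) + t * k := by
    intro k l hkl
    have : (t : ℤ) * k = t * l := by simpa using hkl
    exact mul_left_cancel₀ ht.ne' this
  have hlt : a.val < t := ZMod.val_lt a
  have hneg : ∀ k : ℤ, (a.val : ℤ) + t * k < 0 ↔ k < 0 := by
    intro k
    constructor
    · intro h
      by_contra hk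
      have := mul_nonneg ht.le (not_lt.1 hk)
      omega
    · intro h
      have : (t : ℤ) * k ≤ t * (-1) := mul_le_mul_of_nonneg_left (by omega) ht.le
      omega
  have hmem : ∀ k : ℤ, (a.val : ℤ) + t * k ∈ shiftSet c (Set.Iio 0) ↔ k < c a := by
    intro k
    have h1 : (((a.val : ℤ) + t * k : ℤ) : ZMod t) = a := by push_cast; simp
    rw [shiftSet, Set.mem_ofPred_eq, h1, Set.mem_Iio,
      show (a.val : ℤ) + t * k - t * c a = a.val + t * (k - c a) by ring, hneg]
    omega
  have h1 : charge (shiftSet c (Set.Iio 0)) a =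
      ∑ᶠ k : ℤ, ((if k < c a then 1 else 0) - (if k < 0 then 1 else 0)) := by
    rw [charge, relSum]
    have h2 : ∀ k : ℤ, ((if k < c a then 1 else 0) - (if k < 0 then 1 else 0) : ℤ) =
        (fun x : ℤ => (if (x : ZMod t) = a then 1 else 0) * excess (shiftSet c (Set.Iio 0)) x)
          ((a.val : ℤ) + t * k) := by
      intro k
      have h3 : (((a.val : ℤ) + t * k : ℤ) : ZMod t) = a := by push_cast; simp
      simp only [excess, hmem, hneg, h3, if_true, one_mul]
    simp only [h2]
    have h4 := finsum_mem_range (f := fun x : ℤ =>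
      (if (x : ZMod t) = a then 1 else 0) * excess (shiftSet c (Set.Iio 0)) x) hinj
    refine Eq.trans ?_ h4
    rw [finsum_mem_def]
    refine finsum_congr fun x => ?_
    symm
    apply Set.indicator_apply_eq_self.2
    intro hx'
    rw [if_neg, zero_mul]
    intro hx
    apply hx'
    rw [← hval, ZMod.intCast_eq_intCast_iff_dvd_sub] at hx
    obtain ⟨k, hk⟩ := hx
    exact ⟨-k, by simp only; linarith⟩
  rw [h1]
  rw [finsum_eq_sum_of_support_subset (s := Finset.Ico (min 0 (c a)) (max 0 (c a)))]
  · rcases le_total 0 (c a) with h | h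
    · rw [min_eq_left h, max_eq_right h]
      rw [Finset.sum_congr rfl (g := fun _ => (1 : ℤ))]
      · simp [h]
      · intro k hk
        rw [Finset.mem_Ico] at hk
        rw [if_pos hk.2, if_neg (not_lt.2 hk.1)]
        rfl
    · rw [min_eq_right h, max_eq_left h]
      rw [Finset.sum_congr rfl (g := fun _ => (-1 : ℤ))]
      · simp [h]
      · intro k hk
        rw [Finset.mem_Ico] at hk
        rw [if_pos hk.2, if_neg (not_lt.2 hk.1)]
        rfl
  · intro k hk
    rw [Finset.mem_coe, Finset.mem_Ico]
    by_contra hcon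
    apply hk
    dsimp only
    split_ifs <;> first | rfl | omega

theorem sum_charge [NeZero t] {A : Set ℤ} (hA : IsComm A) :
    ∑ a : ZMod t, charge A a = relSum (fun _ => 1) A := by
  unfold charge
  rw [← relSum_sum hA]
  congr 1
  funext x
  simp

theorem charge_shiftSet [NeZero t] (c : ZMod t → ℤ) {A : Set ℤ} (hA : IsComm A) (a : ZMod t) :
    charge (shiftSet c A) a = charge A a + c a := by
  rw [charge, relSum_shiftSet _ c hA]
  have := charge_shiftSet_Iio c a
  rw [charge] at this
  rw [this, charge]
  simp

theorem relSum_id_shiftSet [NeZero t] (c : ZMod t → ℤ) {A : Set ℤ} (hA : IsComm A)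
    (h0 : ∀ a : ZMod t, charge A a = 0) :
    relSum (fun x => x) (shiftSet c A) =
      relSum (fun x => x) A + relSum (fun x => x) (shiftSet c (Set.Iio 0)) := by
  rw [relSum_shiftSet _ c hA, relSum_add hA]
  have h1 : relSum (fun x => (t : ℤ) * c x) A = 0 := by
    have h2 : (fun x : ℤ => (t : ℤ) * c x) =
        fun x : ℤ => ∑ a : ZMod t, (t * c a) * if (x : ZMod t) = a then 1 else 0 := by
      funext x
      simp
    rw [h2, relSum_sum hA]
    apply Finset.sum_eq_zero
    intro a _
    rw [relSum_const_mul]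
    have := h0 a
    rw [charge] at this
    rw [this, mul_zero]
  rw [h1, add_zero]

theorem shiftSet_shiftSet_neg (c : ZMod t → ℤ) (A : Set ℤ) :
    shiftSet c (shiftSet (fun a => -c a) A) = A := by
  ext x
  simp [shiftSet]

theorem shiftSet_injective (c : ZMod t → ℤ) : Function.Injective (shiftSet c) := by
  intro A B h
  ext x
  have := congrArg (fun s => x + t * c x ∈ s) h
  simpa [shiftSet] using this

/-! ### Cores -/

theorem isTCore_iff (ht : 0 < t) (ν : YoungDiagram) :
    IsTCore t ν ↔ ∀ x ∈ mayaSet ν, x - t ∈ mayaSet ν := by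
  constructor
  · rintro h _ ⟨i, rfl⟩
    rcases exists_rowPos_or_colPos ν (rowPos ν i - t) with h1 | ⟨j, hj⟩
    · exact h1
    · exfalso
      have hlt : j < ν.rowLen i := colPos_lt_rowPos_iff.1 (by omega)
      apply h (i, j) ((YoungDiagram.mem_cells _).2 (YoungDiagram.mem_iff_lt_rowLen.2 hlt))
      have h2 := hookLength_eq hlt
      have h3 : hookLength ν (i, j) = t := by omega
      rw [h3]
  · intro h
    apply isTCore_of_hookLength_ne ht
    rintro ⟨i, j⟩ hc hh
    have hlt := YoungDiagram.mem_iff_lt_rowLen.1 ((YoungDiagram.mem_cells _).1 hc)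
    have h1 := hookLength_eq hlt
    apply colPos_notMem_mayaSet ν j
    rw [show colPos ν j = rowPos ν i - t by omega]
    exact h _ ⟨i, rfl⟩

theorem mayaSet_eq_shiftSet [NeZero t] {ν : YoungDiagram} (h : IsTCore t ν) :
    mayaSet ν = shiftSet (charge (t := t) (mayaSet ν)) (Set.Iio 0) := by
  have ht : 0 < t := Nat.pos_of_ne_zero (NeZero.ne t)
  have htz : 0 < (t : ℤ) := by exact_mod_cast ht
  rw [isTCore_iff ht] at h
  have hdown : ∀ (k : ℕ) (x : ℤ), x ∈ mayaSet ν → x - t * k ∈ mayaSet ν := by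
    intro k
    induction k with
    | zero => intro x hx; simpa using hx
    | succ k ih =>
      intro x hx
      have := h _ (ih x hx)
      rwa [show x - (t : ℤ) * ((k + 1 : ℕ) : ℤ) = x - t * k - t by push_cast; ring]
  have hexists : ∀ a : ZMod t, ∃ d : ℤ, ∀ k : ℤ, (a.val : ℤ) + t * k ∈ mayaSet ν ↔ k < d := by
    intro a
    have hub : ∀ x ∈ mayaSet ν, x < ν.rowLen 0 := by
      rintro _ ⟨i, rfl⟩
      have := ν.rowLen_anti 0 i (Nat.zero_le i)
      simp only [rowPos]
      omega
    have hlow : ∀ x : ℤ, x < -(ν.colLen 0 : ℤ) → x ∈ mayaSet ν := by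
      intro x hx
      rcases exists_rowPos_or_colPos ν x with h1 | ⟨j, rfl⟩
      · exact h1
      · have := ν.colLen_anti 0 j (Nat.zero_le j)
        simp only [colPos] at hx
        omega
    obtain ⟨d, hd, hmax⟩ := Int.exists_greatest_of_bdd
      (P := fun k : ℤ => (a.val : ℤ) + t * k ∈ mayaSet ν)
      ⟨ν.rowLen 0, fun k hk => by
        have h1 := hub _ hk
        by_contra hlt
        have h2 : (ν.rowLen 0 : ℤ) < k := not_le.1 hlt
        have h3 : k ≤ t * k := le_mul_of_one_le_left (by omega) (by omega)
        omega⟩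
      ⟨-(ν.colLen 0 : ℤ) - a.val - 1, by
        apply hlow
        have h3 : (t : ℤ) * (-(ν.colLen 0 : ℤ) - a.val - 1) ≤
            1 * (-(ν.colLen 0 : ℤ) - a.val - 1) :=
          mul_le_mul_of_nonpos_right (by omega) (by omega)
        omega⟩
    refine ⟨d + 1, fun k => ⟨fun hk => Int.lt_add_one_iff.2 (hmax k hk), fun hk => ?_⟩⟩
    have := hdown (d - k).toNat _ hd
    rwa [show (a.val : ℤ) + t * d - t * ((d - k).toNat : ℤ) = a.val + t * k by
      rw [Int.toNat_of_nonneg (by omega)]; ring] at this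
  choose d hd using hexists
  have hset : mayaSet ν = shiftSet d (Set.Iio 0) := by
    ext x
    set a : ZMod t := (x : ZMod t) with ha
    obtain ⟨k, hk⟩ : ∃ k : ℤ, x = a.val + t * k := by
      have h1 : (((a.val : ℤ) : ℤ) : ZMod t) = (x : ZMod t) := by simp [ha]
      rw [ZMod.intCast_eq_intCast_iff_dvd_sub] at h1
      obtain ⟨k, hk⟩ := h1
      exact ⟨k, by linarith⟩
    rw [shiftSet, Set.mem_ofPred_eq, ← ha, Set.mem_Iio]
    have hlt : a.val < t := ZMod.val_lt a
    rw [show x - t * d a = a.val + t * (k - d a) by rw [hk]; ring]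
    conv_lhs => rw [hk]
    rw [hd a k]
    constructor
    · intro h1
      have : (t : ℤ) * (k - d a) ≤ t * (-1) := mul_le_mul_of_nonneg_left (by omega) htz.le
      omega
    · intro h1
      by_contra h2
      have := mul_nonneg htz.le (by omega : 0 ≤ k - d a)
      omega
  have hch : charge (t := t) (mayaSet ν) = d := by
    rw [hset]
    funext a
    exact charge_shiftSet_Iio d a
  rw [hch]
  exact hset

/-! ### Cores and quotients -/

theorem exists_quotient [NeZero t] (κ g : YoungDiagram) :
    ∃ ν, mayaSet ν = shiftSet (charge (t := t) (mayaSet κ)) (mayaSet g) := by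
  apply exists_mayaSet_eq (isComm_shiftSet _ (isComm_mayaSet g))
  rw [← sum_charge (t := t) (isComm_shiftSet _ (isComm_mayaSet g))]
  simp only [charge_shiftSet _ (isComm_mayaSet g)]
  rw [Finset.sum_add_distrib, sum_charge (isComm_mayaSet g), sum_charge (isComm_mayaSet κ),
    relSum_one_mayaSet, relSum_one_mayaSet, add_zero]

/-- The partition with a given `t`-core and a given `t`-quotient. -/
def ofCoreQuotient (t : ℕ) [NeZero t]
    (x : {κ : YoungDiagram // IsTCore t κ} ×
      {g : YoungDiagram // ∀ a : ZMod t, charge (mayaSet g) a = 0}) : YoungDiagram :=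
  (exists_quotient (t := t) x.1.1 x.2.1).choose

theorem mayaSet_ofCoreQuotient (t : ℕ) [NeZero t]
    (x : {κ : YoungDiagram // IsTCore t κ} ×
      {g : YoungDiagram // ∀ a : ZMod t, charge (mayaSet g) a = 0}) :
    mayaSet (ofCoreQuotient t x) = shiftSet (charge (t := t) (mayaSet x.1.1)) (mayaSet x.2.1) :=
  (exists_quotient (t := t) x.1.1 x.2.1).choose_spec

theorem card_ofCoreQuotient (t : ℕ) [NeZero t]
    (x : {κ : YoungDiagram // IsTCore t κ} ×
      {g : YoungDiagram // ∀ a : ZMod t, charge (mayaSet g) a = 0}) :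
    (ofCoreQuotient t x).card = x.1.1.card + x.2.1.card := by
  have h := relSum_id_shiftSet (charge (t := t) (mayaSet x.1.1)) (isComm_mayaSet x.2.1) x.2.2
  rw [← mayaSet_ofCoreQuotient, ← mayaSet_eq_shiftSet x.1.2, relSum_id_mayaSet,
    relSum_id_mayaSet, relSum_id_mayaSet] at h
  omega

theorem ofCoreQuotient_bijective (t : ℕ) [NeZero t] : Function.Bijective (ofCoreQuotient t) := by
  have ht : 0 < t := Nat.pos_of_ne_zero (NeZero.ne t)
  constructor
  · rintro ⟨⟨κ, hκ⟩, ⟨g, hg⟩⟩ ⟨⟨κ', hκ'⟩, ⟨g', hg'⟩⟩ h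
    have h1 := congrArg mayaSet h
    rw [mayaSet_ofCoreQuotient, mayaSet_ofCoreQuotient] at h1
    dsimp only at h1
    have h2 : charge (t := t) (mayaSet κ) = charge (mayaSet κ') := by
      funext a
      have := congrArg (fun A => charge A a) h1
      simpa only [charge_shiftSet _ (isComm_mayaSet _), hg, hg', zero_add] using this
    have h3 : κ = κ' := by
      apply mayaSet_injective
      rw [mayaSet_eq_shiftSet hκ, mayaSet_eq_shiftSet hκ', h2]
    rw [h2] at h1
    have h4 : g = g' := mayaSet_injective (shiftSet_injective _ h1)
    subst h3 h4
    rfl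
  · intro ν
    have h0 : ∑ a : ZMod t, charge (mayaSet ν) a = 0 := by
      rw [sum_charge (isComm_mayaSet ν), relSum_one_mayaSet]
    obtain ⟨κ, hκ⟩ := exists_mayaSet_eq (isComm_shiftSet_Iio (charge (t := t) (mayaSet ν))) (by
      rw [← sum_charge (t := t) (isComm_shiftSet_Iio _)]
      simp only [charge_shiftSet_Iio]
      exact h0)
    have hc := isComm_shiftSet (fun a => -charge (t := t) (mayaSet ν) a) (isComm_mayaSet ν)
    have hch : ∀ a : ZMod t,
        charge (shiftSet (fun a => -charge (t := t) (mayaSet ν) a) (mayaSet ν)) a = 0 := by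
      intro a
      rw [charge_shiftSet _ (isComm_mayaSet ν), add_neg_cancel]
    obtain ⟨g, hg⟩ := exists_mayaSet_eq hc (by
      rw [← sum_charge (t := t) hc]
      exact Finset.sum_eq_zero fun a _ => hch a)
    have hκcore : IsTCore t κ := by
      rw [isTCore_iff ht, hκ]
      intro x hx
      simp only [shiftSet, Set.mem_ofPred_eq, Set.mem_Iio] at hx ⊢
      have h1 : ((x - t : ℤ) : ZMod t) = (x : ZMod t) := by push_cast; simp
      rw [h1]
      omega
    have hκch : charge (t := t) (mayaSet κ) = charge (mayaSet ν) := by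
      rw [hκ]
      funext a
      exact charge_shiftSet_Iio _ a
    refine ⟨⟨⟨κ, hκcore⟩, ⟨g, fun a => by rw [hg]; exact hch a⟩⟩, ?_⟩
    apply mayaSet_injective
    rw [mayaSet_ofCoreQuotient]
    dsimp only
    rw [hκch, hg, shiftSet_shiftSet_neg]

end Abacus

theorem coreSum_ne_zero {t : ℕ} (ht : 0 < t) {Q : ℂ} (hQ : ‖Q‖ < 1) : coreSum t Q ≠ 0 := by
  have : NeZero t := ⟨ht.ne'⟩
  have hs := summable_pow_card hQ
  have h := tsum_pow_card_ne_zero hQ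
  rw [← (Equiv.ofBijective _ (ofCoreQuotient_bijective t)).tsum_eq] at h
  simp only [Equiv.ofBijective_apply, card_ofCoreQuotient, pow_add] at h
  have h1 : Summable fun κ : {κ : YoungDiagram // IsTCore t κ} => ‖Q ^ κ.1.card‖ :=
    (hs.subtype _).norm
  have h2 : Summable fun g : {g : YoungDiagram // ∀ a : ZMod t, charge (mayaSet g) a = 0} =>
      ‖Q ^ g.1.card‖ := (hs.subtype _).norm
  rw [← tsum_mul_tsum_of_summable_norm h1 h2] at h
  exact left_ne_zero_of_mul h

/-! ### Jacobi-Trudi determinants -/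

section JacobiTrudi

variable {R : Type*} [CommRing R]

/-- The determinant `det (e_{lam_i - i + j})` of size `n`. -/
def jtDet (e : ℤ → R) (lam : YoungDiagram) (n : ℕ) : R :=
  Matrix.det (Matrix.of fun i j : Fin n => e ((lam.rowLen i : ℤ) - (i : ℕ) + (j : ℕ)))

/-- The determinant `det (e_{lam_i - i + j})` of size `l(lam)`. -/
def jt (e : ℤ → R) (lam : YoungDiagram) : R := jtDet e lam (lam.colLen 0)

theorem det_of_last_row {n : ℕ} (A : Matrix (Fin (n + 1)) (Fin (n + 1)) R)
    (h : ∀ j : Fin n, A (Fin.last n) j.castSucc = 0) :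
    A.det = A (Fin.last n) (Fin.last n) * (A.submatrix Fin.castSucc Fin.castSucc).det := by
  rw [Matrix.det_succ_row A (Fin.last n), Finset.sum_eq_single (Fin.last n)]
  · rw [Fin.succAbove_last, Fin.val_last, Even.neg_one_pow ⟨n, rfl⟩, one_mul]
  · intro j _ hj
    obtain ⟨k, rfl⟩ := Fin.exists_castSucc_eq.2 hj
    rw [h k, mul_zero, zero_mul]
  · intro hn
    exact absurd (Finset.mem_univ _) hn

theorem jtDet_succ {e : ℤ → R} (h0 : e 0 = 1) (hneg : ∀ r < 0, e r = 0) {lam : YoungDiagram}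
    {n : ℕ} (hn : lam.colLen 0 ≤ n) : jtDet e lam (n + 1) = jtDet e lam n := by
  have hr := rowLen_eq_zero hn
  rw [jtDet, det_of_last_row]
  · simp only [Matrix.of_apply, Fin.val_last, hr]
    rw [show ((0 : ℕ) : ℤ) - n + n = 0 by simp, h0, one_mul]
    rfl
  · intro j
    simp only [Matrix.of_apply, Fin.val_last, hr, Fin.val_castSucc]
    apply hneg
    have := j.2
    omega

theorem jtDet_eq_jt {e : ℤ → R} (h0 : e 0 = 1) (hneg : ∀ r < 0, e r = 0) {lam : YoungDiagram}
    {n : ℕ} (hn : lam.colLen 0 ≤ n) : jtDet e lam n = jt e lam := by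
  induction n, hn using Nat.le_induction with
  | base => rfl
  | succ n hn ih => rw [jtDet_succ h0 hneg hn, ih]

@[simp]
theorem jt_bot (e : ℤ → R) : jt e ⊥ = 1 := by
  have : (⊥ : YoungDiagram).colLen 0 = 0 := colLen_bot 0
  rw [jt, jtDet]
  have : IsEmpty (Fin ((⊥ : YoungDiagram).colLen 0)) := by rw [this]; infer_instance
  exact Matrix.det_isEmpty

theorem colLen_zero_pos {ν : YoungDiagram} {i : ℕ} (h : 0 < ν.rowLen i) : 0 < ν.colLen 0 :=
  lt_of_le_of_lt (Nat.zero_le i) (lt_rowLen_iff_lt_colLen.1 h)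

theorem jt_eq_zero {e : ℤ → R} {K : ℕ} (hK : ∀ r : ℤ, K < r → e r = 0) {lam : YoungDiagram}
    (h : K < lam.rowLen 0) : jt e lam = 0 := by
  have hpos : 0 < lam.colLen 0 := colLen_zero_pos (lt_of_le_of_lt (Nat.zero_le K) h)
  apply Matrix.det_eq_zero_of_row_eq_zero (⟨0, hpos⟩ : Fin (lam.colLen 0))
  intro j
  apply hK
  simp only
  omega

/-! ### Strips -/

/-- `lam / kap` is a vertical strip. -/
def VStrip (lam kap : YoungDiagram) : Prop :=
  ∀ i, kap.rowLen i ≤ lam.rowLen i ∧ lam.rowLen i ≤ kap.rowLen i + 1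

/-- `lam / kap` is a horizontal strip. -/
def HStrip (lam kap : YoungDiagram) : Prop :=
  ∀ i, kap.rowLen i ≤ lam.rowLen i ∧ lam.rowLen (i + 1) ≤ kap.rowLen i

theorem VStrip.le {lam kap : YoungDiagram} (h : VStrip lam kap) : kap ≤ lam :=
  le_iff_rowLen.2 fun i => (h i).1

theorem vStrip_transpose_iff {lam kap : YoungDiagram} :
    VStrip lam.transpose kap.transpose ↔ HStrip lam kap := by
  simp only [VStrip, HStrip, YoungDiagram.rowLen_transpose]
  constructor
  · intro h i
    refine ⟨le_iff_rowLen.1 (YoungDiagram.transpose_le_iff.1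
      (le_iff_rowLen.2 fun j => by simpa using (h j).1)) i, ?_⟩
    by_contra hlt
    have h1 := lt_rowLen_iff_lt_colLen.1 (not_le.1 hlt)
    have h2 := (h (kap.rowLen i)).2
    have h3 : i < kap.colLen (kap.rowLen i) := by omega
    exact lt_irrefl _ (lt_rowLen_iff_lt_colLen.2 h3)
  · intro h j
    have hle : kap.transpose ≤ lam.transpose :=
      YoungDiagram.transpose_le_iff.2 (le_iff_rowLen.2 fun i => (h i).1)
    refine ⟨by simpa using le_iff_rowLen.1 hle j, ?_⟩
    by_contra hlt
    have h1 := lt_rowLen_iff_lt_colLen.2 (not_le.1 hlt)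
    have h2 := (h (kap.colLen j)).2
    have h3 : j < kap.rowLen (kap.colLen j) := by omega
    exact lt_irrefl _ (lt_rowLen_iff_lt_colLen.1 h3)

theorem card_le_card_of_le {μ ν : YoungDiagram} (h : μ ≤ ν) : μ.card ≤ ν.card :=
  Finset.card_le_card (YoungDiagram.cells_subset_iff.2 h)

theorem finite_box (n : ℕ) : {ν : YoungDiagram | ν.colLen 0 ≤ n ∧ ν.rowLen 0 ≤ n}.Finite := by
  apply Set.Finite.of_finite_image (f := YoungDiagram.cells)
  · apply (Finset.range n ×ˢ Finset.range n).powerset.finite_toSet.subset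
    rintro _ ⟨ν, ⟨h1, h2⟩, rfl⟩
    rw [Finset.mem_coe, Finset.mem_powerset]
    rintro ⟨i, j⟩ hc
    rw [YoungDiagram.mem_cells] at hc
    have h3 := YoungDiagram.mem_iff_lt_colLen.1 (ν.up_left_mem le_rfl (Nat.zero_le j) hc)
    have h4 := YoungDiagram.mem_iff_lt_rowLen.1 (ν.up_left_mem (Nat.zero_le i) le_rfl hc)
    rw [Finset.mem_product, Finset.mem_range, Finset.mem_range]
    exact ⟨h3.trans_le h1, h4.trans_le h2⟩
  · intro μ _ ν _ h
    exact YoungDiagram.ext h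

/-- The partitions contained in a square. -/
def box (n : ℕ) : Finset YoungDiagram := (finite_box n).toFinset

theorem mem_box {n : ℕ} {ν : YoungDiagram} :
    ν ∈ box n ↔ ν.colLen 0 ≤ n ∧ ν.rowLen 0 ≤ n := by
  simp [box]

theorem mem_box_transpose {n : ℕ} {ν : YoungDiagram} : ν.transpose ∈ box n ↔ ν ∈ box n := by
  rw [mem_box, mem_box, YoungDiagram.colLen_transpose, YoungDiagram.rowLen_transpose, and_comm]

theorem mem_box_of_le {n : ℕ} {μ ν : YoungDiagram} (h : μ ≤ ν) (hν : ν ∈ box n) : μ ∈ box n := by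
  rw [mem_box] at hν ⊢
  have h2 := le_iff_rowLen.1 (YoungDiagram.transpose_le_iff.2 h) 0
  rw [YoungDiagram.rowLen_transpose, YoungDiagram.rowLen_transpose] at h2
  exact ⟨h2.trans hν.1, (le_iff_rowLen.1 h 0).trans hν.2⟩

theorem mem_box_card (ν : YoungDiagram) : ν ∈ box ν.card :=
  mem_box.2 ⟨colLen_le_card ν 0, rowLen_le_card ν 0⟩

/-! ### Adding a variable -/

theorem antitone_of_piecewise {lam : YoungDiagram} {s : Finset (Fin (lam.colLen 0))}
    (h : ∀ i (hi : i + 1 < lam.colLen 0),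
      lam.rowLen (i + 1) - (if ⟨i + 1, hi⟩ ∈ s then 1 else 0) ≤
        lam.rowLen i - (if ⟨i, Nat.lt_of_succ_lt hi⟩ ∈ s then 1 else 0)) :
    Antitone fun i => if hi : i < lam.colLen 0 then
      lam.rowLen i - (if (⟨i, hi⟩ : Fin (lam.colLen 0)) ∈ s then 1 else 0) else 0 := by
  apply antitone_nat_of_succ_le
  intro i
  by_cases hi : i + 1 < lam.colLen 0
  · have := h i hi
    simpa only [hi, Nat.lt_of_succ_lt hi, dif_pos] using this
  · simp only [hi, dif_neg, not_false_eq_true, Nat.zero_le]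

open Classical in
theorem jt_add_mul {e : ℤ → R} (h0 : e 0 = 1) (hneg : ∀ r < 0, e r = 0) (x : R) {n : ℕ}
    {lam : YoungDiagram} (hlam : lam ∈ box n) :
    jt (fun r => e r + x * e (r - 1)) lam =
      ∑ kap ∈ box n, if VStrip lam kap then x ^ (lam.card - kap.card) * jt e kap else 0 := by
  set l := lam.colLen 0 with hl
  set a : Finset (Fin l) → Fin l → ℤ := fun s i =>
    (lam.rowLen i : ℤ) - (if i ∈ s then 1 else 0) - (i : ℕ) with ha
  have hexp : jt (fun r => e r + x * e (r - 1)) lam =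
      ∑ s : Finset (Fin l), x ^ s.card *
        Matrix.det (Matrix.of fun i j : Fin l => e (a s i + (j : ℕ))) := by
    set A : Fin l → Fin l → R := fun i j => e ((lam.rowLen i : ℤ) - (i : ℕ) + (j : ℕ))
    set B : Fin l → Fin l → R := fun i j => e ((lam.rowLen i : ℤ) - (i : ℕ) + (j : ℕ) - 1)
    have h1 : jt (fun r => e r + x * e (r - 1)) lam =
        (Matrix.detRowAlternating (R := R) (n := Fin l)).toMultilinearMap
          ((fun i => x • B i) + A) := by
      rw [jt, jtDet]
      change _ = Matrix.det ((fun i => x • B i) + A)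
      congr 1
      funext i j
      simp only [Matrix.of_apply, Pi.add_apply, Pi.smul_apply, smul_eq_mul, A, B]
      rw [add_comm]
    rw [h1, MultilinearMap.map_add_univ]
    refine Finset.sum_congr rfl fun s _ => ?_
    have h2 : s.piecewise (fun i => x • B i) A =
        s.piecewise (fun i => (fun _ => x) i • s.piecewise B A i) (s.piecewise B A) := by
      funext i
      by_cases hi : i ∈ s <;> simp [hi]
    rw [h2, MultilinearMap.map_piecewise_smul, Finset.prod_const, smul_eq_mul]
    congr 1
    change Matrix.det _ = Matrix.det _
    congr 1
    funext i j
    simp only [Matrix.of_apply, ha, A, B]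
    by_cases hi : i ∈ s
    · rw [Finset.piecewise_eq_of_mem _ _ _ hi, if_pos hi]
      congr 1
      ring
    · rw [Finset.piecewise_eq_of_notMem _ _ _ hi, if_neg hi]
      rw [sub_zero]
  rw [hexp, ← Finset.sum_filter]
  symm
  have hsub : ∀ kap, VStrip lam kap → ∀ i : Fin l,
      (kap.rowLen i : ℤ) = (lam.rowLen i : ℤ) - (if kap.rowLen i < lam.rowLen i then 1 else 0) := by
    intro kap h i
    have := h i
    split_ifs <;> omega
  apply Finset.sum_of_injOn (fun kap => Finset.univ.filter
    fun i : Fin l => kap.rowLen i < lam.rowLen i)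
  · intro κ hκ κ' hκ' h
    rw [Finset.mem_coe, Finset.mem_filter] at hκ hκ'
    apply ext_rowLen
    intro i
    by_cases hi : i < l
    · have h1 := hsub κ hκ.2 ⟨i, hi⟩
      have h2 := hsub κ' hκ'.2 ⟨i, hi⟩
      have h3 := Finset.ext_iff.1 h ⟨i, hi⟩
      simp only [Finset.mem_filter, Finset.mem_univ, true_and] at h3
      simp only at h1 h2
      simp only [h3] at h1
      omega
    · have h1 := (hκ.2 i).1
      have h2 := (hκ'.2 i).1
      rw [rowLen_eq_zero (not_lt.1 hi)] at h1 h2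
      omega
  · intro κ _
    exact Finset.mem_coe.2 (Finset.mem_univ _)
  · intro s _ hs
    by_cases hanti : ∀ i (hi : i + 1 < l),
        lam.rowLen (i + 1) - (if ⟨i + 1, hi⟩ ∈ s then 1 else 0) ≤
          lam.rowLen i - (if ⟨i, Nat.lt_of_succ_lt hi⟩ ∈ s then 1 else 0)
    · exfalso
      apply hs
      have hA := antitone_of_piecewise hanti
      have hpos : ∀ i, i < l → 0 < lam.rowLen i := fun i hi => lt_rowLen_iff_lt_colLen.2 hi
      have hrow : ∀ i (hi : i < l), (ofRowLen _ hA l (by simp [hl])).rowLen i =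
          lam.rowLen i - (if (⟨i, hi⟩ : Fin l) ∈ s then 1 else 0) := by
        intro i hi
        rw [rowLen_ofRowLen, dif_pos hi]
      have hV : VStrip lam (ofRowLen _ hA l (by simp [hl])) := by
        intro i
        by_cases hi : i < l
        · rw [hrow i hi]
          split_ifs <;> omega
        · rw [rowLen_ofRowLen, dif_neg hi, rowLen_eq_zero (not_lt.1 hi)]
          omega
      refine ⟨ofRowLen _ hA l (by simp [hl]), ?_, ?_⟩
      · rw [Finset.mem_coe, Finset.mem_filter]
        exact ⟨mem_box_of_le hV.le hlam, hV⟩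
      · ext i
        simp only [Finset.mem_filter, Finset.mem_univ, true_and]
        rw [hrow i i.2]
        have := hpos i i.2
        split_ifs with h1
        · simp only [h1, iff_true]
          omega
        · simp only [h1, iff_false]
          omega
    · push Not at hanti
      obtain ⟨i, hi, hlt⟩ := hanti
      rw [Matrix.det_zero_of_row_eq (i := ⟨i, Nat.lt_of_succ_lt hi⟩) (j := ⟨i + 1, hi⟩), mul_zero]
      · simp
      · funext j
        simp only [Matrix.of_apply, ha]
        congr 2
        have := lam.rowLen_anti i (i + 1) (Nat.le_succ i)
        push_cast
        split_ifs at hlt ⊢ <;> omega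
  · intro κ hκ
    rw [Finset.mem_filter] at hκ
    have hle : κ.colLen 0 ≤ l := by
      have h2 := le_iff_rowLen.1 (YoungDiagram.transpose_le_iff.2 hκ.2.le) 0
      rwa [YoungDiagram.rowLen_transpose, YoungDiagram.rowLen_transpose] at h2
    congr 2
    · rw [card_eq_sum_rowLen lam le_rfl, card_eq_sum_rowLen κ hle, ← hl, Finset.card_filter,
        ← Fin.sum_univ_eq_sum_range, ← Fin.sum_univ_eq_sum_range]
      have h1 : ∑ i : Fin l, lam.rowLen i =
          ∑ i : Fin l, κ.rowLen i + ∑ i : Fin l, if κ.rowLen i < lam.rowLen i then 1 else 0 := by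
        rw [← Finset.sum_add_distrib]
        refine Finset.sum_congr rfl fun i _ => ?_
        have := hsub κ hκ.2 i
        split_ifs at this ⊢ <;> omega
      omega
    · rw [← jtDet_eq_jt h0 hneg hle, jtDet]
      congr 1
      funext i j
      simp only [Matrix.of_apply, ha, Finset.mem_filter, Finset.mem_univ, true_and]
      rw [hsub κ hκ.2 i]

end JacobiTrudi

section Pieri

variable {R : Type*} [CommRing R]

/-- The length of the row above row `i`, with a fictitious row of length `n` on top. -/
def rowAbove (n : ℕ) (η : YoungDiagram) (i : ℕ) : ℕ := if i = 0 then n else η.rowLen (i - 1)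

theorem rowLen_le_rowAbove {n : ℕ} {η : YoungDiagram} (h : η.rowLen 0 ≤ n) (i : ℕ) :
    η.rowLen i ≤ rowAbove n η i := by
  unfold rowAbove
  split_ifs with hi
  · exact (η.rowLen_anti 0 i (Nat.zero_le i)).trans h
  · exact η.rowLen_anti _ _ (Nat.sub_le i 1)

theorem tail_eq_sum {e t : ℤ → R} {u : R} (ht : ∀ c, t c = e c + u * t (c + 1)) (c : ℤ) (m : ℕ) :
    t c = ∑ k ∈ Finset.range m, u ^ k * e (c + k) + u ^ m * t (c + m) := by
  induction m with
  | zero => simp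
  | succ m ih =>
    rw [ih, Finset.sum_range_succ, ht (c + m), Nat.cast_succ, ← add_assoc]
    ring

theorem exists_tail {e : ℤ → R} {K : ℕ} (hK : ∀ r : ℤ, K < r → e r = 0) (u : R) :
    ∃ t : ℤ → R, (∀ c, t c = e c + u * t (c + 1)) ∧ (∀ c : ℤ, K < c → t c = 0) ∧
      t 0 = ∑ r ∈ Finset.range (K + 1), u ^ r * e r := by
  refine ⟨fun c => ∑ k ∈ Finset.range (K + 1 - c).toNat, u ^ k * e (c + k), ?_, ?_, ?_⟩
  · intro c
    rcases le_or_gt c K with h | h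
    · obtain ⟨m, hm⟩ : ∃ m, (K + 1 - c).toNat = m + 1 := ⟨(K - c).toNat, by omega⟩
      have hm' : (K + 1 - (c + 1)).toNat = m := by omega
      dsimp only
      rw [hm, hm', Finset.sum_range_succ', Finset.mul_sum, add_comm]
      congr 1
      · simp
      · refine Finset.sum_congr rfl fun k _ => ?_
        rw [pow_succ', mul_assoc]
        congr 3
        push_cast
        ring
    · have h1 : (K + 1 - c).toNat = 0 := by omega
      have h2 : (K + 1 - (c + 1)).toNat = 0 := by omega
      simp only [h1, h2, Finset.range_zero, Finset.sum_empty, hK c h, mul_zero, add_zero]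
  · intro c hc
    have h1 : (K + 1 - c).toNat = 0 := by omega
    simp only [h1, Finset.range_zero, Finset.sum_empty]
  · simp only [zero_add, sub_zero]
    congr 1

theorem det_tail {e t : ℤ → R} {u : R} (hneg : ∀ r < 0, e r = 0)
    (ht : ∀ c, t c = e c + u * t (c + 1)) {η : YoungDiagram} {n : ℕ} (hn : η.colLen 0 ≤ n) :
    Matrix.det (Matrix.of fun i j : Fin (n + 1) => t ((η.rowLen i : ℤ) - (i : ℕ) + (j : ℕ))) =
      t 0 * jtDet e η n := by
  set T : Matrix (Fin (n + 1)) (Fin (n + 1)) R :=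
    Matrix.of fun i j : Fin (n + 1) => t ((η.rowLen i : ℤ) - (i : ℕ) + (j : ℕ))
  set B : Matrix (Fin (n + 1)) (Fin (n + 1)) R := Matrix.of fun i j : Fin (n + 1) =>
    if (j : ℕ) = n then t ((η.rowLen i : ℤ) - (i : ℕ) + (j : ℕ))
    else e ((η.rowLen i : ℤ) - (i : ℕ) + (j : ℕ))
  have h1 : (T.submatrix id Fin.revPerm).det = (B.submatrix id Fin.revPerm).det := by
    apply Matrix.det_eq_of_forall_col_eq_smul_add_pred (c := fun _ => u)
    · intro i
      simp [T, B]
    · intro i j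
      simp only [Matrix.submatrix_apply, id_eq, Fin.revPerm_apply, T, B, Matrix.of_apply,
        Fin.rev_succ, Fin.rev_castSucc, Fin.val_castSucc, Fin.val_succ]
      rw [if_neg (by have := (Fin.rev j).2; omega), ht]
      push_cast
      congr 3
      ring
  have h2 : T.det = B.det := by
    rw [Matrix.det_permute', Matrix.det_permute'] at h1
    have hs : IsUnit ((Equiv.Perm.sign (Fin.revPerm : Equiv.Perm (Fin (n + 1))) : ℤ) : R) :=
      (Units.isUnit _).map (Int.castRingHom R)
    exact hs.mul_left_cancel h1
  have hr := rowLen_eq_zero hn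
  rw [h2, det_of_last_row]
  · congr 1
    · simp [B, hr]
    · rw [jtDet]
      congr 1
      funext i j
      simp only [Matrix.submatrix_apply, B, Matrix.of_apply, Fin.val_castSucc]
      rw [if_neg (by have := j.2; omega)]
  · intro j
    simp only [B, Matrix.of_apply, Fin.val_castSucc, Fin.val_last, hr]
    rw [if_neg (by have := j.2; omega)]
    apply hneg
    have := j.2
    omega

theorem det_tail_eq_det_sum {e t : ℤ → R} {u : R} (ht : ∀ c, t c = e c + u * t (c + 1)) {K : ℕ}
    (hK : ∀ c : ℤ, K < c → t c = 0) {η : YoungDiagram} {n m : ℕ} (hm : K ≤ m)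
    (hη : η.rowLen 0 ≤ m) :
    Matrix.det (Matrix.of fun i j : Fin (n + 1) => t ((η.rowLen i : ℤ) - (i : ℕ) + (j : ℕ))) =
      Matrix.det (Matrix.of fun i j : Fin (n + 1) =>
        ∑ k ∈ Finset.range (rowAbove m η i - η.rowLen i + 1),
          u ^ k * e ((η.rowLen i : ℤ) - (i : ℕ) + (j : ℕ) + k)) := by
  apply Matrix.det_eq_of_forall_row_eq_smul_add_pred
    (c := fun i : Fin n => u ^ (rowAbove m η (i + 1) - η.rowLen (i + 1) + 1))
  · intro j
    simp only [Matrix.of_apply, Fin.val_zero]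
    rw [tail_eq_sum ht _ (rowAbove m η 0 - η.rowLen 0 + 1), hK _ _, mul_zero, add_zero]
    simp only [rowAbove, if_true]
    push_cast [hη]
    omega
  · intro i j
    simp only [Matrix.of_apply, Fin.val_succ, Fin.val_castSucc]
    rw [tail_eq_sum ht _ (rowAbove m η (i + 1) - η.rowLen (i + 1) + 1)]
    congr 3
    simp only [rowAbove, Nat.succ_ne_zero, if_false, Nat.add_sub_cancel]
    push_cast [η.rowLen_anti i (i + 1) (Nat.le_succ _)]
    ring

open Classical in
theorem det_sum_eq_sum_hStrip {e : ℤ → R} (h0 : e 0 = 1) (hneg : ∀ r < 0, e r = 0) (u : R)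
    {η : YoungDiagram} {n m : ℕ} (hn : η.colLen 0 ≤ n) (hnm : n + 1 ≤ m) (hη : η.rowLen 0 ≤ m) :
    Matrix.det (Matrix.of fun i j : Fin (n + 1) =>
        ∑ k ∈ Finset.range (rowAbove m η i - η.rowLen i + 1),
          u ^ k * e ((η.rowLen i : ℤ) - (i : ℕ) + (j : ℕ) + k)) =
      ∑ μ ∈ box m, if HStrip μ η then u ^ (μ.card - η.card) * jt e μ else 0 := by
  have hexp : Matrix.det (Matrix.of fun i j : Fin (n + 1) =>
        ∑ k ∈ Finset.range (rowAbove m η i - η.rowLen i + 1),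
          u ^ k * e ((η.rowLen i : ℤ) - (i : ℕ) + (j : ℕ) + k)) =
      ∑ k ∈ Fintype.piFinset fun i : Fin (n + 1) =>
          Finset.range (rowAbove m η i - η.rowLen i + 1),
        u ^ (∑ i, k i) * Matrix.det (Matrix.of fun i j : Fin (n + 1) =>
          e ((η.rowLen i : ℤ) + k i - (i : ℕ) + (j : ℕ))) := by
    have h1 : (Matrix.of fun i j : Fin (n + 1) =>
        ∑ k ∈ Finset.range (rowAbove m η i - η.rowLen i + 1),
          u ^ k * e ((η.rowLen i : ℤ) - (i : ℕ) + (j : ℕ) + k)) =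
        fun i : Fin (n + 1) => ∑ k ∈ Finset.range (rowAbove m η i - η.rowLen i + 1),
          u ^ k • fun j : Fin (n + 1) => e ((η.rowLen i : ℤ) + k - (i : ℕ) + (j : ℕ)) := by
      funext i j
      simp only [Matrix.of_apply, Finset.sum_apply, Pi.smul_apply, smul_eq_mul]
      refine Finset.sum_congr rfl fun k _ => ?_
      congr 2
      ring
    rw [h1]
    change (Matrix.detRowAlternating (R := R) (n := Fin (n + 1))).toMultilinearMap _ = _
    rw [MultilinearMap.map_sum_finset]
    refine Finset.sum_congr rfl fun k _ => ?_
    rw [MultilinearMap.map_smul_univ, Finset.prod_pow_eq_pow_sum, smul_eq_mul]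
    rfl
  rw [hexp, ← Finset.sum_filter]
  symm
  have hcol : ∀ μ, HStrip μ η → μ.colLen 0 ≤ n + 1 := by
    intro μ hμ
    rw [colLen_zero_le_iff]
    have := (hμ n).2
    rw [rowLen_eq_zero hn] at this
    omega
  apply Finset.sum_of_injOn (fun μ (i : Fin (n + 1)) => μ.rowLen i - η.rowLen i)
  · intro κ hκ κ' hκ' h
    rw [Finset.mem_coe, Finset.mem_filter] at hκ hκ'
    apply ext_rowLen
    intro i
    by_cases hi : i < n + 1
    · have h1 := (hκ.2 i).1
      have h2 := (hκ'.2 i).1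
      have h3 := congrFun h ⟨i, hi⟩
      simp only at h3
      omega
    · rw [rowLen_eq_zero ((hcol _ hκ.2).trans (not_lt.1 hi)),
        rowLen_eq_zero ((hcol _ hκ'.2).trans (not_lt.1 hi))]
  · intro κ hκ
    rw [Finset.mem_coe, Finset.mem_filter, mem_box] at hκ
    rw [Finset.mem_coe, Fintype.mem_piFinset]
    rintro ⟨i, hi⟩
    rw [Finset.mem_range]
    unfold rowAbove
    simp only
    split_ifs with h
    · subst h
      omega
    · have := (hκ.2 (i - 1)).2
      rw [Nat.sub_add_cancel (Nat.pos_of_ne_zero h)] at this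
      omega
  · intro k hk hk'
    exfalso
    apply hk'
    rw [Fintype.mem_piFinset] at hk
    have hk2 : ∀ i (hi : i < n + 1), η.rowLen i + k ⟨i, hi⟩ ≤ rowAbove m η i := by
      intro i hi
      have h1 := Finset.mem_range.1 (hk ⟨i, hi⟩)
      have h2 := rowLen_le_rowAbove hη i
      simp only at h1
      omega
    have hA : Antitone fun i => if hi : i < n + 1 then η.rowLen i + k ⟨i, hi⟩ else 0 := by
      apply antitone_nat_of_succ_le
      intro i
      by_cases hi : i + 1 < n + 1
      · have := hk2 (i + 1) hi
        simp only [rowAbove, Nat.succ_ne_zero, if_false, Nat.add_sub_cancel] at this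
        simp only [hi, Nat.lt_of_succ_lt hi, dif_pos]
        omega
      · simp only [hi, dif_neg, not_false_eq_true, Nat.zero_le]
    set μ := ofRowLen _ hA (n + 1) (by simp) with hμ
    have hrow : ∀ i (hi : i < n + 1), μ.rowLen i = η.rowLen i + k ⟨i, hi⟩ := by
      intro i hi
      rw [hμ, rowLen_ofRowLen, dif_pos hi]
    have hrow0 : μ.rowLen (n + 1) = 0 := by
      rw [hμ, rowLen_ofRowLen, dif_neg (lt_irrefl _)]
    have hH : HStrip μ η := by
      intro i
      constructor
      · by_cases hi : i < n + 1
        · rw [hrow i hi]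
          omega
        · rw [rowLen_eq_zero (hn.trans (by omega : n ≤ i))]
          omega
      · by_cases hi : i + 1 < n + 1
        · rw [hrow _ hi]
          simpa only [rowAbove, Nat.succ_ne_zero, if_false, Nat.add_sub_cancel] using hk2 _ hi
        · have := μ.rowLen_anti (n + 1) (i + 1) (not_lt.1 hi)
          omega
    refine ⟨μ, ?_, ?_⟩
    · rw [Finset.mem_coe, Finset.mem_filter, mem_box]
      refine ⟨⟨(hcol μ hH).trans hnm, ?_⟩, hH⟩
      rw [hrow 0 (Nat.succ_pos n)]
      simpa only [rowAbove, if_true] using hk2 0 (Nat.succ_pos n)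
    · funext i
      change μ.rowLen i - η.rowLen i = k i
      rw [hrow i i.2]
      exact Nat.add_sub_cancel_left _ _
  · intro κ hκ
    rw [Finset.mem_filter] at hκ
    have hsub : ∀ i, (κ.rowLen i - η.rowLen i) + η.rowLen i = κ.rowLen i :=
      fun i => Nat.sub_add_cancel (hκ.2 i).1
    congr 2
    · rw [card_eq_sum_rowLen κ (hcol κ hκ.2), card_eq_sum_rowLen η (N := n + 1) (by omega),
        ← Fin.sum_univ_eq_sum_range, ← Fin.sum_univ_eq_sum_range]
      have h1 : ∑ i : Fin (n + 1), κ.rowLen i =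
          ∑ i : Fin (n + 1), (κ.rowLen i - η.rowLen i) + ∑ i : Fin (n + 1), η.rowLen i := by
        rw [← Finset.sum_add_distrib]
        exact Finset.sum_congr rfl fun i _ => (hsub i).symm
      change _ = ∑ i : Fin (n + 1), (κ.rowLen i - η.rowLen i)
      omega
    · rw [← jtDet_eq_jt h0 hneg (hcol κ hκ.2), jtDet]
      congr 1
      funext i j
      simp only [Matrix.of_apply]
      congr 3
      have := hsub i
      omega

open Classical in
/-- The Pieri rule for Jacobi-Trudi determinants. -/
theorem sum_hStrip_mul_jt {e : ℤ → R} (h0 : e 0 = 1) (hneg : ∀ r < 0, e r = 0) {K : ℕ}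
    (hK : ∀ r : ℤ, K < r → e r = 0) (u : R) {η : YoungDiagram} {m : ℕ}
    (hη : η ∈ box m) (hcol : η.colLen 0 + 1 ≤ m) (hm : K ≤ m) :
    (∑ μ ∈ box m, if HStrip μ η then u ^ (μ.card - η.card) * jt e μ else 0) =
      (∑ r ∈ Finset.range (K + 1), u ^ r * e r) * jt e η := by
  obtain ⟨t, ht, htK, ht0⟩ := exists_tail hK u
  have hη0 := (mem_box.1 hη).2
  rw [← det_sum_eq_sum_hStrip h0 hneg u le_rfl hcol hη0, ← det_tail_eq_det_sum ht htK hm hη0,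
    det_tail hneg ht le_rfl, ht0]
  rfl

end Pieri

/-! ### Elementary symmetric functions and the dual Cauchy identity -/

section DualCauchy

variable {R : Type*} [CommRing R]

/-- The elementary symmetric functions of `x 0, …, x (N - 1)`. -/
def esym (x : ℕ → R) : ℕ → ℤ → R
  | 0, r => if r = 0 then 1 else 0
  | N + 1, r => esym x N r + x N * esym x N (r - 1)

theorem esym_of_neg (x : ℕ → R) (N : ℕ) : ∀ r < 0, esym x N r = 0 := by
  induction N with
  | zero => intro r hr; simp [esym, hr.ne]
  | succ N ih => intro r hr; rw [esym, ih r hr, ih (r - 1) (by omega), mul_zero, add_zero]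

@[simp]
theorem esym_apply_zero (x : ℕ → R) (N : ℕ) : esym x N 0 = 1 := by
  induction N with
  | zero => simp [esym]
  | succ N ih => rw [esym, ih, esym_of_neg x N _ (by omega), mul_zero, add_zero]

theorem esym_of_lt (x : ℕ → R) (N : ℕ) : ∀ r : ℤ, N < r → esym x N r = 0 := by
  induction N with
  | zero =>
    intro r hr
    have : r ≠ 0 := by push_cast at hr; omega
    simp [esym, this]
  | succ N ih =>
    intro r hr
    push_cast at hr
    rw [esym, ih r (by omega), ih (r - 1) (by omega), mul_zero, add_zero]

theorem sum_pow_mul_esym (x : ℕ → R) (u : R) (N : ℕ) :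
    ∑ r ∈ Finset.range (N + 1), u ^ r * esym x N r = ∏ i ∈ Finset.range N, (1 + u * x i) := by
  induction N with
  | zero => simp
  | succ N ih =>
    have h1 : ∑ r ∈ Finset.range (N + 2), u ^ r * esym x N r =
        ∑ r ∈ Finset.range (N + 1), u ^ r * esym x N r := by
      rw [Finset.sum_range_succ, esym_of_lt x N _ (by push_cast; omega), mul_zero, add_zero]
    have h2 : ∑ r ∈ Finset.range (N + 2), u ^ r * esym x N ((r : ℤ) - 1) =
        u * ∑ r ∈ Finset.range (N + 1), u ^ r * esym x N r := by
      rw [Finset.sum_range_succ', esym_of_neg x N _ (by simp), mul_zero, add_zero, Finset.mul_sum]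
      refine Finset.sum_congr rfl fun r _ => ?_
      rw [pow_succ', mul_assoc]
      congr 3
      push_cast
      ring
    have h3 : ∑ r ∈ Finset.range (N + 2), u ^ r * esym x (N + 1) r =
        ∑ r ∈ Finset.range (N + 2), u ^ r * esym x N r +
          x N * ∑ r ∈ Finset.range (N + 2), u ^ r * esym x N ((r : ℤ) - 1) := by
      rw [Finset.mul_sum, ← Finset.sum_add_distrib]
      refine Finset.sum_congr rfl fun r _ => ?_
      rw [esym]
      ring
    rw [h3, h1, h2, ih, Finset.prod_range_succ]
    ring

theorem jt_esym_zero (x : ℕ → R) {lam : YoungDiagram} (h : lam ≠ ⊥) : jt (esym x 0) lam = 0 := by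
  apply jt_eq_zero (esym_of_lt x 0)
  by_contra h0
  apply h
  apply ext_rowLen
  intro i
  have := lam.rowLen_anti 0 i (Nat.zero_le i)
  rw [rowLen_bot]
  omega

open Classical in
theorem jt_esym_succ (x : ℕ → R) (N : ℕ) {n : ℕ} {lam : YoungDiagram} (hlam : lam ∈ box n) :
    jt (esym x (N + 1)) lam = ∑ kap ∈ box n,
      if VStrip lam kap then x N ^ (lam.card - kap.card) * jt (esym x N) kap else 0 :=
  jt_add_mul (esym_apply_zero x N) (esym_of_neg x N) (x N) hlam

theorem sum_box_jt_mul_jt_transpose (x y : ℕ → R) (w : R) {N M n : ℕ} (hN : N ≤ n) (hM : M ≤ n) :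
    ∑ μ ∈ box n, w ^ μ.card * jt (esym x N) μ * jt (esym y M) μ.transpose =
      ∏ j ∈ Finset.range M, ∏ i ∈ Finset.range N, (1 + w * y j * x i) := by
  classical
  induction M with
  | zero =>
    rw [Finset.sum_eq_single ⊥]
    · simp
    · intro μ _ hμ
      rw [jt_esym_zero y, mul_zero]
      intro h
      apply hμ
      rw [YoungDiagram.transpose_eq_iff_eq_transpose, transpose_bot] at h
      exact h
    · intro h
      exact absurd (mem_box.2 (by simp)) h
  | succ M ih =>
    rw [Finset.prod_range_succ, ← ih (by omega), Finset.sum_mul]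
    have h1 : ∀ μ ∈ box n, w ^ μ.card * jt (esym x N) μ * jt (esym y (M + 1)) μ.transpose =
        ∑ η ∈ box n, w ^ η.card * jt (esym y M) η.transpose *
          if HStrip μ η then (w * y M) ^ (μ.card - η.card) * jt (esym x N) μ else 0 := by
      intro μ hμ
      rw [jt_esym_succ y M (mem_box_transpose.2 hμ), Finset.mul_sum]
      refine Finset.sum_bij' (fun η _ => η.transpose) (fun η _ => η.transpose) ?_ ?_ ?_ ?_ ?_
      · intro η hη
        exact mem_box_transpose.2 hη
      · intro η hη
        exact mem_box_transpose.2 hη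
      · intro η _
        exact YoungDiagram.transpose_transpose η
      · intro η _
        exact YoungDiagram.transpose_transpose η
      · intro η _
        rw [← vStrip_transpose_iff, YoungDiagram.transpose_transpose, card_transpose,
          card_transpose]
        split_ifs with h
        · have hle : η.card ≤ μ.card := by
            have := card_le_card_of_le h.le
            rwa [card_transpose] at this
          rw [mul_pow]
          conv_lhs => rw [← Nat.sub_add_cancel hle, pow_add, Nat.add_sub_cancel]
          ring
        · rw [mul_zero, mul_zero]
    rw [Finset.sum_congr rfl h1, Finset.sum_comm]
    refine Finset.sum_congr rfl fun η hη => ?_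
    rw [← Finset.mul_sum]
    by_cases hcol : η.colLen 0 ≤ M
    · rw [sum_hStrip_mul_jt (esym_apply_zero x N) (esym_of_neg x N) (esym_of_lt x N) _ hη
        (by omega) hN, sum_pow_mul_esym]
      ring
    · rw [jt_eq_zero (esym_of_lt y M) (lam := η.transpose)]
      · ring
      · rw [YoungDiagram.rowLen_transpose]
        omega

end DualCauchy

/-! ### The dual Cauchy identity in infinitely many variables -/

theorem norm_jt_esym_le (x : ℕ → ℂ) (N : ℕ) (lam : YoungDiagram) :
    ‖jt (esym x N) lam‖ ≤ jt (esym (fun i => ‖x i‖) N) lam := by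
  classical
  induction N generalizing lam with
  | zero =>
    by_cases h : lam = ⊥
    · simp [h]
    · simp [jt_esym_zero _ h]
  | succ N ih =>
    rw [jt_esym_succ x N (mem_box_card lam), jt_esym_succ _ N (mem_box_card lam)]
    refine (norm_sum_le _ _).trans (Finset.sum_le_sum fun kap _ => ?_)
    split_ifs
    · rw [norm_mul, norm_pow]
      exact mul_le_mul_of_nonneg_left (ih kap) (pow_nonneg (norm_nonneg _) _)
    · simp

theorem jt_esym_norm_nonneg (x : ℕ → ℂ) (N : ℕ) (lam : YoungDiagram) :
    0 ≤ jt (esym (fun i => ‖x i‖) N) lam :=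
  (norm_nonneg _).trans (norm_jt_esym_le x N lam)

theorem tendsto_jt {𝕜 : Type*} [NormedField 𝕜] {e : ℕ → ℤ → 𝕜} {a : ℤ → 𝕜}
    (h : ∀ r, Tendsto (fun N => e N r) atTop (𝓝 (a r))) (lam : YoungDiagram) :
    Tendsto (fun N => jt (e N) lam) atTop (𝓝 (jt a lam)) := by
  have hdet : Continuous fun A : Matrix (Fin (lam.colLen 0)) (Fin (lam.colLen 0)) 𝕜 => A.det :=
    continuous_id.matrix_det
  exact (hdet.tendsto _).comp (tendsto_pi_nhds.2 fun i => tendsto_pi_nhds.2 fun j => h _)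

theorem esym_nonneg {x : ℕ → ℝ} (hx0 : ∀ i, 0 ≤ x i) (N : ℕ) (r : ℤ) : 0 ≤ esym x N r := by
  induction N generalizing r with
  | zero =>
    rw [esym]
    split_ifs <;> norm_num
  | succ N ih => exact add_nonneg (ih r) (mul_nonneg (hx0 N) (ih _))

theorem exists_tendsto_esym {x : ℕ → ℝ} (hx0 : ∀ i, 0 ≤ x i) (hx : Summable x) (r : ℤ) :
    ∃ L, Tendsto (fun N => esym x N r) atTop (𝓝 L) := by
  have hmono : Monotone fun N => esym x N r := by
    apply monotone_nat_of_le_succ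
    intro N
    rw [esym]
    exact le_add_of_nonneg_right (mul_nonneg (hx0 N) (esym_nonneg hx0 N _))
  refine ⟨_, tendsto_atTop_ciSup hmono ⟨Real.exp (∑' i, x i), ?_⟩⟩
  rintro _ ⟨N, rfl⟩
  dsimp only
  by_cases hr : r < 0 ∨ (N : ℤ) < r
  · have : esym x N r = 0 := by
      rcases hr with h | h
      · exact esym_of_neg x N r h
      · exact esym_of_lt x N r h
    rw [this]
    exact (Real.exp_pos _).le
  · push Not at hr
    lift r to ℕ using hr.1
    calc esym x N r ≤ ∑ k ∈ Finset.range (N + 1), (1 : ℝ) ^ k * esym x N k := by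
          have h := Finset.single_le_sum (f := fun k : ℕ => (1 : ℝ) ^ k * esym x N k)
            (fun k _ => mul_nonneg (by simp) (esym_nonneg hx0 N k))
            (Finset.mem_range.2 (show r < N + 1 by omega))
          simpa using h
      _ = ∏ i ∈ Finset.range N, (1 + 1 * x i) := sum_pow_mul_esym x 1 N
      _ ≤ ∏ i ∈ Finset.range N, Real.exp (x i) := by
          apply Finset.prod_le_prod
          · intro i _
            have := hx0 i
            positivity
          · intro i _
            have := Real.add_one_le_exp (x i)
            linarith
      _ = Real.exp (∑ i ∈ Finset.range N, x i) := (Real.exp_sum _ _).symm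
      _ ≤ _ := Real.exp_le_exp.2 (hx.sum_le_tsum _ fun i _ => hx0 i)

theorem dual_cauchy {x y : ℕ → ℂ} (hx : Summable fun i => ‖x i‖) (hy : Summable fun i => ‖y i‖)
    {a b : ℤ → ℂ} (ha : ∀ r, Tendsto (fun N => esym x N r) atTop (𝓝 (a r)))
    (hb : ∀ r, Tendsto (fun N => esym y N r) atTop (𝓝 (b r))) (w : ℂ) {K : ℝ}
    (hK : ∀ᶠ N in atTop, ∏ j ∈ Finset.range N, ∏ i ∈ Finset.range N,
      (1 + ‖w‖ * ‖y j‖ * ‖x i‖) ≤ K) :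
    (∀ u : Finset YoungDiagram,
      ∑ μ ∈ u, ‖w ^ μ.card * jt a μ * jt b μ.transpose‖ ≤ K) ∧
    Tendsto (fun N => ∏ j ∈ Finset.range N, ∏ i ∈ Finset.range N, (1 + w * y j * x i)) atTop
      (𝓝 (∑' μ : YoungDiagram, w ^ μ.card * jt a μ * jt b μ.transpose)) := by
  choose A hA using exists_tendsto_esym (fun i => norm_nonneg (x i)) hx
  choose B hB using exists_tendsto_esym (fun i => norm_nonneg (y i)) hy
  have hAle : ∀ N μ, ‖jt (esym x N) μ‖ ≤ jt (esym (fun i => ‖x i‖) N) μ :=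
    fun N μ => norm_jt_esym_le x N μ
  have hmono : ∀ (z : ℕ → ℂ) (μ : YoungDiagram),
      Monotone fun N => jt (esym (fun i => ‖z i‖) N) μ := by
    classical
    intro z μ
    apply monotone_nat_of_le_succ
    intro N
    rw [jt_esym_succ _ N (mem_box_card μ)]
    have h := Finset.single_le_sum (f := fun kap => if VStrip μ kap then
        ‖z N‖ ^ (μ.card - kap.card) * jt (esym (fun i => ‖z i‖) N) kap else 0)
      (fun kap _ => by
        split_ifs
        · exact mul_nonneg (pow_nonneg (norm_nonneg _) _) (jt_esym_norm_nonneg z N kap)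
        · exact le_rfl) (mem_box_card μ)
    simpa [show VStrip μ μ from fun i => ⟨le_rfl, Nat.le_succ _⟩] using h
  have hAt : ∀ μ, Tendsto (fun N => jt (esym (fun i => ‖x i‖) N) μ) atTop (𝓝 (jt A μ)) :=
    fun μ => tendsto_jt hA μ
  have hBt : ∀ μ, Tendsto (fun N => jt (esym (fun i => ‖y i‖) N) μ) atTop (𝓝 (jt B μ)) :=
    fun μ => tendsto_jt hB μ
  have hxA : ∀ N μ, jt (esym (fun i => ‖x i‖) N) μ ≤ jt A μ :=
    fun N μ => (hmono x μ).ge_of_tendsto (hAt μ) N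
  have hyB : ∀ N μ, jt (esym (fun i => ‖y i‖) N) μ ≤ jt B μ :=
    fun N μ => (hmono y μ).ge_of_tendsto (hBt μ) N
  have hA0 : ∀ μ, 0 ≤ jt A μ := fun μ => (jt_esym_norm_nonneg x 0 μ).trans (hxA 0 μ)
  have hB0 : ∀ μ, 0 ≤ jt B μ := fun μ => (jt_esym_norm_nonneg y 0 μ).trans (hyB 0 μ)
  have haA : ∀ μ, ‖jt a μ‖ ≤ jt A μ := fun μ =>
    le_of_tendsto_of_tendsto' (tendsto_jt ha μ).norm (hAt μ) fun N => norm_jt_esym_le x N μ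
  have hbB : ∀ μ, ‖jt b μ‖ ≤ jt B μ := fun μ =>
    le_of_tendsto_of_tendsto' (tendsto_jt hb μ).norm (hBt μ) fun N => norm_jt_esym_le y N μ
  set g : YoungDiagram → ℝ := fun μ => ‖w‖ ^ μ.card * jt A μ * jt B μ.transpose with hg
  have hg0 : ∀ μ, 0 ≤ g μ := fun μ =>
    mul_nonneg (mul_nonneg (pow_nonneg (norm_nonneg _) _) (hA0 _)) (hB0 _)
  have hgsum : ∀ u : Finset YoungDiagram, ∑ μ ∈ u, g μ ≤ K := by
    intro u
    have hlim : Tendsto (fun N => ∑ μ ∈ u, ‖w‖ ^ μ.card * jt (esym (fun i => ‖x i‖) N) μ *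
        jt (esym (fun i => ‖y i‖) N) μ.transpose) atTop (𝓝 (∑ μ ∈ u, g μ)) :=
      tendsto_finsetSum _ fun μ _ => (tendsto_const_nhds.mul (hAt μ)).mul (hBt μ.transpose)
    refine le_of_tendsto hlim ?_
    filter_upwards [hK] with N hN
    refine le_trans ?_ hN
    have hR : ∀ μ ∈ u, μ ∈ box (u.sup YoungDiagram.card + N) := by
      intro μ hμ
      have h1 := Finset.le_sup (f := YoungDiagram.card) hμ
      have h2 := mem_box.1 (mem_box_card μ)
      exact mem_box.2 ⟨by omega, by omega⟩
    rw [← sum_box_jt_mul_jt_transpose (fun i => ‖x i‖) (fun i => ‖y i‖) ‖w‖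
      (Nat.le_add_left N (u.sup YoungDiagram.card)) (Nat.le_add_left N (u.sup YoungDiagram.card))]
    exact Finset.sum_le_sum_of_subset_of_nonneg hR fun μ _ _ =>
      mul_nonneg (mul_nonneg (pow_nonneg (norm_nonneg _) _) (jt_esym_norm_nonneg x N μ))
        (jt_esym_norm_nonneg y N μ.transpose)
  have hgs : Summable g := summable_of_sum_le hg0 hgsum
  refine ⟨fun u => le_trans (Finset.sum_le_sum fun μ _ => ?_) (hgsum u), ?_⟩
  · rw [norm_mul, norm_mul, norm_pow]
    exact mul_le_mul (mul_le_mul_of_nonneg_left (haA μ) (pow_nonneg (norm_nonneg _) _)) (hbB _)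
      (norm_nonneg _) (mul_nonneg (pow_nonneg (norm_nonneg _) _) (hA0 _))
  · have hfin : ∀ N, ∏ j ∈ Finset.range N, ∏ i ∈ Finset.range N, (1 + w * y j * x i) =
        ∑' μ : YoungDiagram, w ^ μ.card * jt (esym x N) μ * jt (esym y N) μ.transpose := by
      intro N
      rw [← sum_box_jt_mul_jt_transpose x y w le_rfl le_rfl]
      symm
      apply tsum_eq_sum
      intro μ hμ
      rw [mem_box, not_and_or] at hμ
      rcases hμ with h | h
      · rw [jt_eq_zero (esym_of_lt y N) (lam := μ.transpose), mul_zero]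
        rw [YoungDiagram.rowLen_transpose]
        omega
      · rw [jt_eq_zero (esym_of_lt x N) (by omega), mul_zero, zero_mul]
    simp only [hfin]
    apply tendsto_tsum_of_dominated_convergence hgs
    · intro μ
      exact (tendsto_const_nhds.mul (tendsto_jt ha μ)).mul (tendsto_jt hb _)
    · refine Eventually.of_forall fun N μ => ?_
      rw [norm_mul, norm_mul, norm_pow]
      exact mul_le_mul (mul_le_mul_of_nonneg_left ((hAle N μ).trans (hxA N μ))
        (pow_nonneg (norm_nonneg _) _)) ((norm_jt_esym_le y N _).trans (hyB N _))
        (norm_nonneg _) (mul_nonneg (pow_nonneg (norm_nonneg _) _) (hA0 _))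

/-! ### Newton's identities and complete symmetric functions -/

theorem newton_esym (x : ℕ → ℂ) (N r : ℕ) :
    ∑ k ∈ Finset.range (r + 1), (-1) ^ k * (∑ i ∈ Finset.range N, x i ^ (k + 1)) *
      esym x N ((r : ℤ) - k) = (r + 1) * esym x N (r + 1) := by
  induction N generalizing r with
  | zero =>
    have : (r : ℤ) + 1 ≠ 0 := by omega
    simp [esym, this]
  | succ N ih =>
    set p : ℕ → ℂ := fun k => ∑ i ∈ Finset.range N, x i ^ (k + 1) with hp
    have h1 : ∑ k ∈ Finset.range (r + 1), (-1) ^ k * p k * esym x N ((r : ℤ) - k - 1) =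
        r * esym x N r := by
      rw [Finset.sum_range_succ, esym_of_neg x N _ (by omega), mul_zero, add_zero]
      cases r with
      | zero => simp
      | succ r =>
        have := ih r
        push_cast
        rw [← this]
        refine Finset.sum_congr rfl fun k _ => ?_
        rw [show (r : ℤ) + 1 - k - 1 = r - k by ring]
    have h2 : ∑ k ∈ Finset.range (r + 1), ((-1) ^ k * x N ^ (k + 1) * esym x N ((r : ℤ) - k) +
        (-1) ^ k * x N ^ (k + 1) * (x N * esym x N ((r : ℤ) - k - 1))) = x N * esym x N r := by
      have h3 := Finset.sum_range_sub' (fun k : ℕ => (-1) ^ k * x N ^ (k + 1) *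
        esym x N ((r : ℤ) - k)) (r + 1)
      rw [esym_of_neg x N ((r : ℤ) - (r + 1 : ℕ)) (by push_cast; omega)] at h3
      simp only [pow_zero, one_mul, Nat.cast_zero, sub_zero, mul_zero, zero_add, pow_one] at h3
      rw [← h3]
      refine Finset.sum_congr rfl fun k _ => ?_
      rw [show (r : ℤ) - ((k + 1 : ℕ) : ℤ) = r - k - 1 by push_cast; ring]
      ring
    have h4 : ∑ k ∈ Finset.range (r + 1), (-1) ^ k *
        (∑ i ∈ Finset.range (N + 1), x i ^ (k + 1)) * esym x (N + 1) ((r : ℤ) - k) =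
        ∑ k ∈ Finset.range (r + 1), (-1) ^ k * p k * esym x N ((r : ℤ) - k) +
        x N * ∑ k ∈ Finset.range (r + 1), (-1) ^ k * p k * esym x N ((r : ℤ) - k - 1) +
        ∑ k ∈ Finset.range (r + 1), ((-1) ^ k * x N ^ (k + 1) * esym x N ((r : ℤ) - k) +
        (-1) ^ k * x N ^ (k + 1) * (x N * esym x N ((r : ℤ) - k - 1))) := by
      rw [Finset.mul_sum, ← Finset.sum_add_distrib, ← Finset.sum_add_distrib]
      refine Finset.sum_congr rfl fun k _ => ?_
      rw [Finset.sum_range_succ, esym, hp]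
      ring
    rw [h4, h1, h2, ih, esym, add_sub_cancel_right]
    ring

theorem completeH_succ (p : ℕ → ℂ) (r : ℕ) : completeH p (r + 1) =
    (∑ k ∈ Finset.range (r + 1), p (k + 1) * completeH p (r - k)) / ((r : ℂ) + 1) := by
  rw [completeH, Fin.sum_univ_eq_sum_range (fun k => p (k + 1) * completeH p (r - k))]

theorem completeH_neg_psum (x : ℕ → ℂ) (N r : ℕ) :
    completeH (fun k => -∑ i ∈ Finset.range N, x i ^ k) r = (-1) ^ r * esym x N r := by
  induction r using Nat.strong_induction_on with
  | _ r ih =>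
    cases r with
    | zero => simp [completeH]
    | succ r =>
      have h := newton_esym x N r
      have hr : (r : ℂ) + 1 ≠ 0 := Nat.cast_add_one_ne_zero r
      rw [completeH_succ, div_eq_iff hr]
      have h1 : ∑ k ∈ Finset.range (r + 1), (-∑ i ∈ Finset.range N, x i ^ (k + 1)) *
          completeH (fun k => -∑ i ∈ Finset.range N, x i ^ k) (r - k) =
          (-1) ^ (r + 1) * ∑ k ∈ Finset.range (r + 1), (-1) ^ k *
            (∑ i ∈ Finset.range N, x i ^ (k + 1)) * esym x N ((r : ℤ) - k) := by
        rw [Finset.mul_sum]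
        refine Finset.sum_congr rfl fun k hk => ?_
        have hk' : k ≤ r := Nat.lt_succ_iff.1 (Finset.mem_range.1 hk)
        rw [ih (r - k) (by omega), Nat.cast_sub hk']
        have h2 : (-1 : ℂ) ^ (r + 1) * (-1) ^ k = -(-1) ^ (r - k) := by
          obtain ⟨m, rfl⟩ := Nat.exists_eq_add_of_le hk'
          rw [Nat.add_sub_cancel_left, ← pow_add, show k + m + 1 + k = 2 * k + (m + 1) by ring,
            pow_add, pow_mul]
          ring
        linear_combination (-((∑ i ∈ Finset.range N, x i ^ (k + 1)) *
          esym x N ((r : ℤ) - k))) * h2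
      rw [h1, h]
      push_cast
      ring

theorem tendsto_completeH {P : ℕ → ℕ → ℂ} {p : ℕ → ℂ}
    (h : ∀ k, Tendsto (fun N => P N (k + 1)) atTop (𝓝 (p (k + 1)))) (r : ℕ) :
    Tendsto (fun N => completeH (P N) r) atTop (𝓝 (completeH p r)) := by
  induction r using Nat.strong_induction_on with
  | _ r ih =>
    cases r with
    | zero => simp [completeH]
    | succ r =>
      simp only [completeH_succ]
      apply Tendsto.div_const
      exact tendsto_finsetSum _ fun k _ => (h k).mul (ih (r - k) (by omega))

/-- The elementary symmetric functions of the variables with power sums `-p_k`. -/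
def signedH (p : ℕ → ℂ) (r : ℤ) : ℂ := (-1) ^ r * completeHInt p r

theorem tendsto_esym_signedH {x : ℕ → ℂ} {p : ℕ → ℂ}
    (h : ∀ k, HasSum (fun i => x i ^ (k + 1)) (-p (k + 1))) (r : ℤ) :
    Tendsto (fun N => esym x N r) atTop (𝓝 (signedH p r)) := by
  rcases lt_or_ge r 0 with hr | hr
  · have : ∀ N, esym x N r = 0 := fun N => esym_of_neg x N r hr
    simp only [this, signedH, completeHInt, if_pos hr, mul_zero]
    exact tendsto_const_nhds
  · lift r to ℕ using hr
    have h1 : ∀ N, esym x N r = (-1) ^ r *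
        completeH (fun k => -∑ i ∈ Finset.range N, x i ^ k) r := by
      intro N
      rw [completeH_neg_psum, ← mul_assoc, ← mul_pow]
      simp
    have h2 : ¬ (r : ℤ) < 0 := by omega
    simp only [h1, signedH, completeHInt, if_neg h2, zpow_natCast, Int.toNat_natCast]
    apply Tendsto.const_mul
    apply tendsto_completeH
    intro k
    simpa using ((h k).tendsto_sum_nat).neg

theorem signedH_zero (p : ℕ → ℂ) : signedH p 0 = 1 := by
  simp [signedH, completeHInt, completeH]

theorem schur_eq_jt (lam : YoungDiagram) (p : ℕ → ℂ) :
    schur lam p = (-1) ^ lam.card * jt (signedH p) lam := by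
  have hsz : max (lam.colLen 0) ((⊥ : YoungDiagram).colLen 0) = lam.colLen 0 := by simp
  rw [schur, skewSchur]
  generalize hn : max (lam.colLen 0) ((⊥ : YoungDiagram).colLen 0) = n
  rw [hsz] at hn
  rw [jt, hn, jtDet]
  have hM : (Matrix.of fun i j : Fin n => completeHInt p
      ((lam.rowLen i : ℤ) - ((⊥ : YoungDiagram).rowLen j : ℤ) - ((i : ℕ) : ℤ) + ((j : ℕ) : ℤ))) =
      Matrix.of fun i j : Fin n => ((-1 : ℂ) ^ ((lam.rowLen i : ℤ) - (i : ℕ))) *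
        (Matrix.of fun i j : Fin n => (-1 : ℂ) ^ (j : ℕ) *
          (Matrix.of fun i j : Fin n =>
            signedH p ((lam.rowLen i : ℤ) - (i : ℕ) + (j : ℕ))) i j) i j := by
    ext i j
    simp only [Matrix.of_apply, rowLen_bot, signedH, Nat.cast_zero, sub_zero]
    rw [← mul_assoc, ← mul_assoc]
    have : ((-1 : ℂ) ^ ((lam.rowLen i : ℤ) - (i : ℕ))) * (-1) ^ (j : ℕ) *
        (-1) ^ ((lam.rowLen i : ℤ) - (i : ℕ) + (j : ℕ)) = 1 := by
      rw [zpow_add₀ (by norm_num), zpow_natCast, mul_mul_mul_comm, ← mul_pow, ← zpow_add₀ (by norm_num),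
        Even.neg_one_zpow ⟨_, rfl⟩]
      simp
    rw [this, one_mul]
  rw [hM, Matrix.det_mul_column, Matrix.det_mul_row, ← mul_assoc]
  congr 1
  rw [← Finset.prod_mul_distrib, card_eq_sum_rowLen lam hn.le, ← Fin.sum_univ_eq_sum_range,
    ← Finset.prod_pow_eq_pow_sum]
  refine Finset.prod_congr rfl fun i _ => ?_
  rw [← zpow_natCast, ← zpow_natCast, ← zpow_add₀ (by norm_num), sub_add_cancel]

/-! ### The variables `q^{-ν-ρ}` -/

/-- The variables `q^{-ν_i + i + 1/2}`, where `v = q^{1/2}`. -/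
def dualVar (ν : YoungDiagram) (v : ℂ) (i : ℕ) : ℂ := v ^ (-twiceMaya ν i)

theorem geometric_eq {v : ℂ} (hv0 : v ≠ 0) (hv : ‖v‖ < 1) {k : ℕ} (hk : 1 ≤ k) :
    HasSum (fun j : ℕ => v ^ ((k : ℤ) * (2 * (j : ℤ) + 1))) (-(1 / (v ^ (k : ℤ) - v ^ (-(k : ℤ))))) := by
  have hlt : ‖v ^ k‖ < 1 := by
    rw [norm_pow]
    exact pow_lt_one₀ (norm_nonneg v) hv (by omega)
  have hvk : v ^ k ≠ 0 := pow_ne_zero _ hv0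
  have hlt2 : ‖(v ^ k) ^ 2‖ < 1 := by
    rw [norm_pow]
    exact pow_lt_one₀ (norm_nonneg _) hlt two_ne_zero
  have hne : 1 - (v ^ k) ^ 2 ≠ 0 := by
    intro h
    rw [← sub_eq_zero.1 h, norm_one] at hlt2
    exact lt_irrefl _ hlt2
  have hval : v ^ k * (1 - (v ^ k) ^ 2)⁻¹ = -(1 / (v ^ (k : ℤ) - v ^ (-(k : ℤ)))) := by
    rw [zpow_neg, zpow_natCast]
    have h2 : v ^ k - (v ^ k)⁻¹ = -((1 - (v ^ k) ^ 2) * (v ^ k)⁻¹) := by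
      field_simp
      ring
    rw [h2]
    field_simp
  rw [← hval]
  have hg := (hasSum_geometric_of_norm_lt_one hlt2).mul_left (v ^ k)
  have hfun : (fun j : ℕ => v ^ ((k : ℤ) * (2 * (j : ℤ) + 1))) =
      fun j : ℕ => v ^ k * ((v ^ k) ^ 2) ^ j := by
    funext j
    rw [← pow_mul, ← pow_mul, ← pow_add, ← zpow_natCast]
    congr 1
    push_cast
    ring
  rw [hfun]
  exact hg

theorem hasSum_dualVar {v : ℂ} (hv0 : v ≠ 0) (hv : ‖v‖ < 1) (ν : YoungDiagram) {k : ℕ}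
    (hk : 1 ≤ k) :
    HasSum (fun j => dualVar ν.transpose v j ^ k) (-powerSum ν v k) := by
  set g : ℤ → ℂ := fun m => v ^ ((k : ℤ) * (2 * m + 1)) with hg
  have h1 := sum_Ico_eq ν (N := ν.colLen 0) (M := ν.rowLen 0) le_rfl le_rfl g
  have h2 := sum_Ico_eq ⊥ (N := ν.colLen 0) (M := ν.rowLen 0) (by simp) (by simp) g
  have h7 : ∀ i : ℕ, rowPos ⊥ i = -(i : ℤ) - 1 := fun i => by simp [rowPos]
  have h8 : ∀ i : ℕ, colPos ⊥ i = i := fun i => by simp [colPos]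
  rw [h1] at h2
  simp only [h7, h8] at h2
  have hfin : HasSum (fun j : ℕ => g (colPos ν j) - g j)
      (∑ j ∈ Finset.range (ν.rowLen 0), (g (colPos ν j) - g j)) := by
    apply hasSum_sum_of_ne_finset_zero
    intro j hj
    rw [Finset.mem_range, not_lt] at hj
    have : ν.colLen j = 0 := Nat.le_zero.1 (colLen_le_iff.2 hj)
    simp [colPos, this]
  have hsum := hfin.add (geometric_eq hv0 hv hk)
  have hval : ∑ j ∈ Finset.range (ν.rowLen 0), (g (colPos ν j) - g j) +
      -(1 / (v ^ (k : ℤ) - v ^ (-(k : ℤ)))) = -powerSum ν v k := by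
    have h3 : ∀ i, v ^ ((k : ℤ) * twiceMaya ν i) = g (rowPos ν i) := by
      intro i
      simp only [hg, rowPos, twiceMaya]
      congr 2
      ring
    have h4 : ∀ i : ℕ, v ^ ((k : ℤ) * twiceMaya ⊥ i) = g (-(i : ℤ) - 1) := by
      intro i
      simp only [hg, twiceMaya, rowLen_bot]
      congr 2
      push_cast
      ring
    simp only [powerSum, h3, h4]
    rw [Finset.sum_sub_distrib, Finset.sum_sub_distrib]
    linear_combination h2
  rw [hval] at hsum
  have hfun : (fun j => dualVar ν.transpose v j ^ k) =
      fun j : ℕ => g (colPos ν j) - g j + v ^ ((k : ℤ) * (2 * (j : ℤ) + 1)) := by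
    funext j
    simp only [hg, dualVar, twiceMaya, colPos, YoungDiagram.rowLen_transpose, sub_add_cancel]
    rw [← zpow_natCast, ← zpow_mul]
    congr 1
    ring
  rw [hfun]
  exact hsum

theorem summable_norm_dualVar {v : ℂ} (hv0 : v ≠ 0) (hv : ‖v‖ < 1) (ν : YoungDiagram) :
    Summable fun i => ‖dualVar ν v i‖ := by
  have := (hasSum_dualVar hv0 hv ν.transpose le_rfl).summable.norm
  simpa using this

theorem tendsto_esym_dualVar {v : ℂ} (hv0 : v ≠ 0) (hv : ‖v‖ < 1) (ν : YoungDiagram) (r : ℤ) :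
    Tendsto (fun N => esym (dualVar ν.transpose v) N r) atTop (𝓝 (signedH (powerSum ν v) r)) :=
  tendsto_esym_signedH (fun k => hasSum_dualVar hv0 hv ν (Nat.succ_pos k)) r

/-! ### The principal specialization -/

theorem esym_succ_left (x : ℕ → ℂ) (N : ℕ) (r : ℤ) :
    esym x (N + 1) r = esym (fun i => x (i + 1)) N r +
      x 0 * esym (fun i => x (i + 1)) N (r - 1) := by
  induction N generalizing r with
  | zero => simp [esym]
  | succ N ih =>
    rw [esym, ih r, ih (r - 1), esym, esym]
    ring

theorem esym_const_mul (q : ℂ) (hq : q ≠ 0) (x : ℕ → ℂ) (N : ℕ) (r : ℤ) :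
    esym (fun i => q * x i) N r = q ^ r * esym x N r := by
  induction N generalizing r with
  | zero =>
    rw [esym, esym]
    split_ifs with h
    · simp [h]
    · simp
  | succ N ih =>
    rw [esym, esym, ih r, ih (r - 1), zpow_sub_one₀ hq]
    field_simp

theorem dualVar_bot (v : ℂ) (i : ℕ) : dualVar ⊥ v i = v ^ (2 * i + 1) := by
  rw [dualVar, twiceMaya, rowLen_bot, ← zpow_natCast]
  congr 1
  push_cast
  ring

theorem one_sub_zpow_ne_zero {q : ℂ} (hq : ‖q‖ < 1) {k : ℤ} (hk : 0 < k) : 1 - q ^ k ≠ 0 := by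
  lift k to ℕ using hk.le
  intro h
  have h1 : ‖q ^ k‖ < 1 := by
    rw [norm_pow]
    exact pow_lt_one₀ (norm_nonneg q) hq (by omega)
  rw [zpow_natCast] at h
  rw [← sub_eq_zero.1 h, norm_one] at h1
  exact lt_irrefl _ h1

theorem norm_sq_lt_one {v : ℂ} (hv : ‖v‖ < 1) : ‖v ^ 2‖ < 1 := by
  rw [norm_pow]
  exact pow_lt_one₀ (norm_nonneg v) hv two_ne_zero

theorem signedH_bot_sub_one {v : ℂ} (hv0 : v ≠ 0) (hv : ‖v‖ < 1) (r : ℤ) :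
    signedH (powerSum ⊥ v) (r - 1) =
      v ^ (1 - 2 * r) * (1 - (v ^ 2) ^ r) * signedH (powerSum ⊥ v) r := by
  have hlim := tendsto_esym_dualVar hv0 hv ⊥
  rw [transpose_bot] at hlim
  have hq : v ^ 2 ≠ 0 := pow_ne_zero 2 hv0
  have hshift : (fun i => dualVar ⊥ v (i + 1)) = fun i => v ^ 2 * dualVar ⊥ v i := by
    funext i
    rw [dualVar_bot, dualVar_bot, ← pow_add]
    congr 1
    ring
  have h1 : ∀ N, esym (dualVar ⊥ v) (N + 1) r = (v ^ 2) ^ r * esym (dualVar ⊥ v) N r +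
      v * ((v ^ 2) ^ (r - 1) * esym (dualVar ⊥ v) N (r - 1)) := by
    intro N
    rw [esym_succ_left, hshift, esym_const_mul _ hq, esym_const_mul _ hq, dualVar_bot]
    simp
  have h2 := (tendsto_add_atTop_iff_nat 1).2 (hlim r)
  simp only [h1] at h2
  have h3 := tendsto_nhds_unique h2 (((hlim r).const_mul _).add
    (((hlim (r - 1)).const_mul _).const_mul _))
  have h4 : v * (v ^ 2) ^ (r - 1) = (v ^ (1 - 2 * r))⁻¹ := by
    rw [← zpow_natCast, ← zpow_mul, ← zpow_one_add₀ hv0, ← zpow_neg]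
    congr 1
    push_cast
    ring
  rw [← mul_assoc, h4] at h3
  have h5 : v ^ (1 - 2 * r) ≠ 0 := zpow_ne_zero _ hv0
  field_simp at h3
  linear_combination (-1 : ℂ) * h3

/-- `∏_{k=1}^n (1 - q^k)` times `e_n(q^{1/2}, q^{3/2}, …)` is `q^{n^2/2}`. -/
theorem prod_mul_signedH_bot {v : ℂ} (hv0 : v ≠ 0) (hv : ‖v‖ < 1) (n : ℕ) :
    signedH (powerSum ⊥ v) n * ∏ k ∈ Finset.range n, (1 - (v ^ 2) ^ ((k : ℤ) + 1)) =
      v ^ (n ^ 2) := by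
  induction n with
  | zero => simp [signedH_zero]
  | succ n ih =>
    have h := signedH_bot_sub_one hv0 hv ((n + 1 : ℕ) : ℤ)
    rw [Finset.prod_range_succ]
    push_cast at h ⊢
    rw [add_sub_cancel_right] at h
    rw [h] at ih
    have h5 : v ^ (1 - 2 * ((n : ℤ) + 1)) * v ^ (2 * n + 1) = 1 := by
      rw [← zpow_natCast, ← zpow_add₀ hv0,
        show 1 - 2 * ((n : ℤ) + 1) + ((2 * n + 1 : ℕ) : ℤ) = 0 by push_cast; ring, zpow_zero]
    have h6 : v ^ ((n + 1) ^ 2) = v ^ (2 * n + 1) * v ^ (n ^ 2) := by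
      rw [← pow_add]
      congr 1
      ring
    rw [h6, ← ih]
    linear_combination (-signedH (powerSum ⊥ v) ((n : ℤ) + 1) * (1 - (v ^ 2) ^ ((n : ℤ) + 1)) *
      ∏ k ∈ Finset.range n, (1 - (v ^ 2) ^ ((k : ℤ) + 1))) * h5

open Polynomial in
/-- The polynomial `∏_{l < k} (X - q^{-l})`. -/
def qFalling (v : ℂ) (k : ℕ) : ℂ[X] :=
  ∏ l ∈ Finset.range k, (X - C ((v ^ 2) ^ (-(l : ℤ))))

theorem qFalling_monic (v : ℂ) (k : ℕ) : (qFalling v k).Monic :=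
  Polynomial.monic_prod_of_monic _ _ fun _ _ => Polynomial.monic_X_sub_C _

theorem qFalling_natDegree (v : ℂ) (k : ℕ) : (qFalling v k).natDegree = k := by
  rw [qFalling, Polynomial.natDegree_prod_of_monic _ _ fun _ _ => Polynomial.monic_X_sub_C _]
  simp

theorem signedH_bot_sub {v : ℂ} (hv0 : v ≠ 0) (hv : ‖v‖ < 1) (c k : ℕ) :
    signedH (powerSum ⊥ v) ((c : ℤ) - k) = signedH (powerSum ⊥ v) c *
      (v ^ (k ^ 2) * (qFalling v k).eval ((v ^ 2) ^ (-(c : ℤ)))) := by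
  induction k with
  | zero => simp [qFalling]
  | succ k ih =>
    have hq : v ^ 2 ≠ 0 := pow_ne_zero 2 hv0
    have h := signedH_bot_sub_one hv0 hv ((c : ℤ) - k)
    rw [show (c : ℤ) - ((k + 1 : ℕ) : ℤ) = c - k - 1 by push_cast; ring, h, ih]
    have h1 : (qFalling v (k + 1)).eval ((v ^ 2) ^ (-(c : ℤ))) =
        (qFalling v k).eval ((v ^ 2) ^ (-(c : ℤ))) *
          ((v ^ 2) ^ (-(c : ℤ)) - (v ^ 2) ^ (-(k : ℤ))) := by
      rw [qFalling, Finset.prod_range_succ, Polynomial.eval_mul]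
      simp [qFalling]
    have h2 : (v ^ 2) ^ (-(c : ℤ)) - (v ^ 2) ^ (-(k : ℤ)) =
        (v ^ 2) ^ (-(c : ℤ)) * (1 - (v ^ 2) ^ ((c : ℤ) - k)) := by
      rw [mul_sub, mul_one, ← zpow_add₀ hq]
      congr 2
      ring
    have h3 : v ^ (1 - 2 * ((c : ℤ) - k)) * v ^ (k ^ 2) =
        v ^ ((k + 1) ^ 2) * (v ^ 2) ^ (-(c : ℤ)) := by
      rw [← zpow_natCast, ← zpow_natCast, ← zpow_natCast v 2, ← zpow_mul, ← zpow_add₀ hv0,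
        ← zpow_add₀ hv0]
      congr 1
      push_cast
      ring
    rw [h1, h2]
    linear_combination (signedH (powerSum ⊥ v) c * (qFalling v k).eval ((v ^ 2) ^ (-(c : ℤ))) *
      (1 - (v ^ 2) ^ ((c : ℤ) - k))) * h3

theorem pairProd_eq_prod_Ioi {α : Type*} [CommMonoid α] (ν : YoungDiagram) (n : ℕ) (f : ℤ → α) :
    pairProd ν n f = ∏ i : Fin n, ∏ j ∈ Finset.Ioi i,
      f (rowPos ν (Fin.rev j) - rowPos ν (Fin.rev i) : ℤ) := by
  have h1 : ∀ i : Fin n, ∏ j ∈ Finset.Ioi i,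
      f (rowPos ν (Fin.rev j) - rowPos ν (Fin.rev i) : ℤ) =
      ∏ j : Fin n, if i < j then f (rowPos ν (Fin.rev j) - rowPos ν (Fin.rev i) : ℤ) else 1 := by
    intro i
    rw [← Finset.prod_filter]
    congr 1
    ext j
    simp
  rw [Finset.prod_congr rfl fun i _ => h1 i, Finset.prod_comm, pairProd, Finset.prod_range,
    ← Equiv.prod_comp Fin.revPerm]
  refine Finset.prod_congr rfl fun i _ => ?_
  rw [Finset.prod_range, ← Equiv.prod_comp Fin.revPerm]
  refine Finset.prod_congr rfl fun j _ => ?_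
  simp only [Fin.revPerm_apply]
  have h2 : rowPos ν (Fin.rev j) < rowPos ν (Fin.rev i) ↔ j < i := by
    rw [(rowPos_strictAnti ν).lt_iff_gt, ← Fin.lt_def, Fin.rev_lt_rev]
  simp only [h2]

theorem prod_Ioi_eq_prod_pow {n : ℕ} (g : Fin n → ℂ) :
    ∏ i : Fin n, ∏ j ∈ Finset.Ioi i, g j = ∏ j : Fin n, g j ^ (j : ℕ) := by
  rw [Finset.prod_comm' (t' := Finset.univ) (s' := fun j => Finset.Iio j)
    (by intro i j; simp)]
  refine Finset.prod_congr rfl fun j _ => ?_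
  rw [Finset.prod_const, Fin.card_Iio]

theorem jt_signedH_bot {v : ℂ} (hv0 : v ≠ 0) (hv : ‖v‖ < 1) (ν : YoungDiagram) :
    jt (signedH (powerSum ⊥ v)) ν * ∏ c ∈ ν.cells, (1 - (v ^ 2) ^ hookLength ν c) =
      v ^ (∑ i ∈ Finset.range (ν.colLen 0), ν.rowLen i ^ 2) := by
  have hq : v ^ 2 ≠ 0 := pow_ne_zero 2 hv0
  set n := ν.colLen 0 with hn
  set e := signedH (powerSum ⊥ v) with he
  set f : ℤ → ℂ := fun k => 1 - (v ^ 2) ^ k with hf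
  set γ : Fin n → ℕ := fun i => ν.rowLen (Fin.rev i) + i with hγ
  have hpos : ∀ i j : Fin n, rowPos ν (Fin.rev j) - rowPos ν (Fin.rev i) = (γ j : ℤ) - γ i := by
    intro i j
    simp only [rowPos, hγ, Fin.val_rev]
    have := i.2
    have := j.2
    omega
  have hdet : jt e ν = (∏ i, e (γ i)) * ((∏ j : Fin n, v ^ ((j : ℕ) ^ 2)) *
      ((∏ j : Fin n, ((v ^ 2) ^ (-(γ j : ℤ))) ^ (j : ℕ)) * pairProd ν n f)) := by
    rw [jt, jtDet, ← Matrix.det_submatrix_equiv_self Fin.revPerm]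
    have hM : (Matrix.of fun i j : Fin (ν.colLen 0) =>
        e ((ν.rowLen i : ℤ) - (i : ℕ) + (j : ℕ))).submatrix Fin.revPerm Fin.revPerm =
        Matrix.of fun i j : Fin n => e (γ i) *
          (Matrix.of fun i j : Fin n => v ^ ((j : ℕ) ^ 2) *
            (Matrix.of fun i j : Fin n =>
              (qFalling v j).eval ((v ^ 2) ^ (-(γ i : ℤ)))) i j) i j := by
      ext i j
      simp only [Matrix.submatrix_apply, Matrix.of_apply, Fin.revPerm_apply]
      rw [he, ← signedH_bot_sub hv0 hv]
      congr 1
      simp only [hγ, Fin.val_rev, ← hn]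
      have := i.2
      have := j.2
      omega
    have hV : ∏ i : Fin n, ∏ j ∈ Finset.Ioi i,
        ((v ^ 2) ^ (-(γ j : ℤ)) - (v ^ 2) ^ (-(γ i : ℤ))) =
        (∏ j : Fin n, ((v ^ 2) ^ (-(γ j : ℤ))) ^ (j : ℕ)) * pairProd ν n f := by
      rw [pairProd_eq_prod_Ioi, ← prod_Ioi_eq_prod_pow, ← Finset.prod_mul_distrib]
      refine Finset.prod_congr rfl fun i _ => ?_
      rw [← Finset.prod_mul_distrib]
      refine Finset.prod_congr rfl fun j _ => ?_
      rw [hpos, hf]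
      dsimp only
      rw [mul_sub, mul_one, ← zpow_add₀ hq]
      congr 2
      ring
    rw [hM, Matrix.det_mul_column, Matrix.det_mul_row,
      ← Matrix.det_eval_matrixOfPolynomials_eq_det_vandermonde
        (fun i : Fin n => (v ^ 2) ^ (-(γ i : ℤ))) (fun j : Fin n => qFalling v j)
        (fun j => qFalling_natDegree v j) (fun j => qFalling_monic v j),
      Matrix.det_vandermonde, hV]
  have hF := prod_range_rowPos_eq ν f (N := n) le_rfl
  have hF' : ∏ i ∈ Finset.range n, ∏ k ∈ Finset.range (ν.rowLen i + (n - 1 - i)), f (k + 1) =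
      ∏ i : Fin n, ∏ k ∈ Finset.range (γ i), f (k + 1) := by
    rw [Finset.prod_range, ← Equiv.prod_comp Fin.revPerm]
    refine Finset.prod_congr rfl fun i _ => ?_
    have : n - 1 - (Fin.rev i : ℕ) = i := by
      rw [Fin.val_rev]
      have := i.2
      omega
    simp only [Fin.revPerm_apply, this, hγ]
  have hpair : pairProd ν n f ≠ 0 := by
    rw [pairProd, Finset.prod_ne_zero_iff]
    intro i _
    rw [Finset.prod_ne_zero_iff]
    intro k _
    split_ifs with h
    · exact one_sub_zpow_ne_zero (norm_sq_lt_one hv) (by omega)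
    · exact one_ne_zero
  have hE : (∏ i, e (γ i)) * ∏ i : Fin n, ∏ k ∈ Finset.range (γ i), f (k + 1) =
      ∏ i : Fin n, v ^ (γ i ^ 2) := by
    rw [← Finset.prod_mul_distrib]
    exact Finset.prod_congr rfl fun i _ => prod_mul_signedH_bot hv0 hv (γ i)
  have hpow : (∏ i : Fin n, v ^ (γ i ^ 2)) * ((∏ j : Fin n, v ^ ((j : ℕ) ^ 2)) *
      ∏ j : Fin n, ((v ^ 2) ^ (-(γ j : ℤ))) ^ (j : ℕ)) =
      v ^ (∑ i ∈ Finset.range n, ν.rowLen i ^ 2) := by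
    have h1 : ∏ i ∈ Finset.range n, v ^ (ν.rowLen i ^ 2) =
        ∏ i : Fin n, v ^ (ν.rowLen (Fin.rev i) ^ 2) := by
      rw [Finset.prod_range, ← Equiv.prod_comp Fin.revPerm]
      rfl
    rw [← Finset.prod_pow_eq_pow_sum, h1, ← Finset.prod_mul_distrib, ← Finset.prod_mul_distrib]
    refine Finset.prod_congr rfl fun i _ => ?_
    rw [← zpow_natCast, ← zpow_natCast, ← zpow_natCast, ← zpow_natCast,
      ← zpow_natCast v, ← zpow_mul, ← zpow_mul, ← zpow_add₀ hv0, ← zpow_add₀ hv0]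
    congr 1
    simp only [hγ]
    push_cast
    ring
  rw [hF'] at hF
  apply mul_right_cancel₀ hpair
  have hcell : ∏ c ∈ ν.cells, (1 - (v ^ 2) ^ hookLength ν c) =
      ∏ c ∈ ν.cells, f (hookLength ν c) := by
    refine Finset.prod_congr rfl fun c _ => ?_
    rw [hf]
    dsimp only
    rw [zpow_natCast]
  rw [hcell, mul_assoc, mul_comm (∏ c ∈ ν.cells, f (hookLength ν c)), ← hF, hdet, ← hpow, ← hE]
  ring

theorem sum_cells_arm (ν : YoungDiagram) :
    ∑ c ∈ ν.cells, (2 * (ν.rowLen c.1 - (c.2 + 1)) + 1) =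
      ∑ i ∈ Finset.range (ν.colLen 0), ν.rowLen i ^ 2 := by
  rw [sum_cells ν _ le_rfl]
  refine Finset.sum_congr rfl fun i _ => ?_
  dsimp only
  rw [← Finset.sum_range_reflect]
  have h : ∀ m : ℕ, ∑ j ∈ Finset.range m, (2 * j + 1) = m ^ 2 := by
    intro m
    induction m with
    | zero => rfl
    | succ m ih => rw [Finset.sum_range_succ, ih]; ring
  rw [← h]
  refine Finset.sum_congr rfl fun j hj => ?_
  rw [Finset.mem_range] at hj
  omega

@[to_additive]
theorem prod_cells_transpose {α : Type*} [CommMonoid α] (ν : YoungDiagram) (f : ℕ × ℕ → α) :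
    ∏ c ∈ ν.transpose.cells, f c = ∏ c ∈ ν.cells, f c.swap := by
  refine Finset.prod_bij' (fun c _ => c.swap) (fun c _ => c.swap) ?_ ?_ ?_ ?_ ?_
  · intro c hc
    simpa using hc
  · intro c hc
    simpa using hc
  · intro c _
    exact Prod.swap_swap c
  · intro c _
    exact Prod.swap_swap c
  · intro c _
    rw [Prod.swap_swap]

theorem hookLength_transpose (ν : YoungDiagram) (c : ℕ × ℕ) :
    hookLength ν.transpose c.swap = hookLength ν c := by
  simp only [hookLength, YoungDiagram.rowLen_transpose, YoungDiagram.colLen_transpose,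
    Prod.fst_swap, Prod.snd_swap]
  omega

theorem sum_sq_add_sum_sq (ν : YoungDiagram) :
    ∑ i ∈ Finset.range (ν.colLen 0), ν.rowLen i ^ 2 +
      ∑ i ∈ Finset.range (ν.transpose.colLen 0), ν.transpose.rowLen i ^ 2 =
      ∑ c ∈ ν.cells, 2 * hookLength ν c := by
  rw [← sum_cells_arm, ← sum_cells_arm, sum_cells_transpose, ← Finset.sum_add_distrib]
  refine Finset.sum_congr rfl fun c _ => ?_
  simp only [hookLength, YoungDiagram.rowLen_transpose, Prod.fst_swap, Prod.snd_swap]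
  omega

theorem schur_mul_schur_transpose {v : ℂ} (hv0 : v ≠ 0) (hv : ‖v‖ < 1) (ν : YoungDiagram) :
    schur ν (powerSum ⊥ v) * schur ν.transpose (powerSum ⊥ v) =
      ∏ c ∈ ν.cells, (v ^ 2) ^ hookLength ν c / (1 - (v ^ 2) ^ hookLength ν c) ^ 2 := by
  have h1 := jt_signedH_bot hv0 hv ν
  have h2 := jt_signedH_bot hv0 hv ν.transpose
  simp only [prod_cells_transpose, hookLength_transpose] at h2
  have hne : ∏ c ∈ ν.cells, (1 - (v ^ 2) ^ hookLength ν c) ≠ 0 := by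
    rw [Finset.prod_ne_zero_iff]
    intro c _
    have := one_sub_zpow_ne_zero (norm_sq_lt_one hv) (k := hookLength ν c)
      (by exact_mod_cast hookLength_pos ν c)
    rwa [zpow_natCast] at this
  rw [schur_eq_jt, schur_eq_jt, card_transpose, Finset.prod_div_distrib, Finset.prod_pow,
    eq_div_iff (pow_ne_zero 2 hne)]
  have h3 : ((-1 : ℂ) ^ ν.card) * (-1) ^ ν.card = 1 := by
    rw [← mul_pow]
    simp
  have h4 : ∏ c ∈ ν.cells, (v ^ 2) ^ hookLength ν c =
      v ^ (∑ i ∈ Finset.range (ν.colLen 0), ν.rowLen i ^ 2) *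
        v ^ (∑ i ∈ Finset.range (ν.transpose.colLen 0), ν.transpose.rowLen i ^ 2) := by
    rw [← pow_add, sum_sq_add_sum_sq, ← Finset.prod_pow_eq_pow_sum]
    exact Finset.prod_congr rfl fun c _ => (pow_mul v 2 _).symm
  rw [h4, ← h1, ← h2]
  linear_combination (jt (signedH (powerSum ⊥ v)) ν *
    jt (signedH (powerSum ⊥ v)) ν.transpose *
    (∏ c ∈ ν.cells, (1 - (v ^ 2) ^ hookLength ν c)) ^ 2) * h3

/-! ### The topological vertex with one trivial leg -/

theorem schur_bot (p : ℕ → ℂ) : schur ⊥ p = 1 := by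
  rw [schur_eq_jt, jt_bot, card_bot, pow_zero, one_mul]

theorem skewSchur_bot_left {η : YoungDiagram} (h : η ≠ ⊥) (p : ℕ → ℂ) : skewSchur ⊥ η p = 0 := by
  have hpos : 0 < η.rowLen 0 := by
    by_contra h0
    apply h
    apply ext_rowLen
    intro i
    have := η.rowLen_anti 0 i (Nat.zero_le i)
    rw [rowLen_bot]
    omega
  have hcol := colLen_zero_pos hpos
  rw [skewSchur]
  apply Matrix.det_eq_zero_of_column_eq_zero
    (⟨0, lt_max_of_lt_right hcol⟩ : Fin (max ((⊥ : YoungDiagram).colLen 0) (η.colLen 0)))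
  intro i
  simp only [Matrix.of_apply, rowLen_bot, completeHInt]
  rw [if_pos]
  omega

theorem topVertex_bot_left (μ ν : YoungDiagram) (v : ℂ) :
    topVertex ⊥ μ ν v = (v ^ 2) ^ halfKappa ν * schur ν.transpose (powerSum ⊥ v) *
      schur μ (powerSum ν.transpose v) := by
  have hk : halfKappa ⊥ = 0 := by simp [halfKappa]
  rw [topVertex, hk, zero_add, transpose_bot, finsum_eq_single _ ⊥]
  · change _ * (schur ⊥ _ * schur μ _) = _
    rw [schur_bot, one_mul]
  · intro η hη
    rw [skewSchur_bot_left hη, zero_mul]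

theorem halfKappa_transpose (ν : YoungDiagram) : halfKappa ν.transpose = -halfKappa ν := by
  rw [halfKappa, halfKappa, sum_cells_transpose, ← Finset.sum_neg_distrib]
  refine Finset.sum_congr rfl fun c _ => ?_
  simp

theorem zTerm_eq {v : ℂ} (hv0 : v ≠ 0) (hv : ‖v‖ < 1) (Q Q₁ : ℂ) (μ ν : YoungDiagram) :
    zTerm Q Q₁ v (μ, ν) =
      ((-Q) ^ ν.card *
        ∏ c ∈ ν.cells, (v ^ 2) ^ hookLength ν c / (1 - (v ^ 2) ^ hookLength ν c) ^ 2) *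
      ((-Q₁) ^ μ.card * jt (signedH (powerSum ν v)) μ *
        jt (signedH (powerSum ν.transpose v)) μ.transpose) := by
  have hq : v ^ 2 ≠ 0 := pow_ne_zero 2 hv0
  rw [zTerm, topVertex_bot_left, topVertex_bot_left, YoungDiagram.transpose_transpose,
    halfKappa_transpose, ← schur_mul_schur_transpose hv0 hv, schur_eq_jt μ, schur_eq_jt μ.transpose,
    card_transpose]
  have h1 : (v ^ 2) ^ halfKappa ν * (v ^ 2) ^ (-halfKappa ν) = 1 := by
    rw [← zpow_add₀ hq, add_neg_cancel, zpow_zero]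
  have h2 : ((-1 : ℂ) ^ μ.card) * (-1) ^ μ.card = 1 := by
    rw [← mul_pow]
    simp
  dsimp only
  linear_combination ((-Q₁) ^ μ.card * (-Q) ^ ν.card * schur ν.transpose (powerSum ⊥ v) *
    schur ν (powerSum ⊥ v) * jt (signedH (powerSum ν v)) μ *
    jt (signedH (powerSum ν.transpose v)) μ.transpose) *
    ((v ^ 2) ^ halfKappa ν * (v ^ 2) ^ (-halfKappa ν) * h2 + h1)

/-! ### Comparison with the empty partition -/

theorem dualVar_mul_dualVar {v : ℂ} (hv0 : v ≠ 0) (ν : YoungDiagram) (i j : ℕ) :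
    dualVar ν v i * dualVar ν.transpose v j = (v ^ 2) ^ (colPos ν j - rowPos ν i) := by
  rw [dualVar, dualVar, ← zpow_add₀ hv0, ← zpow_natCast, ← zpow_mul]
  congr 1
  simp only [twiceMaya, rowPos, colPos, YoungDiagram.rowLen_transpose]
  push_cast
  ring

/-- The product over particle-hole pairs in an `N × N` window. -/
def windowProd {𝕜 : Type*} [CommMonoid 𝕜] (ν : YoungDiagram) (f : ℤ → 𝕜) (N : ℕ) : 𝕜 :=
  ∏ i ∈ Finset.range N, ∏ j ∈ Finset.range N, f (colPos ν j - rowPos ν i)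

/-- The ratio of the window products of `ν` and the empty partition, up to hooks. -/
def windowRatio {𝕜 : Type*} [CommMonoid 𝕜] (ν : YoungDiagram) (f : ℤ → 𝕜) (N : ℕ) : 𝕜 :=
  ∏ i ∈ Finset.range (ν.colLen 0), ∏ k ∈ Finset.range (ν.rowLen i),
    f ((N : ℤ) - i + k) * f ((N : ℤ) + i - ν.rowLen i + k + 1)

theorem windowProd_mul_windowRatio {𝕜 : Type*} [Field 𝕜] (ν : YoungDiagram) {f : ℤ → 𝕜}
    (hf : ∀ k : ℤ, 0 < k → f k ≠ 0) {N : ℕ} (hN : ν.card ≤ N) :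
    windowProd ν f N * windowRatio ν f N =
      (∏ c ∈ ν.cells, f (hookLength ν c) * f (-(hookLength ν c : ℤ))) * windowProd ⊥ f N := by
  have hl := (colLen_le_card ν 0).trans hN
  have h1 := prod_colPos_sub_rowPos ν f hl ((rowLen_le_card ν 0).trans hN)
  have h2 := prod_colPos_sub_rowPos ⊥ f (N := N) (M := N) (by simp) (by simp)
  simp only [rowLen_bot, YoungDiagram.cells_bot, Finset.prod_empty, one_mul, zero_add,
    Nat.sub_zero] at h2
  set F : ℕ → 𝕜 := fun n => ∏ k ∈ Finset.range n, f (k + 1) with hF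
  have hF0 : ∀ n, F n ≠ 0 := fun n =>
    Finset.prod_ne_zero_iff.2 fun k _ => hf _ (by omega)
  have hFadd : ∀ a m, F (a + m) = F a * ∏ k ∈ Finset.range m, f ((a : ℤ) + k + 1) := by
    intro a m
    simp only [hF]
    rw [Finset.prod_range_add]
    push_cast
    rfl
  have hratio : windowRatio ν f N = (∏ i ∈ Finset.range N, ∏ k ∈ Finset.range (ν.rowLen i),
      f ((N : ℤ) - i + k)) * ∏ i ∈ Finset.range N, ∏ k ∈ Finset.range (ν.rowLen i),
        f ((N : ℤ) + i - ν.rowLen i + k + 1) := by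
    rw [windowRatio, ← Finset.prod_mul_distrib]
    simp only [← Finset.prod_mul_distrib]
    apply Finset.prod_subset
    · intro i hi
      rw [Finset.mem_range] at hi ⊢
      omega
    · intro i _ hi
      rw [Finset.mem_range, not_lt] at hi
      rw [rowLen_eq_zero hi, Finset.range_zero, Finset.prod_empty]
  have h3 : ∏ i ∈ Finset.range N, F (ν.rowLen i + (N - 1 - i)) =
      (∏ i ∈ Finset.range N, F (N - 1 - i)) * ∏ i ∈ Finset.range N,
        ∏ k ∈ Finset.range (ν.rowLen i), f ((N : ℤ) - i + k) := by
    rw [← Finset.prod_mul_distrib]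
    refine Finset.prod_congr rfl fun i hi => ?_
    rw [Finset.mem_range] at hi
    rw [add_comm, hFadd]
    congr 1
    refine Finset.prod_congr rfl fun k _ => ?_
    congr 1
    omega
  have h4 : ∏ i ∈ Finset.range N, F (N + i) =
      (∏ i ∈ Finset.range N, F (N + i - ν.rowLen i)) * ∏ i ∈ Finset.range N,
        ∏ k ∈ Finset.range (ν.rowLen i), f ((N : ℤ) + i - ν.rowLen i + k + 1) := by
    rw [← Finset.prod_mul_distrib]
    refine Finset.prod_congr rfl fun i _ => ?_
    have hle : ν.rowLen i ≤ N + i := ((rowLen_le_card ν i).trans hN).trans (Nat.le_add_right N i)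
    conv_lhs => rw [← Nat.sub_add_cancel hle, hFadd]
    congr 1
    refine Finset.prod_congr rfl fun k _ => ?_
    congr 1
    omega
  change windowProd ν f N * ∏ i ∈ Finset.range N, F (ν.rowLen i + (N - 1 - i)) =
    _ * ∏ i ∈ Finset.range N, F (N + i - ν.rowLen i) at h1
  change windowProd ⊥ f N * ∏ i ∈ Finset.range N, F (N - 1 - i) =
    ∏ i ∈ Finset.range N, F (N + i) at h2
  have hA : ∏ i ∈ Finset.range N, F (N - 1 - i) ≠ 0 :=
    Finset.prod_ne_zero_iff.2 fun i _ => hF0 _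
  rw [h3] at h1
  rw [h4] at h2
  rw [hratio]
  apply mul_right_cancel₀ hA
  linear_combination (∏ i ∈ Finset.range N, ∏ k ∈ Finset.range (ν.rowLen i),
    f ((N : ℤ) + i - ν.rowLen i + k + 1)) * h1 -
    (∏ c ∈ ν.cells, f (hookLength ν c) * f (-(hookLength ν c : ℤ))) * h2

theorem tendsto_windowRatio (ν : YoungDiagram) {f : ℤ → ℂ} (hf : Tendsto f atTop (𝓝 1)) :
    Tendsto (windowRatio ν f) atTop (𝓝 1) := by
  have h : ∀ a : ℤ, Tendsto (fun N : ℕ => f ((N : ℤ) + a)) atTop (𝓝 1) := fun a =>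
    hf.comp (tendsto_atTop_add_const_right _ a tendsto_natCast_atTop_atTop)
  have h1 : Tendsto (windowRatio ν f) atTop
      (𝓝 (∏ i ∈ Finset.range (ν.colLen 0), ∏ k ∈ Finset.range (ν.rowLen i), (1 : ℂ) * 1)) := by
    refine tendsto_finsetProd _ fun i _ => tendsto_finsetProd _ fun k _ => Tendsto.mul ?_ ?_
    · convert h (-(i : ℤ) + k) using 3
      ring
    · convert h ((i : ℤ) - ν.rowLen i + k + 1) using 3
      ring
  simpa using h1

theorem one_le_windowRatio (ν : YoungDiagram) {f : ℤ → ℝ} (hf : ∀ k, 1 ≤ f k) (N : ℕ) :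
    1 ≤ windowRatio ν f N := by
  have hprod : ∀ (s : Finset ℕ) (g : ℕ → ℝ), (∀ i, 1 ≤ g i) → 1 ≤ ∏ i ∈ s, g i := by
    intro s g hg
    exact Finset.prod_induction g (1 ≤ ·)
      (fun a b ha hb => one_le_mul_of_one_le_of_one_le ha hb) le_rfl fun i _ => hg i
  exact hprod _ _ fun i => hprod _ _ fun k => one_le_mul_of_one_le_of_one_le (hf _) (hf _)

theorem sum_sum_pow_le {x : ℝ} (h0 : 0 ≤ x) (h1 : x < 1) (N : ℕ) :
    ∑ i ∈ Finset.range N, ∑ j ∈ Finset.range N, x ^ (i + j + 1) ≤ (1 - x)⁻¹ * (1 - x)⁻¹ := by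
  have h2 : ∑ i ∈ Finset.range N, ∑ j ∈ Finset.range N, x ^ (i + j + 1) =
      (∑ i ∈ Finset.range N, x ^ i) * ∑ j ∈ Finset.range N, x ^ (j + 1) := by
    rw [Finset.sum_mul_sum]
    refine Finset.sum_congr rfl fun i _ => Finset.sum_congr rfl fun j _ => ?_
    ring
  have h3 : ∑ i ∈ Finset.range N, x ^ i ≤ (1 - x)⁻¹ := by
    rw [← tsum_geometric_of_lt_one h0 h1]
    exact (summable_geometric_of_lt_one h0 h1).sum_le_tsum _ fun k _ => pow_nonneg h0 k
  rw [h2]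
  exact mul_le_mul h3 (sum_pow_succ_le h0 h1 N)
    (Finset.sum_nonneg fun k _ => pow_nonneg h0 _) (inv_nonneg.2 (by linarith))

theorem colPos_sub_rowPos_bot (i j : ℕ) : colPos ⊥ j - rowPos ⊥ i = ((i + j + 1 : ℕ) : ℤ) := by
  simp only [colPos, rowPos, rowLen_bot, colLen_bot]
  push_cast
  ring

theorem windowProd_bot_le {y x : ℝ} (hy0 : 0 ≤ y) (hy : y ≤ 1) (h0 : 0 ≤ x) (h1 : x < 1) (N : ℕ) :
    windowProd ⊥ (fun k : ℤ => 1 + y * x ^ k) N ≤ Real.exp ((1 - x)⁻¹ * (1 - x)⁻¹) := by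
  rw [windowProd]
  simp only [colPos_sub_rowPos_bot, zpow_natCast]
  calc ∏ i ∈ Finset.range N, ∏ j ∈ Finset.range N, (1 + y * x ^ (i + j + 1))
      ≤ ∏ i ∈ Finset.range N, ∏ j ∈ Finset.range N, Real.exp (x ^ (i + j + 1)) := by
        refine Finset.prod_le_prod (fun i _ => Finset.prod_nonneg fun j _ => by positivity)
          fun i _ => Finset.prod_le_prod (fun j _ => by positivity) fun j _ => ?_
        have h2 := Real.add_one_le_exp (x ^ (i + j + 1))
        have h3 : y * x ^ (i + j + 1) ≤ 1 * x ^ (i + j + 1) :=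
          mul_le_mul_of_nonneg_right hy (pow_nonneg h0 _)
        linarith
    _ = Real.exp (∑ i ∈ Finset.range N, ∑ j ∈ Finset.range N, x ^ (i + j + 1)) := by
        simp only [Real.exp_sum]
    _ ≤ _ := Real.exp_le_exp.2 (sum_sum_pow_le h0 h1 N)

theorem le_norm_windowProd_bot {y z : ℂ} (hy : ‖y‖ ≤ 1) (hz : ‖z‖ < 1) (N : ℕ) :
    Real.exp (-((1 - ‖z‖)⁻¹ * (1 - ‖z‖)⁻¹ / (1 - ‖z‖))) ≤
      ‖windowProd ⊥ (fun k : ℤ => 1 - y * z ^ k) N‖ := by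
  set x := ‖z‖ with hx
  have h0 : 0 ≤ x := norm_nonneg z
  rw [windowProd]
  simp only [colPos_sub_rowPos_bot, zpow_natCast, norm_prod]
  have hxp : ∀ m : ℕ, x ^ (m + 1) ≤ x := fun m => by
    simpa using pow_le_pow_of_le_one h0 hz.le (Nat.succ_le_succ (Nat.zero_le m))
  calc Real.exp (-((1 - x)⁻¹ * (1 - x)⁻¹ / (1 - x)))
      ≤ Real.exp (-((∑ i ∈ Finset.range N, ∑ j ∈ Finset.range N, x ^ (i + j + 1)) / (1 - x))) := by
        apply Real.exp_le_exp.2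
        apply neg_le_neg
        exact div_le_div_of_nonneg_right (sum_sum_pow_le h0 hz N) (by linarith)
    _ = ∏ i ∈ Finset.range N, ∏ j ∈ Finset.range N, Real.exp (-(x ^ (i + j + 1) / (1 - x))) := by
        simp only [← Real.exp_sum, Finset.sum_neg_distrib, Finset.sum_div]
    _ ≤ _ := by
        refine Finset.prod_le_prod (fun i _ => Finset.prod_nonneg fun j _ => (Real.exp_pos _).le)
          fun i _ => Finset.prod_le_prod (fun j _ => (Real.exp_pos _).le) fun j _ => ?_
        have h2 := hxp (i + j)
        have h3 : 1 - x ^ (i + j + 1) ≤ ‖1 - y * z ^ (i + j + 1)‖ := by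
          have h4 := norm_sub_norm_le 1 (y * z ^ (i + j + 1))
          rw [norm_one, norm_mul, norm_pow, ← hx] at h4
          have h5 : ‖y‖ * x ^ (i + j + 1) ≤ 1 * x ^ (i + j + 1) :=
            mul_le_mul_of_nonneg_right hy (pow_nonneg h0 _)
          linarith
        refine le_trans ?_ h3
        have h6 : 0 < 1 - x ^ (i + j + 1) := by linarith
        have h7 := inv_one_sub_le_exp (y := x ^ (i + j + 1)) (by linarith)
        have h8 : Real.exp (x ^ (i + j + 1) / (1 - x ^ (i + j + 1))) ≤
            Real.exp (x ^ (i + j + 1) / (1 - x)) :=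
          Real.exp_le_exp.2 (div_le_div_of_nonneg_left (pow_nonneg h0 _) (by linarith)
            (by linarith))
        rw [Real.exp_neg]
        exact inv_le_of_inv_le₀ h6 (h7.trans h8)

/-! ### Summation over the first partition -/

/-- The factor of the partition function that does not depend on the second partition. -/
def vacuumSum (Q₁ v : ℂ) : ℂ :=
  ∑' μ : YoungDiagram, (-Q₁) ^ μ.card * jt (signedH (powerSum ⊥ v)) μ *
    jt (signedH (powerSum ⊥ v)) μ.transpose

theorem sum_norm_fibre_le_and_tendsto {v : ℂ} (hv0 : v ≠ 0) (hv : ‖v‖ < 1) {Q₁ : ℂ}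
    (hQ₁ : ‖Q₁‖ ≤ 1) (ν : YoungDiagram) :
    (∀ u : Finset YoungDiagram, ∑ μ ∈ u, ‖(-Q₁) ^ μ.card * jt (signedH (powerSum ν v)) μ *
        jt (signedH (powerSum ν.transpose v)) μ.transpose‖ ≤
      (∏ c ∈ ν.cells, (1 + ‖Q₁‖ * ‖v ^ 2‖ ^ hookLength ν c) *
        (1 + ‖Q₁‖ * ‖v ^ 2‖ ^ (-(hookLength ν c : ℤ)))) *
        Real.exp ((1 - ‖v ^ 2‖)⁻¹ * (1 - ‖v ^ 2‖)⁻¹)) ∧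
    Tendsto (windowProd ν fun k : ℤ => 1 - Q₁ * (v ^ 2) ^ k) atTop
      (𝓝 (∑' μ : YoungDiagram, (-Q₁) ^ μ.card * jt (signedH (powerSum ν v)) μ *
        jt (signedH (powerSum ν.transpose v)) μ.transpose)) := by
  set z := v ^ 2 with hz
  have hz1 : ‖z‖ < 1 := norm_sq_lt_one hv
  have hzpow : ∀ k : ℤ, 0 ≤ ‖z‖ ^ k := fun k => zpow_nonneg (norm_nonneg z) k
  have hb := tendsto_esym_dualVar hv0 hv ν.transpose
  rw [YoungDiagram.transpose_transpose] at hb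
  have hK : ∀ᶠ N : ℕ in atTop, ∏ j ∈ Finset.range N, ∏ i ∈ Finset.range N,
      (1 + ‖-Q₁‖ * ‖dualVar ν v j‖ * ‖dualVar ν.transpose v i‖) ≤
      (∏ c ∈ ν.cells, (1 + ‖Q₁‖ * ‖z‖ ^ hookLength ν c) *
        (1 + ‖Q₁‖ * ‖z‖ ^ (-(hookLength ν c : ℤ)))) *
        Real.exp ((1 - ‖z‖)⁻¹ * (1 - ‖z‖)⁻¹) := by
    filter_upwards [eventually_ge_atTop ν.card] with N hN
    set f : ℤ → ℝ := fun k => 1 + ‖Q₁‖ * ‖z‖ ^ k with hf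
    have hf1 : ∀ k, 1 ≤ f k := fun k =>
      le_add_of_nonneg_right (mul_nonneg (norm_nonneg _) (hzpow k))
    have h1 : ∏ j ∈ Finset.range N, ∏ i ∈ Finset.range N,
        (1 + ‖-Q₁‖ * ‖dualVar ν v j‖ * ‖dualVar ν.transpose v i‖) = windowProd ν f N := by
      rw [windowProd]
      refine Finset.prod_congr rfl fun j _ => Finset.prod_congr rfl fun i _ => ?_
      rw [mul_assoc, ← norm_mul, dualVar_mul_dualVar hv0, norm_neg, norm_zpow]
    have h2 := windowProd_mul_windowRatio ν (f := f)
      (fun k _ => (zero_lt_one.trans_le (hf1 k)).ne') hN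
    have h3 := one_le_windowRatio ν hf1 N
    have h4 : 0 ≤ windowProd ν f N := Finset.prod_nonneg fun i _ =>
      Finset.prod_nonneg fun j _ => zero_le_one.trans (hf1 _)
    have h5 := windowProd_bot_le (norm_nonneg Q₁) hQ₁ (norm_nonneg z) hz1 N
    rw [h1]
    calc windowProd ν f N ≤ windowProd ν f N * windowRatio ν f N := le_mul_of_one_le_right h4 h3
      _ = _ := h2
      _ ≤ _ := by
        simp only [hf, zpow_natCast]
        refine mul_le_mul_of_nonneg_left h5 (Finset.prod_nonneg fun c _ => ?_)
        have := hzpow (-(hookLength ν c : ℤ))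
        positivity
  have h := dual_cauchy (summable_norm_dualVar hv0 hv ν.transpose) (summable_norm_dualVar hv0 hv ν)
    (tendsto_esym_dualVar hv0 hv ν) hb (-Q₁) hK
  refine ⟨h.1, ?_⟩
  refine h.2.congr fun N => ?_
  rw [windowProd]
  refine Finset.prod_congr rfl fun j _ => Finset.prod_congr rfl fun i _ => ?_
  rw [mul_assoc, dualVar_mul_dualVar hv0, neg_mul, ← sub_eq_add_neg]

theorem tsum_fibre_eq {v : ℂ} (hv0 : v ≠ 0) (hv : ‖v‖ < 1) {Q₁ : ℂ}
    (hQ₁ : ‖Q₁‖ ≤ 1) (ν : YoungDiagram) :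
    ∑' μ : YoungDiagram, (-Q₁) ^ μ.card * jt (signedH (powerSum ν v)) μ *
        jt (signedH (powerSum ν.transpose v)) μ.transpose =
      (∏ c ∈ ν.cells, (1 - Q₁ * (v ^ 2) ^ hookLength ν c) *
        (1 - Q₁ * (v ^ 2) ^ (-(hookLength ν c : ℤ)))) * vacuumSum Q₁ v := by
  set f : ℤ → ℂ := fun k => 1 - Q₁ * (v ^ 2) ^ k with hf
  have hz1 : ‖v ^ 2‖ < 1 := norm_sq_lt_one hv
  have hlim := (sum_norm_fibre_le_and_tendsto hv0 hv hQ₁ ν).2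
  have hlim0 := (sum_norm_fibre_le_and_tendsto hv0 hv hQ₁ ⊥).2
  rw [transpose_bot] at hlim0
  have hf0 : ∀ k : ℤ, 0 < k → f k ≠ 0 := by
    intro k hk h
    lift k to ℕ using hk.le
    have h1 : ‖Q₁ * (v ^ 2) ^ k‖ < 1 := by
      rw [norm_mul, norm_pow]
      have h2 := pow_lt_one₀ (norm_nonneg (v ^ 2)) hz1 (by omega : k ≠ 0)
      calc ‖Q₁‖ * ‖v ^ 2‖ ^ k ≤ 1 * ‖v ^ 2‖ ^ k :=
            mul_le_mul_of_nonneg_right hQ₁ (pow_nonneg (norm_nonneg _) _)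
        _ < 1 := by rwa [one_mul]
    simp only [hf, zpow_natCast] at h
    rw [← sub_eq_zero.1 h, norm_one] at h1
    exact lt_irrefl _ h1
  have hf1 : Tendsto f atTop (𝓝 1) := by
    have h1 : Tendsto (fun k : ℤ => (v ^ 2) ^ k) atTop (𝓝 0) := by
      have h2 := tendsto_pow_atTop_nhds_zero_of_norm_lt_one hz1
      have h3 : Tendsto Int.toNat atTop atTop :=
        tendsto_atTop.2 fun b => (eventually_ge_atTop (b : ℤ)).mono fun k hk => by omega
      refine (h2.comp h3).congr' ?_
      filter_upwards [eventually_ge_atTop 0] with k hk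
      rw [Function.comp_apply, ← zpow_natCast, Int.toNat_of_nonneg hk]
    simpa using (h1.const_mul Q₁).const_sub 1
  have h1 := hlim.mul (tendsto_windowRatio ν hf1)
  have h2 := hlim0.const_mul
    (∏ c ∈ ν.cells, f (hookLength ν c) * f (-(hookLength ν c : ℤ)))
  rw [mul_one] at h1
  have h3 := tendsto_nhds_unique (h1.congr' ?_) h2
  · rw [h3]
    simp only [hf, zpow_natCast, vacuumSum]
  · filter_upwards [eventually_ge_atTop ν.card] with N hN
    exact windowProd_mul_windowRatio ν hf0 hN

theorem vacuumSum_ne_zero {v : ℂ} (hv0 : v ≠ 0) (hv : ‖v‖ < 1) {Q₁ : ℂ} (hQ₁ : ‖Q₁‖ ≤ 1) :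
    vacuumSum Q₁ v ≠ 0 := by
  have hlim0 := (sum_norm_fibre_le_and_tendsto hv0 hv hQ₁ ⊥).2
  rw [transpose_bot] at hlim0
  have h := ge_of_tendsto' hlim0.norm fun N =>
    le_norm_windowProd_bot hQ₁ (norm_sq_lt_one hv) N
  rw [← norm_pos_iff]
  exact (Real.exp_pos _).trans_le h

/-! ### Absolute convergence -/

theorem exists_pow_le_mul_pow {C δ : ℝ} (hC : 1 ≤ C) (hδ : 1 < δ) (L : ℕ) :
    ∃ A : ℝ, ∀ m n : ℕ, m ^ 2 ≤ L * n → C ^ m ≤ A * δ ^ n := by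
  obtain ⟨m₀, hm₀⟩ := pow_unbounded_of_one_lt (C ^ (L + 1)) hδ
  refine ⟨C ^ m₀, fun m n hmn => ?_⟩
  have hC0 : 0 ≤ C := zero_le_one.trans hC
  have hδ0 : 0 ≤ δ := zero_le_one.trans hδ.le
  have hδn : 1 ≤ δ ^ n := one_le_pow₀ hδ.le
  have hCm : 1 ≤ C ^ m₀ := one_le_pow₀ hC
  rcases le_total m m₀ with h | h
  · calc C ^ m ≤ C ^ m₀ := pow_le_pow_right₀ hC h
      _ ≤ C ^ m₀ * δ ^ n := le_mul_of_one_le_right (zero_le_one.trans hCm) hδn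
  · have h1 : C ^ m ≤ δ ^ n := by
      apply le_of_pow_le_pow_left₀ (Nat.succ_ne_zero L) (pow_nonneg hδ0 n)
      calc (C ^ m) ^ (L + 1) = (C ^ (L + 1)) ^ m := by rw [← pow_mul, ← pow_mul, mul_comm]
        _ ≤ (δ ^ m₀) ^ m := pow_le_pow_left₀ (pow_nonneg hC0 _) hm₀.le m
        _ = δ ^ (m₀ * m) := (pow_mul _ _ _).symm
        _ ≤ δ ^ (n * (L + 1)) := by
            apply pow_le_pow_right₀ hδ.le
            nlinarith
        _ = (δ ^ n) ^ (L + 1) := pow_mul _ _ _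
    exact h1.trans (le_mul_of_one_le_left (pow_nonneg hδ0 n) hCm)

theorem sq_card_hookLength_lt_le (ν : YoungDiagram) (H : ℕ) :
    (ν.cells.filter fun c => hookLength ν c < H).card ^ 2 ≤ (H * H * 2) * ν.card := by
  have h1 : (ν.cells.filter fun c => hookLength ν c < H).card =
      ∑ h ∈ Finset.range H, (ν.cells.filter fun c => hookLength ν c = h).card := by
    rw [Finset.card_eq_sum_card_fiberwise (f := hookLength ν) (t := Finset.range H)]
    · refine Finset.sum_congr rfl fun h hh => ?_
      rw [Finset.mem_range] at hh
      rw [Finset.filter_filter]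
      congr 1
      ext c
      simp only [Finset.mem_filter, and_congr_right_iff]
      intro _
      omega
    · intro c hc
      simpa using (Finset.mem_filter.1 hc).2
  rw [h1]
  calc (∑ h ∈ Finset.range H, (ν.cells.filter fun c => hookLength ν c = h).card) ^ 2
      ≤ (Finset.range H).card *
          ∑ h ∈ Finset.range H, (ν.cells.filter fun c => hookLength ν c = h).card ^ 2 :=
        sq_sum_le_card_mul_sum_sq
    _ ≤ H * ∑ h ∈ Finset.range H, 2 * ν.card := by
        rw [Finset.card_range]
        exact Nat.mul_le_mul_left _ (Finset.sum_le_sum fun h _ => sq_card_hookLength_eq_le ν h)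
    _ = _ := by
        rw [Finset.sum_const, Finset.card_range, smul_eq_mul]
        ring

theorem exists_prod_hookLength_le {g : ℕ → ℝ} (hg0 : ∀ h, 0 ≤ g h) (hg : ∀ᶠ h in atTop, g h ≤ 1)
    {δ : ℝ} (hδ : 1 < δ) :
    ∃ A : ℝ, ∀ ν : YoungDiagram, ∏ c ∈ ν.cells, g (hookLength ν c) ≤ A * δ ^ ν.card := by
  obtain ⟨H, hH⟩ := eventually_atTop.1 hg
  set C : ℝ := 1 + ∑ h ∈ Finset.range H, g h with hC
  have hC1 : 1 ≤ C := le_add_of_nonneg_right (Finset.sum_nonneg fun h _ => hg0 h)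
  obtain ⟨A, hA⟩ := exists_pow_le_mul_pow hC1 hδ (H * H * 2)
  refine ⟨A, fun ν => le_trans ?_ (hA _ _ (sq_card_hookLength_lt_le ν H))⟩
  calc ∏ c ∈ ν.cells, g (hookLength ν c)
      ≤ ∏ c ∈ ν.cells, if hookLength ν c < H then C else 1 := by
        refine Finset.prod_le_prod (fun c _ => hg0 _) fun c _ => ?_
        split_ifs with h
        · have := Finset.single_le_sum (f := g) (fun h _ => hg0 h) (Finset.mem_range.2 h)
          linarith
        · exact hH _ (not_lt.1 h)
    _ = _ := by rw [← Finset.prod_filter, Finset.prod_const]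

theorem summable_of_fibre_bound {X Y : Type*} {f : X × Y → ℂ} {B : Y → ℝ} (hB : Summable B)
    (h : ∀ y, ∀ u : Finset X, ∑ x ∈ u, ‖f (x, y)‖ ≤ B y) : Summable f := by
  classical
  have hB0 : ∀ y, 0 ≤ B y := fun y => by simpa using h y ∅
  apply Summable.of_norm
  apply summable_of_sum_le (c := ∑' y, B y) fun x => norm_nonneg _
  intro u
  calc ∑ x ∈ u, ‖f x‖ ≤ ∑ x ∈ u.image Prod.fst ×ˢ u.image Prod.snd, ‖f x‖ := by
        apply Finset.sum_le_sum_of_subset_of_nonneg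
        · exact Finset.subset_product
        · exact fun _ _ _ => norm_nonneg _
    _ = ∑ y ∈ u.image Prod.snd, ∑ x ∈ u.image Prod.fst, ‖f (x, y)‖ := Finset.sum_product_right _ _ _
    _ ≤ ∑ y ∈ u.image Prod.snd, B y := Finset.sum_le_sum fun y _ => h y _
    _ ≤ _ := hB.sum_le_tsum _ fun y _ => hB0 y

theorem summable_mul_pow_card {Q : ℂ} {w : YoungDiagram → ℂ} {P S : ℝ} (hS : 0 ≤ S)
    (hw : ∀ ν, ‖w ν‖ ≤ P * S ^ ν.card) (hQS : ‖Q‖ * S < 1) :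
    Summable fun ν : YoungDiagram => w ν * Q ^ ν.card := by
  refine Summable.of_norm_bounded
    ((summable_pow_card_real (mul_nonneg (norm_nonneg Q) hS) hQS).mul_left P) fun ν => ?_
  rw [norm_mul, norm_pow]
  refine (mul_le_mul_of_nonneg_right (hw ν) (pow_nonneg (norm_nonneg Q) _)).trans_eq ?_
  rw [mul_pow]
  ring

theorem exists_one_lt_mul_lt_one {ρ : ℝ} (h0 : 0 ≤ ρ) (h1 : ρ < 1) : ∃ δ, 1 < δ ∧ ρ * δ < 1 := by
  refine ⟨2 / (1 + ρ), ?_, ?_⟩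
  · rw [lt_div_iff₀ (by linarith)]
    linarith
  · rw [mul_div_assoc', div_lt_one (by linarith)]
    linarith

theorem tendsto_hook_factor {z : ℂ} (hz : ‖z‖ < 1) (y : ℝ) :
    Tendsto (fun h : ℕ => (1 + y * ‖z‖ ^ h) * (‖z‖ ^ h + y) / ‖1 - z ^ h‖ ^ 2) atTop (𝓝 y) := by
  have h1 : Tendsto (fun h : ℕ => ‖z‖ ^ h) atTop (𝓝 0) :=
    tendsto_pow_atTop_nhds_zero_of_lt_one (norm_nonneg z) hz
  have h2 : Tendsto (fun h : ℕ => z ^ h) atTop (𝓝 0) :=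
    tendsto_pow_atTop_nhds_zero_of_norm_lt_one hz
  have h3 := (((h1.const_mul y).const_add 1).mul (h1.add_const y)).div
    (((h2.const_sub 1).norm).pow 2) (by simp)
  have h4 : (1 + y * 0) * (0 + y) / ‖(1 : ℂ) - 0‖ ^ 2 = y := by simp
  rw [h4] at h3
  exact h3

theorem sum_norm_zTerm_fibre_le {v Q Q₁ : ℂ} (hv0 : v ≠ 0) (hv : ‖v‖ < 1) (hQ₁ : ‖Q₁‖ ≤ 1)
    (ν : YoungDiagram) (u : Finset YoungDiagram) :
    ∑ μ ∈ u, ‖zTerm Q Q₁ v (μ, ν)‖ ≤ Real.exp ((1 - ‖v ^ 2‖)⁻¹ * (1 - ‖v ^ 2‖)⁻¹) *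
      (‖Q‖ ^ ν.card * ∏ c ∈ ν.cells, (1 + ‖Q₁‖ * ‖v ^ 2‖ ^ hookLength ν c) *
        (‖v ^ 2‖ ^ hookLength ν c + ‖Q₁‖) / ‖1 - (v ^ 2) ^ hookLength ν c‖ ^ 2) := by
  have h1 := (sum_norm_fibre_le_and_tendsto hv0 hv hQ₁ ν).1 u
  have h2 : ∀ μ, ‖zTerm Q Q₁ v (μ, ν)‖ =
      (‖Q‖ ^ ν.card * ∏ c ∈ ν.cells,
        ‖v ^ 2‖ ^ hookLength ν c / ‖1 - (v ^ 2) ^ hookLength ν c‖ ^ 2) *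
      ‖(-Q₁) ^ μ.card * jt (signedH (powerSum ν v)) μ *
        jt (signedH (powerSum ν.transpose v)) μ.transpose‖ := by
    intro μ
    rw [zTerm_eq hv0 hv, norm_mul, norm_mul, norm_pow, norm_neg, norm_prod]
    simp only [norm_div, norm_pow]
  rw [Finset.sum_congr rfl fun μ _ => h2 μ, ← Finset.mul_sum]
  have h3 : ∏ c ∈ ν.cells, (1 + ‖Q₁‖ * ‖v ^ 2‖ ^ hookLength ν c) *
        (‖v ^ 2‖ ^ hookLength ν c + ‖Q₁‖) / ‖1 - (v ^ 2) ^ hookLength ν c‖ ^ 2 =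
      (∏ c ∈ ν.cells, ‖v ^ 2‖ ^ hookLength ν c / ‖1 - (v ^ 2) ^ hookLength ν c‖ ^ 2) *
      ∏ c ∈ ν.cells, (1 + ‖Q₁‖ * ‖v ^ 2‖ ^ hookLength ν c) *
        (1 + ‖Q₁‖ * ‖v ^ 2‖ ^ (-(hookLength ν c : ℤ))) := by
    rw [← Finset.prod_mul_distrib]
    refine Finset.prod_congr rfl fun c _ => ?_
    have h4 : ‖v ^ 2‖ ^ hookLength ν c ≠ 0 :=
      pow_ne_zero _ (norm_ne_zero_iff.2 (pow_ne_zero 2 hv0))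
    rw [zpow_neg, zpow_natCast]
    generalize ‖v ^ 2‖ ^ hookLength ν c = y at h4 ⊢
    field_simp
  rw [h3]
  refine (mul_le_mul_of_nonneg_left h1 (mul_nonneg (by positivity)
    (Finset.prod_nonneg fun c _ => by positivity))).trans_eq ?_
  ring

theorem summable_zTerm_mul {v Q Q₁ : ℂ} (hv0 : v ≠ 0) (hv : ‖v‖ < 1) (hQ₁ : ‖Q₁‖ < 1)
    {w : YoungDiagram → ℂ} {P S : ℝ} (hS : 0 ≤ S) (hw : ∀ ν, ‖w ν‖ ≤ P * S ^ ν.card)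
    (hQS : ‖Q‖ * S < 1) :
    Summable fun x : YoungDiagram × YoungDiagram => zTerm Q Q₁ v x * w x.2 := by
  obtain ⟨δ, hδ, hρδ⟩ := exists_one_lt_mul_lt_one (mul_nonneg (norm_nonneg Q) hS) hQS
  obtain ⟨A, hA⟩ := exists_prod_hookLength_le (fun h => by positivity)
    ((tendsto_hook_factor (norm_sq_lt_one hv) ‖Q₁‖).eventually_le_const hQ₁) hδ
  have hρ0 : 0 ≤ ‖Q‖ * S * δ := by positivity
  refine summable_of_fibre_bound
    (B := fun ν => Real.exp ((1 - ‖v ^ 2‖)⁻¹ * (1 - ‖v ^ 2‖)⁻¹) * P * A * (‖Q‖ * S * δ) ^ ν.card)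
    ((summable_pow_card_real hρ0 hρδ).mul_left _) fun ν u => ?_
  have h1 := sum_norm_zTerm_fibre_le (Q := Q) hv0 hv hQ₁.le ν u
  have h2 := hA ν
  have h3 : ∑ μ ∈ u, ‖zTerm Q Q₁ v (μ, ν) * w ν‖ = (∑ μ ∈ u, ‖zTerm Q Q₁ v (μ, ν)‖) * ‖w ν‖ := by
    rw [Finset.sum_mul]
    exact Finset.sum_congr rfl fun μ _ => norm_mul _ _
  rw [h3]
  have hE := Real.exp_pos ((1 - ‖v ^ 2‖)⁻¹ * (1 - ‖v ^ 2‖)⁻¹)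
  generalize ∑ μ ∈ u, ‖zTerm Q Q₁ v (μ, ν)‖ = x at h1 ⊢
  generalize Real.exp ((1 - ‖v ^ 2‖)⁻¹ * (1 - ‖v ^ 2‖)⁻¹) = E at h1 hE ⊢
  have h4 := h1.trans (mul_le_mul_of_nonneg_left
    (mul_le_mul_of_nonneg_left h2 (pow_nonneg (norm_nonneg Q) ν.card)) hE.le)
  have h5 : 0 ≤ A * δ ^ ν.card := (Finset.prod_nonneg fun c _ => by positivity).trans h2
  refine (mul_le_mul h4 (hw ν) (norm_nonneg _) (by positivity)).trans_eq ?_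
  simp only [mul_pow]
  ring

/-! ### Summation over both partitions -/

/-- The weight of a hook of length `h` in the reduced partition function. -/
def hookWeight (Q₁ z : ℂ) (h : ℕ) : ℂ := (1 - Q₁ * z ^ h) * (Q₁ - z ^ h) / (1 - z ^ h) ^ 2

/-- The weight of a partition in the reduced partition function. -/
def hookProd (Q₁ z : ℂ) (ν : YoungDiagram) : ℂ := ∏ c ∈ ν.cells, hookWeight Q₁ z (hookLength ν c)

theorem tsum_zTerm_fibre {v Q Q₁ : ℂ} (hv0 : v ≠ 0) (hv : ‖v‖ < 1) (hQ₁ : ‖Q₁‖ ≤ 1)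
    (ν : YoungDiagram) :
    ∑' μ, zTerm Q Q₁ v (μ, ν) = vacuumSum Q₁ v * (Q ^ ν.card * hookProd Q₁ (v ^ 2) ν) := by
  simp only [zTerm_eq hv0 hv]
  rw [tsum_mul_left, tsum_fibre_eq hv0 hv hQ₁, neg_pow Q]
  have hz0 : v ^ 2 ≠ 0 := pow_ne_zero 2 hv0
  have h1 : (-1) ^ ν.card *
      (∏ c ∈ ν.cells, (v ^ 2) ^ hookLength ν c / (1 - (v ^ 2) ^ hookLength ν c) ^ 2) *
      ∏ c ∈ ν.cells, (1 - Q₁ * (v ^ 2) ^ hookLength ν c) *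
        (1 - Q₁ * (v ^ 2) ^ (-(hookLength ν c : ℤ))) = hookProd Q₁ (v ^ 2) ν := by
    rw [YoungDiagram.card, ← Finset.prod_const, ← Finset.prod_mul_distrib,
      ← Finset.prod_mul_distrib, hookProd]
    refine Finset.prod_congr rfl fun c _ => ?_
    have h4 : (v ^ 2) ^ hookLength ν c ≠ 0 := pow_ne_zero _ hz0
    rw [hookWeight, zpow_neg, zpow_natCast]
    field_simp
    ring
  rw [← h1]
  ring

theorem tsum_zTerm_mul {v Q Q₁ : ℂ} (hv0 : v ≠ 0) (hv : ‖v‖ < 1) (hQ₁ : ‖Q₁‖ < 1)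
    {w : YoungDiagram → ℂ} {P S : ℝ} (hS : 0 ≤ S) (hw : ∀ ν, ‖w ν‖ ≤ P * S ^ ν.card)
    (hQS : ‖Q‖ * S < 1) :
    ∑' x : YoungDiagram × YoungDiagram, zTerm Q Q₁ v x * w x.2 =
      vacuumSum Q₁ v * ∑' ν : YoungDiagram, Q ^ ν.card * hookProd Q₁ (v ^ 2) ν * w ν := by
  have hs := summable_zTerm_mul hv0 hv hQ₁ hS hw hQS
  rw [← (Equiv.prodComm YoungDiagram YoungDiagram).tsum_eq, Summable.tsum_prod]
  · rw [← tsum_mul_left]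
    refine tsum_congr fun ν => ?_
    simp only [Equiv.prodComm_apply, Prod.swap_prod_mk]
    rw [tsum_mul_right, tsum_zTerm_fibre hv0 hv hQ₁.le]
    ring
  · exact (Equiv.prodComm YoungDiagram YoungDiagram).summable_iff.2 hs

/-! ### The limit `q → 1` -/

section Limit

variable {t : ℕ} {ξ : ℂ}

theorem exists_le_norm_one_sub (ht : 1 < t) (hξ : IsPrimitiveRoot ξ t) :
    ∃ c : ℝ, 0 < c ∧ ∀ h : ℕ, ¬ t ∣ h → ∀ q ∈ Set.Ioo (0 : ℝ) 1, c ≤ ‖1 - (ξ * q) ^ h‖ := by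
  have hne : (Finset.Ico 1 t).Nonempty := ⟨1, Finset.mem_Ico.2 ⟨le_rfl, ht⟩⟩
  obtain ⟨k, hk, hmin⟩ := (Finset.Ico 1 t).exists_min_image (fun k => ‖1 - ξ ^ k‖) hne
  rw [Finset.mem_Ico] at hk
  refine ⟨‖1 - ξ ^ k‖ / 2, ?_, ?_⟩
  · have : ξ ^ k ≠ 1 := hξ.pow_ne_one_of_pos_of_lt (by omega) hk.2
    have : 0 < ‖1 - ξ ^ k‖ := norm_pos_iff.2 (sub_ne_zero.2 this.symm)
    linarith
  · intro h hh q hq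
    have hmod : ξ ^ h = ξ ^ (h % t) := by
      conv_lhs => rw [← Nat.div_add_mod h t, pow_add, pow_mul, hξ.pow_eq_one, one_pow, one_mul]
    have hlt : h % t < t := Nat.mod_lt _ (by omega)
    have hpos : h % t ≠ 0 := fun h0 => hh (Nat.dvd_of_mod_eq_zero h0)
    have h1 := hmin (h % t) (Finset.mem_Ico.2 ⟨by omega, hlt⟩)
    rw [← hmod] at h1
    have hnorm : ‖ξ ^ h‖ = 1 := by
      rw [norm_pow, hξ.norm'_eq_one (by omega), one_pow]
    have hqh0 : 0 ≤ q ^ h := pow_nonneg hq.1.le h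
    have hqh : q ^ h ≤ 1 := pow_le_one₀ hq.1.le hq.2.le
    have h2 : ‖(ξ * q) ^ h‖ = q ^ h := by
      rw [mul_pow, norm_mul, hnorm, one_mul, norm_pow, Complex.norm_real,
        Real.norm_of_nonneg hq.1.le]
    have h3 : 1 - q ^ h ≤ ‖1 - (ξ * q) ^ h‖ := by
      have := norm_sub_norm_le 1 ((ξ * q) ^ h)
      rwa [norm_one, h2] at this
    have h4 : ‖(ξ * q) ^ h - ξ ^ h‖ = 1 - q ^ h := by
      have : (ξ * q) ^ h - ξ ^ h = -(ξ ^ h * ((1 - q ^ h : ℝ) : ℂ)) := by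
        push_cast
        ring
      rw [this, norm_neg, norm_mul, hnorm, one_mul, Complex.norm_real,
        Real.norm_of_nonneg (by linarith)]
    have h5 : ‖1 - ξ ^ h‖ ≤ ‖1 - (ξ * q) ^ h‖ + ‖(ξ * q) ^ h - ξ ^ h‖ := by
      have := norm_add_le (1 - (ξ * q) ^ h) ((ξ * q) ^ h - ξ ^ h)
      rwa [sub_add_sub_cancel] at this
    linarith

theorem hookProd_eq_zero (ht : 0 < t) (hξ : IsPrimitiveRoot ξ t) (q : ℂ) {ν : YoungDiagram}
    (hν : ¬ IsTCore t ν) : hookProd (q ^ t) (ξ * q) ν = 0 := by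
  have h : ∃ c ∈ ν.cells, hookLength ν c = t := by
    by_contra hcon
    push Not at hcon
    exact hν (isTCore_of_hookLength_ne ht hcon)
  obtain ⟨c, hc, hct⟩ := h
  apply Finset.prod_eq_zero hc
  rw [hct, hookWeight, mul_pow, hξ.pow_eq_one, one_mul, sub_self, mul_zero, zero_div]

theorem norm_hookWeight_le {c q : ℝ} (hc : 0 < c) (hq : q ∈ Set.Ioo (0 : ℝ) 1) {h : ℕ}
    (hξ1 : ‖ξ‖ = 1) (hch : c ≤ ‖1 - (ξ * q) ^ h‖) :
    ‖hookWeight ((q : ℂ) ^ t) (ξ * q) h‖ ≤ (1 + (1 - q ^ t) / c) ^ 2 := by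
  set y := (ξ * q) ^ h with hy
  set d := ‖1 - y‖ with hd
  have hd0 : 0 < d := hc.trans_le hch
  have hqt : q ^ t ≤ 1 := pow_le_one₀ hq.1.le hq.2.le
  have hy1 : ‖y‖ ≤ 1 := by
    rw [hy, norm_pow, norm_mul, hξ1, one_mul, Complex.norm_real, Real.norm_of_nonneg hq.1.le]
    exact pow_le_one₀ hq.1.le hq.2.le
  have hε : ‖(1 : ℂ) - (q : ℂ) ^ t‖ = 1 - q ^ t := by
    have : (1 : ℂ) - (q : ℂ) ^ t = ((1 - q ^ t : ℝ) : ℂ) := by push_cast; ring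
    rw [this, Complex.norm_real, Real.norm_of_nonneg (by linarith)]
  have h1 : ‖1 - (q : ℂ) ^ t * y‖ ≤ d + (1 - q ^ t) := by
    calc ‖1 - (q : ℂ) ^ t * y‖ = ‖(1 - y) + y * (1 - (q : ℂ) ^ t)‖ := by ring_nf
      _ ≤ ‖1 - y‖ + ‖y * (1 - (q : ℂ) ^ t)‖ := norm_add_le _ _
      _ ≤ d + 1 * (1 - q ^ t) := by
          rw [norm_mul, hε]
          exact add_le_add_right (mul_le_mul_of_nonneg_right hy1 (by linarith)) _
      _ = _ := by ring
  have h2 : ‖(q : ℂ) ^ t - y‖ ≤ d + (1 - q ^ t) := by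
    calc ‖(q : ℂ) ^ t - y‖ = ‖(1 - y) - (1 - (q : ℂ) ^ t)‖ := by ring_nf
      _ ≤ ‖1 - y‖ + ‖1 - (q : ℂ) ^ t‖ := norm_sub_le _ _
      _ = _ := by rw [hε]
  rw [hookWeight, norm_div, norm_mul, norm_pow, ← hy, ← hd, div_le_iff₀ (by positivity)]
  have h3 : (1 - q ^ t) / d ≤ (1 - q ^ t) / c :=
    div_le_div_of_nonneg_left (by linarith) hc hch
  have h4 : d + (1 - q ^ t) = (1 + (1 - q ^ t) / d) * d := by field_simp
  have h5 : 0 ≤ (1 - q ^ t) / d := div_nonneg (by linarith) hd0.le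
  calc _ ≤ (d + (1 - q ^ t)) * (d + (1 - q ^ t)) :=
        mul_le_mul h1 h2 (norm_nonneg _) (by linarith)
    _ = (1 + (1 - q ^ t) / d) ^ 2 * d ^ 2 := by
        rw [h4]
        ring
    _ ≤ _ := mul_le_mul_of_nonneg_right (pow_le_pow_left₀ (by linarith) (by linarith) 2)
        (by positivity)

theorem tendsto_hookProd (hξ : IsPrimitiveRoot ξ t) {ν : YoungDiagram} (hν : IsTCore t ν) :
    Tendsto (fun q : ℝ => hookProd ((q : ℂ) ^ t) (ξ * q) ν) (𝓝[<] 1) (𝓝 1) := by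
  have hq : Tendsto (fun q : ℝ => (q : ℂ)) (𝓝[<] 1) (𝓝 1) := by
    have := (Complex.continuous_ofReal.tendsto 1).mono_left (nhdsWithin_le_nhds (s := Set.Iio 1))
    simpa using this
  have h : Tendsto (fun q : ℝ => hookProd ((q : ℂ) ^ t) (ξ * q) ν) (𝓝[<] 1)
      (𝓝 (∏ c ∈ ν.cells, (1 : ℂ))) := by
    refine tendsto_finsetProd _ fun c hc => ?_
    have hne : (1 : ℂ) - ξ ^ hookLength ν c ≠ 0 := by
      intro h0
      exact hν c hc ((hξ.pow_eq_one_iff_dvd _).1 (sub_eq_zero.1 h0).symm)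
    have h1 : Tendsto (fun q : ℝ => (ξ * q) ^ hookLength ν c) (𝓝[<] 1)
        (𝓝 (ξ ^ hookLength ν c)) := by
      simpa using (hq.const_mul ξ).pow (hookLength ν c)
    have h2 : Tendsto (fun q : ℝ => (q : ℂ) ^ t) (𝓝[<] 1) (𝓝 1) := by
      simpa using hq.pow t
    have h3 := (((h2.mul h1).const_sub 1).mul (h2.sub h1)).div ((h1.const_sub 1).pow 2)
      (pow_ne_zero 2 hne)
    have h4 : (1 - 1 * ξ ^ hookLength ν c) * (1 - ξ ^ hookLength ν c) /
        (1 - ξ ^ hookLength ν c) ^ 2 = 1 := by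
      field_simp
    rw [h4] at h3
    exact h3
  simpa using h

theorem tendsto_tsum_hookProd (ht : 1 < t) (hξ : IsPrimitiveRoot ξ t) {Q : ℂ}
    {w : YoungDiagram → ℂ} {P S : ℝ} (hS : 0 ≤ S) (hw : ∀ ν, ‖w ν‖ ≤ P * S ^ ν.card)
    (hQS : ‖Q‖ * S < 1) :
    Tendsto (fun q : ℝ => ∑' ν : YoungDiagram,
        Q ^ ν.card * hookProd ((q : ℂ) ^ t) (ξ * q) ν * w ν) (𝓝[<] 1)
      (𝓝 (∑' ν : {ν : YoungDiagram // IsTCore t ν}, w ν.1 * Q ^ ν.1.card)) := by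
  have hcore : ∀ q : ℝ, ∑' ν : YoungDiagram, Q ^ ν.card * hookProd ((q : ℂ) ^ t) (ξ * q) ν * w ν =
      ∑' ν : {ν : YoungDiagram // IsTCore t ν},
        Q ^ ν.1.card * hookProd ((q : ℂ) ^ t) (ξ * q) ν.1 * w ν.1 := by
    intro q
    symm
    apply tsum_subtype_eq_of_support_subset (s := {ν : YoungDiagram | IsTCore t ν})
      (f := fun ν => Q ^ ν.card * hookProd ((q : ℂ) ^ t) (ξ * q) ν * w ν)
    intro ν hν
    by_contra hcon
    apply hν
    dsimp only
    rw [hookProd_eq_zero (by omega) hξ _ hcon, mul_zero, zero_mul]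
  simp only [hcore]
  obtain ⟨c, hc, hcle⟩ := exists_le_norm_one_sub ht hξ
  have hP : 0 ≤ P := by
    have := (norm_nonneg _).trans (hw ⊥)
    simpa using this
  have hρ0 : 0 ≤ ‖Q‖ * S := mul_nonneg (norm_nonneg Q) hS
  obtain ⟨δ, hδ, hρδ⟩ := exists_one_lt_mul_lt_one hρ0 hQS
  have hlim : Tendsto (fun q : ℝ => (1 + (1 - q ^ t) / c) ^ 2) (𝓝[<] 1) (𝓝 1) := by
    have h1 : Continuous fun q : ℝ => (1 + (1 - q ^ t) / c) ^ 2 := by fun_prop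
    have h2 := (h1.tendsto 1).mono_left (nhdsWithin_le_nhds (s := Set.Iio (1 : ℝ)))
    simpa using h2
  have hnorm : ‖ξ‖ = 1 := hξ.norm'_eq_one (by omega)
  apply tendsto_tsum_of_dominated_convergence
    (bound := fun ν : {ν : YoungDiagram // IsTCore t ν} => P * (‖Q‖ * S * δ) ^ ν.1.card)
  · exact ((summable_pow_card_real (by positivity) hρδ).subtype
      {ν : YoungDiagram | IsTCore t ν}).mul_left P
  · rintro ⟨ν, hν⟩
    have := ((tendsto_hookProd hξ hν).const_mul (Q ^ ν.card)).mul_const (w ν)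
    rw [mul_one, mul_comm (Q ^ ν.card) (w ν)] at this
    exact this
  · have hev : ∀ᶠ q : ℝ in 𝓝[<] 1, q ∈ Set.Ioo (0 : ℝ) 1 :=
      Ioo_mem_nhdsLT zero_lt_one
    filter_upwards [hev, hlim.eventually_le_const hδ] with q hq hqδ
    rintro ⟨ν, hν⟩
    have h1 : ‖hookProd ((q : ℂ) ^ t) (ξ * q) ν‖ ≤ δ ^ ν.card := by
      rw [hookProd, norm_prod, YoungDiagram.card, ← Finset.prod_const]
      refine Finset.prod_le_prod (fun _ _ => norm_nonneg _) fun b hb => ?_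
      exact (norm_hookWeight_le hc hq hnorm (hcle _ (hν b hb) q hq)).trans hqδ
    dsimp only
    rw [norm_mul, norm_mul, norm_pow]
    calc _ ≤ ‖Q‖ ^ ν.card * δ ^ ν.card * (P * S ^ ν.card) :=
          mul_le_mul (mul_le_mul_of_nonneg_left h1 (by positivity)) (hw ν) (norm_nonneg _)
            (by positivity)
      _ = _ := by
          rw [mul_pow, mul_pow]
          ring

end Limit

/-! ### The correlation factors -/

theorem norm_zpow_twiceMaya_le {a : ℂ} (ha : 1 < ‖a‖) (ν : YoungDiagram) (i : ℕ) :
    ‖a ^ twiceMaya ν i‖ ≤ (‖a‖ ^ 2) ^ ν.card * ((‖a‖ ^ 2)⁻¹) ^ i := by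
  have h0 : ‖a‖ ≠ 0 := by positivity
  have h1 : (‖a‖ ^ 2) ^ ν.card * ((‖a‖ ^ 2)⁻¹) ^ i = ‖a‖ ^ (2 * (ν.card : ℤ) - 2 * i) := by
    rw [inv_pow, ← pow_mul, ← pow_mul, ← zpow_natCast, ← zpow_natCast, ← zpow_neg,
      ← zpow_add₀ h0]
    congr 1
  rw [h1, norm_zpow]
  apply zpow_le_zpow_right₀ ha.le
  have := rowLen_le_card ν i
  simp only [twiceMaya]
  omega

theorem summable_geometric_inv_sq {a : ℂ} (ha : 1 < ‖a‖) :
    Summable fun i : ℕ => ((‖a‖ ^ 2)⁻¹) ^ i :=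
  summable_geometric_of_lt_one (by positivity) (inv_lt_one_of_one_lt₀ (one_lt_pow₀ ha two_ne_zero))

theorem summable_zpow_twiceMaya {a : ℂ} (ha : 1 < ‖a‖) (ν : YoungDiagram) :
    Summable fun i : ℕ => a ^ twiceMaya ν i :=
  Summable.of_norm_bounded ((summable_geometric_inv_sq ha).mul_left _)
    (norm_zpow_twiceMaya_le ha ν)

theorem norm_pointProd_le {n : ℕ} {r : Fin n → ℂ} (hr : ∀ j, 1 < ‖r j‖) (ν : YoungDiagram) :
    ‖pointProd ν r‖ ≤ (∏ j, ∑' i : ℕ, ((‖r j‖ ^ 2)⁻¹) ^ i) * (∏ j, ‖r j‖ ^ 2) ^ ν.card := by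
  rw [pointProd, norm_prod, ← Finset.prod_pow, ← Finset.prod_mul_distrib]
  refine Finset.prod_le_prod (fun _ _ => norm_nonneg _) fun j _ => ?_
  rw [mul_comm, ← tsum_mul_left]
  exact tsum_of_norm_bounded ((summable_geometric_inv_sq (hr j)).mul_left _).hasSum
    (norm_zpow_twiceMaya_le (hr j) ν)

end TCore

end

theorem theorem1p1 (t : ℕ) (ht : 1 < t) (ξ : ℂ) (hξ : IsPrimitiveRoot ξ t)
    (v : ℝ → ℂ) (hv : ∀ q ∈ Set.Ioo (0 : ℝ) 1, v q ^ 2 = ξ * (q : ℂ))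
    (n : ℕ) (Q : ℂ) (s r : Fin n → ℂ) (hr : ∀ j, r j ^ 2 = s j)
    (hs : ∀ j, 1 < ‖s j‖) (hQ : ‖Q‖ * ∏ j, ‖s j‖ < 1) :
    -- convergence of everything that occurs in the two `n`-point functions
    (∀ (ν : YoungDiagram) (j : Fin n), Summable fun i : ℕ => r j ^ TCore.twiceMaya ν i) ∧
    (Summable fun ν : {ν : YoungDiagram // TCore.IsTCore t ν} => Q ^ ν.1.card) ∧
    TCore.coreSum t Q ≠ 0 ∧
    (Summable fun ν : {ν : YoungDiagram // TCore.IsTCore t ν} =>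
      TCore.pointProd ν.1 r * Q ^ ν.1.card) ∧
    (∀ q ∈ Set.Ioo (0 : ℝ) 1,
      Summable (TCore.zTerm Q ((q : ℂ) ^ t) (v q)) ∧
      Summable fun x : YoungDiagram × YoungDiagram =>
        TCore.zTerm Q ((q : ℂ) ^ t) (v q) x * TCore.pointProd x.2 r) ∧
    (∀ᶠ q : ℝ in 𝓝[<] 1, TCore.partitionZ Q ((q : ℂ) ^ t) (v q) ≠ 0) ∧
    -- the limit formula
    Tendsto (fun q : ℝ => TCore.nPointZ Q ((q : ℂ) ^ t) (v q) r) (𝓝[<] 1)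
      (𝓝 (TCore.nPointF t Q r)) := by
  have hrs : ∀ j, ‖r j‖ ^ 2 = ‖s j‖ := fun j => by rw [← norm_pow, hr]
  have hr1 : ∀ j, 1 < ‖r j‖ := by
    intro j
    by_contra h
    have h1 := pow_le_one₀ (n := 2) (norm_nonneg (r j)) (not_lt.1 h)
    rw [hrs] at h1
    exact absurd (hs j) (not_lt.2 h1)
  have hS1 : 1 ≤ ∏ j, ‖s j‖ := Finset.prod_induction _ (1 ≤ ·)
    (fun a b ha hb => one_le_mul_of_one_le_of_one_le ha hb) le_rfl fun j _ => (hs j).le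
  have hS0 : 0 ≤ ∏ j, ‖s j‖ := zero_le_one.trans hS1
  have hQ1 : ‖Q‖ < 1 := (le_mul_of_one_le_right (norm_nonneg Q) hS1).trans_lt hQ
  have hw := TCore.norm_pointProd_le hr1
  simp only [hrs] at hw
  have hw1 : ∀ ν : YoungDiagram, ‖(1 : ℂ)‖ ≤ 1 * (1 : ℝ) ^ ν.card := fun ν => by simp
  have hQ1' : ‖Q‖ * 1 < 1 := by rwa [mul_one]
  have hvq : ∀ q ∈ Set.Ioo (0 : ℝ) 1, v q ≠ 0 ∧ ‖v q‖ < 1 ∧ ‖(q : ℂ) ^ t‖ < 1 := by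
    intro q hq
    have h1 : ‖v q‖ ^ 2 = q := by
      rw [← norm_pow, hv q hq, norm_mul, hξ.norm'_eq_one (by omega), one_mul, Complex.norm_real,
        Real.norm_of_nonneg hq.1.le]
    refine ⟨?_, ?_, ?_⟩
    · intro h0
      rw [h0, norm_zero] at h1
      exact hq.1.ne (by simpa using h1)
    · by_contra h
      have h2 := one_le_pow₀ (n := 2) (not_lt.1 h)
      rw [h1] at h2
      exact absurd hq.2 (not_lt.2 h2)
    · rw [norm_pow, Complex.norm_real, Real.norm_of_nonneg hq.1.le]
      exact pow_lt_one₀ hq.1.le hq.2 (by omega)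
  have hcoreS : Summable fun ν : {ν : YoungDiagram // TCore.IsTCore t ν} => Q ^ ν.1.card :=
    (TCore.summable_pow_card hQ1).subtype {ν : YoungDiagram | TCore.IsTCore t ν}
  have hcore0 := TCore.coreSum_ne_zero (t := t) (by omega) hQ1
  have hden := TCore.tendsto_tsum_hookProd ht hξ (w := fun _ => 1) zero_le_one hw1 hQ1'
  simp only [one_mul] at hden
  have hnum := TCore.tendsto_tsum_hookProd ht hξ (w := fun ν => TCore.pointProd ν r) hS0 hw hQ
  have hev : ∀ᶠ q : ℝ in 𝓝[<] 1, q ∈ Set.Ioo (0 : ℝ) 1 := Ioo_mem_nhdsLT zero_lt_one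
  have hZ : ∀ q ∈ Set.Ioo (0 : ℝ) 1, TCore.partitionZ Q ((q : ℂ) ^ t) (v q) =
      TCore.vacuumSum ((q : ℂ) ^ t) (v q) *
        ∑' ν : YoungDiagram, Q ^ ν.card * TCore.hookProd ((q : ℂ) ^ t) (ξ * q) ν * 1 := by
    intro q hq
    obtain ⟨h0, h1, h2⟩ := hvq q hq
    have := TCore.tsum_zTerm_mul h0 h1 h2 (w := fun _ => 1) zero_le_one hw1 hQ1'
    rw [hv q hq] at this
    rw [TCore.partitionZ]
    simpa only [mul_one] using this
  have hne : ∀ᶠ q : ℝ in 𝓝[<] 1,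
      ∑' ν : YoungDiagram, Q ^ ν.card * TCore.hookProd ((q : ℂ) ^ t) (ξ * q) ν * 1 ≠ 0 :=
    hden.eventually_ne hcore0
  refine ⟨fun ν j => TCore.summable_zpow_twiceMaya (hr1 j) ν, hcoreS, hcore0, ?_, ?_, ?_, ?_⟩
  · exact (TCore.summable_mul_pow_card (w := fun ν => TCore.pointProd ν r) hS0 hw hQ).subtype {ν : YoungDiagram | TCore.IsTCore t ν}
  · intro q hq
    obtain ⟨h0, h1, h2⟩ := hvq q hq
    refine ⟨?_, TCore.summable_zTerm_mul h0 h1 h2 (w := fun ν => TCore.pointProd ν r) hS0 hw hQ⟩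
    simpa only [mul_one] using
      TCore.summable_zTerm_mul h0 h1 h2 (w := fun _ => 1) zero_le_one hw1 hQ1'
  · filter_upwards [hev, hne] with q hq hq0
    obtain ⟨h0, h1, h2⟩ := hvq q hq
    rw [hZ q hq]
    exact mul_ne_zero (TCore.vacuumSum_ne_zero h0 h1 h2.le) hq0
  · have hlim := ((tendsto_const_nhds (x := (1 : ℂ))).div hden hcore0).mul hnum
    refine hlim.congr' ?_
    filter_upwards [hev, hne] with q hq hq0
    obtain ⟨h0, h1, h2⟩ := hvq q hq
    have hnumZ := TCore.tsum_zTerm_mul h0 h1 h2 (w := fun ν => TCore.pointProd ν r) hS0 hw hQ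
    rw [hv q hq] at hnumZ
    have hvac := TCore.vacuumSum_ne_zero h0 h1 h2.le
    rw [TCore.nPointZ, hZ q hq, hnumZ]
    simp only [mul_one, Pi.div_apply] at hq0 ⊢
    generalize (∑' ν : YoungDiagram, Q ^ ν.card * TCore.hookProd ((q : ℂ) ^ t) (ξ * q) ν) = D
      at hq0 ⊢
    field_simp
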